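/- Let $\Bbbk$ be a field and let $\Lambda_3$ be the exterior $\Bbbk$-algebra on $\partial_1,\partial_2,\partial_3$ ($\partial_j^2=0$, $\partial_j\partial_l=-\partial_l\partial_j$ for $j\neq l$), trigraded by $\deg\partial_j=e_j\in\mathbb Z^3$. Let $\mathcal M_3$ be the category of trigraded left $\Lambda_3$-modules $M=\bigoplus_{(i,j,k)\in\mathbb Z^3}M_{i,j,k}$ and degree-preserving $\Lambda_3$-linear maps. Tensor products over $\Bbbk$ are formed with $\partial_l(m\otimes n)=\partial_l m\otimes n+(-1)^{|m|}m\otimes\partial_l n$, where $|m|$ is the total degree of $m$. For $a\in\mathbb Z^3$, $M\{a\}$ denotes the shifted module, $(M\{a\})_n=M_{n-a}$, on which each $\partial_l$ acts by $(-1)^{a_1+a_2+a_3}\partial_l$. Let $Q=\Lambda_3\omega/\Lambda_3\partial_3\omega$, with basis $\omega,\partial_1\omega,\partial_2\omega,\partial_1\partial_2\omega$. For $M\in\mathcal M_3$ let $M_{i,j}$ be $\bigoplus_k M_{i,j,k}$ with the $\partial_3$ of $M$ and with $\partial_1=\partial_2=0$. For $r\in\mathbb Z$ put $\mathcal U_r(M)=\bigoplus_{i-j=r}Q\otimes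 M_{i,j}$. Let $\mathrm{in}_r\colon\mathcal U_r(M)\to M$ be the natural morphism with $q\omega\otimes m\mapsto qm$ for $q\in\{1,\partial_1,\partial_2,\partial_1\partial_2\}$. Let $\mathrm{out}_r\colon M\to\mathcal U_r(M)\{-1,-1,0\}$ be the natural morphism sending $m\in M_{i,j,k}$ to $$(-1)^{i+j}\,\pi_r\bigl(\omega\otimes\partial_1\partial_2m+\partial_1\omega\otimes\partial_2m-\partial_2\omega\otimes\partial_1m+\partial_1\partial_2\omega\otimes m\bigr),$$ where $\pi_r$ keeps the terms whose second factor lies in some $M_{i',j'}$ with $i'-j'=r$. For a morphism $f\colon M\to N$ of $\mathcal M_3$, the $\partial_3$-cone $\mathrm C_3(f)$ is the trigraded space $M\{0,0,-1\}\oplus N$ with $\partial_3(m,n)=(-\partial_3m,\,f(m)+\partial_3n)$ and $\partial_l(m,n)=(-\partial_lm,\,\partial_ln)$ for $l=1,2$, where $\partial_1,\partial_2,\partial_3$ on the right-hand sides are those of $M$ and $N$. Define endofunctors of $\mathcal M_3$ by $\mathcal R_r=\mathrm C_3(\mathrm{in}_r)$ and $\mathcal R'_r=\mathrm C_3(\mathrm{out}_r)\{0,0,1\}$.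 Let $\mathcal{SM}_3$ be the stable category: the objects of $\mathcal M_3$, with the morphisms of $\mathcal M_3$ modulo those that factor through a projective object. Its suspension is $M[1]=\operatorname{coker}\bigl(M\to\Lambda_3\otimes M\{-1,-1,-1\}\bigr)$, $m\mapsto\partial_1\partial_2\partial_3\otimes m$. Its distinguished triangles are those isomorphic to $M\xrightarrow{f}N\to\operatorname{cone}(f)\to M[1]$, where $f$ is a morphism of $\mathcal M_3$, $\operatorname{cone}(f)$ is the cokernel of $M\to N\oplus(\Lambda_3\otimes M\{-1,-1,-1\})$, $m\mapsto(f(m),\partial_1\partial_2\partial_3\otimes m)$, and the last map is induced by $(n,p)\mapsto-p$. An endofunctor of $\mathcal{SM}_3$ is exact if it commutes with $[1]$ up to a natural isomorphism by means of which it preserves distinguished triangles. **Theorem.** For every $r\in\mathbb Z$ the functors $\mathcal R_r$ and $\mathcal R'_r$ descend to exact endofunctors of $\mathcal{SM}_3$, denoted by the same symbols, and: (i) $\mathcal R_r$ and $\mathcal R'_r$ are mutually inverse: $\mathcal R'_r\mathcal R_r\cong\mathrm{Id}\cong\mathcal R_r\mathcal R'_r$ on $\mathcal{SM}_3$. (ii)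 There are isomorphisms of functors $\mathcal R_r\mathcal R_{r+1}\mathcal R_r\cong\mathcal R_{r+1}\mathcal R_r\mathcal R_{r+1}$, and $\mathcal R_r\mathcal R_s\cong\mathcal R_s\mathcal R_r$ whenever $|r-s|>1$. Consequently the $\mathcal R_r$ give an action of $\mathrm{Br}_\infty$ on the triangulated category $\mathcal{SM}_3$, where $\mathrm{Br}_\infty$ is the group with generators $\sigma_r$ ($r\in\mathbb Z$) and relations $\sigma_r\sigma_{r+1}\sigma_r=\sigma_{r+1}\sigma_r\sigma_{r+1}$ for all $r$ and $\sigma_r\sigma_s=\sigma_s\sigma_r$ for $|r-s|>1$. That is, there are exact functors $\Phi_g\colon\mathcal{SM}_3\to\mathcal{SM}_3$, $g\in\mathrm{Br}_\infty$, with $\Phi_1\cong\mathrm{Id}$, $\Phi_{gh}\cong\Phi_g\Phi_h$ for all $g,h$, and $\Phi_{\sigma_r}\cong\mathcal R_r$ for all $r$. -/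

import Mathlib

open CategoryTheory

universe v u

/-- Trigraded left modules over the exterior algebra `Λ₃` on `∂₁, ∂₂, ∂₃` (indexed here by
`s = 0, 1, 2`): a `k`-vector space, which is the internal direct sum of its pieces `gr n`,
`n ∈ ℤ³`, with operators `d s` of degree `e_s` that square to zero and anticommute. -/
structure TriMod (k : Type u) [Field k] where
  carrier : Type v
  [addCommGroup : AddCommGroup carrier]
  [module : Module k carrier]
  gr : (Fin 3 → ℤ) → Submodule k carrier
  isInternal : DirectSum.IsInternal gr
  d : Fin 3 → carrier →ₗ[k] carrier
  d_mem : ∀ s n x, x ∈ gr n → d s x ∈ gr (n + Pi.single s 1)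
  d_sq : ∀ s x, d s (d s x) = 0
  d_anticomm : ∀ s t x, s ≠ t → d s (d t x) = -d t (d s x)

namespace TriMod

variable {k : Type u} [Field k]

instance : CoeSort (TriMod.{v} k) (Type v) := ⟨TriMod.carrier⟩

instance (M : TriMod.{v} k) : AddCommGroup M := M.addCommGroup

instance (M : TriMod.{v} k) : Module k M := M.module

/-- Morphisms of trigraded `Λ₃`-modules: degree-preserving `Λ₃`-linear maps. -/
@[ext]
structure Hom (M N : TriMod.{v} k) where
  lin : M →ₗ[k] N
  map_gr : ∀ n x, x ∈ M.gr n → lin x ∈ N.gr n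
  map_d : ∀ s x, lin (M.d s x) = N.d s (lin x)

/-- The category `ℳ₃` of trigraded `Λ₃`-modules. -/
instance : Category (TriMod.{v} k) where
  Hom M N := Hom M N
  id M := ⟨LinearMap.id, fun _ _ h => h, fun _ _ => rfl⟩
  comp f g := ⟨g.lin ∘ₗ f.lin, fun n x h => g.map_gr n _ (f.map_gr n x h),
    fun s x => by simp [f.map_d, g.map_d]⟩

@[ext]
theorem hom_ext {M N : TriMod.{v} k} {f g : M ⟶ N} (h : ∀ x : M, f.lin x = g.lin x) : f = g :=
  Hom.ext (LinearMap.ext h)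

@[simp] theorem id_lin (M : TriMod.{v} k) : Hom.lin (𝟙 M) = LinearMap.id := rfl

@[simp] theorem comp_lin {M N P : TriMod.{v} k} (f : M ⟶ N) (g : N ⟶ P) :
    (f ≫ g).lin = g.lin ∘ₗ f.lin := rfl

instance (M N : TriMod.{v} k) : Zero (M ⟶ N) :=
  ⟨⟨0, fun _ _ _ => by simp, fun _ _ => by simp⟩⟩

instance (M N : TriMod.{v} k) : Add (M ⟶ N) :=
  ⟨fun f g => ⟨f.lin + g.lin,
    fun n x h => Submodule.add_mem _ (f.map_gr n x h) (g.map_gr n x h),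
    fun s x => by simp [f.map_d, g.map_d]⟩⟩

instance (M N : TriMod.{v} k) : Neg (M ⟶ N) :=
  ⟨fun f => ⟨-f.lin, fun n x h => Submodule.neg_mem _ (f.map_gr n x h),
    fun s x => by simp [f.map_d]⟩⟩

instance (M N : TriMod.{v} k) : Sub (M ⟶ N) :=
  ⟨fun f g => ⟨f.lin - g.lin,
    fun n x h => Submodule.sub_mem _ (f.map_gr n x h) (g.map_gr n x h),
    fun s x => by simp [f.map_d, g.map_d]⟩⟩

@[simp] theorem zero_lin (M N : TriMod.{v} k) : Hom.lin (0 : M ⟶ N) = 0 := rfl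
@[simp] theorem add_lin {M N : TriMod.{v} k} (f g : M ⟶ N) : (f + g).lin = f.lin + g.lin := rfl
@[simp] theorem neg_lin {M N : TriMod.{v} k} (f : M ⟶ N) : (-f).lin = -f.lin := rfl
@[simp] theorem sub_lin {M N : TriMod.{v} k} (f g : M ⟶ N) : (f - g).lin = f.lin - g.lin := rfl

instance (M N : TriMod.{v} k) : AddCommGroup (M ⟶ N) where
  add_assoc _ _ _ := by ext; simp [add_assoc]
  zero_add _ := by ext; simp
  add_zero _ := by ext; simp
  nsmul := nsmulRec
  zsmul := zsmulRec
  neg_add_cancel _ := by ext; simp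
  add_comm _ _ := by ext; simp [add_comm]
  sub_eq_add_neg _ _ := by ext; simp [sub_eq_add_neg]

instance : Preadditive (TriMod.{v} k) where
  add_comp _ _ _ _ _ _ := by ext; simp
  comp_add _ _ _ _ _ _ := by ext; simp

/-! ### Gradings -/

section Grading

variable {V : Type v} [AddCommGroup V] [Module k V]

theorem isInternal_of_proj (gr : (Fin 3 → ℤ) → Submodule k V) (p : (Fin 3 → ℤ) → V →ₗ[k] V)
    (h1 : ∀ n x, x ∈ gr n → p n x = x) (h2 : ∀ n m x, n ≠ m → x ∈ gr n → p m x = 0)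
    (h3 : ∀ x, x ∈ ⨆ n, gr n) : DirectSum.IsInternal gr := by
  refine DirectSum.isInternal_submodule_of_iSupIndep_of_iSup_eq_top ?_
    (eq_top_iff.2 fun x _ => h3 x)
  intro n
  rw [disjoint_iff_inf_le]
  rintro x ⟨hx, hx'⟩
  have h4 : p n x = 0 := by
    have : (⨆ j, ⨆ (_ : j ≠ n), gr j) ≤ LinearMap.ker (p n) := by
      refine iSup_le fun j => iSup_le fun hj y hy => ?_
      exact h2 j n y hj hy
    exact this hx'
  rw [h1 n x hx] at h4
  simpa using h4

end Grading

/-- The operator that multiplies the piece of degree `n` by the scalar `c n`. -/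
noncomputable def scale (M : TriMod.{v} k) (c : (Fin 3 → ℤ) → k) : M →ₗ[k] M :=
  DirectSum.toModule k _ M (fun n => c n • (M.gr n).subtype) ∘ₗ
    (LinearEquiv.ofBijective (DirectSum.coeLinearMap M.gr) M.isInternal).symm.toLinearMap

theorem scale_of_mem (M : TriMod.{v} k) (c : (Fin 3 → ℤ) → k) {n : Fin 3 → ℤ} {x : M}
    (hx : x ∈ M.gr n) : M.scale c x = c n • x := by
  have : (LinearEquiv.ofBijective (DirectSum.coeLinearMap M.gr) M.isInternal).symm x
      = DirectSum.lof k _ (fun i => M.gr i) n ⟨x, hx⟩ := by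
    rw [LinearEquiv.symm_apply_eq]
    exact (DirectSum.coeLinearMap_lof M.gr n ⟨x, hx⟩).symm
  simp [scale, this]

theorem mem_iSup_gr (M : TriMod.{v} k) (x : M) : x ∈ ⨆ n, M.gr n := by
  rw [M.isInternal.submodule_iSup_eq_top]; trivial

/-- To prove a linear statement on all of `M`, check it on homogeneous elements. -/
theorem homogeneous_induction (M : TriMod.{v} k) {p : M → Prop}
    (hom : ∀ n x, x ∈ M.gr n → p x) (add : ∀ x y, p x → p y → p (x + y)) (x : M) : p x :=
  Submodule.iSup_induction _ (motive := p) (M.mem_iSup_gr x) hom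
    (hom 0 0 (Submodule.zero_mem _)) add

theorem lin_ext (M : TriMod.{v} k) {V : Type*} [AddCommGroup V] [Module k V] {f g : M →ₗ[k] V}
    (h : ∀ n x, x ∈ M.gr n → f x = g x) : f = g := by
  ext x
  induction x using M.homogeneous_induction with
  | hom n x hx => exact h n x hx
  | add x y hx hy => simp [hx, hy]

/-- The projection onto the piece of degree `n`. -/
noncomputable def proj (M : TriMod.{v} k) (n : Fin 3 → ℤ) : M →ₗ[k] M :=
  M.scale (Pi.single n 1)

theorem proj_of_mem (M : TriMod.{v} k) {n : Fin 3 → ℤ} {x : M} (hx : x ∈ M.gr n) :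
    M.proj n x = x := by
  simp [proj, M.scale_of_mem _ hx]

theorem proj_of_mem_ne (M : TriMod.{v} k) {n m : Fin 3 → ℤ} (h : n ≠ m) {x : M}
    (hx : x ∈ M.gr n) : M.proj m x = 0 := by
  simp [proj, M.scale_of_mem _ hx, Pi.single_eq_of_ne h]

theorem scale_mem (M : TriMod.{v} k) (c : (Fin 3 → ℤ) → k) {n : Fin 3 → ℤ} {x : M}
    (hx : x ∈ M.gr n) : M.scale c x ∈ M.gr n := by
  rw [M.scale_of_mem c hx]; exact Submodule.smul_mem _ _ hx

theorem proj_mem (M : TriMod.{v} k) (n : Fin 3 → ℤ) (x : M) : M.proj n x ∈ M.gr n := by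
  induction x using M.homogeneous_induction with
  | hom m x hx =>
    by_cases h : m = n
    · subst h; rwa [M.proj_of_mem hx]
    · rw [M.proj_of_mem_ne h hx]; exact Submodule.zero_mem _
  | add x y hx hy => rw [map_add]; exact Submodule.add_mem _ hx hy

theorem hom_scale {M N : TriMod.{v} k} (f : M ⟶ N) (c : (Fin 3 → ℤ) → k) (x : M) :
    f.lin (M.scale c x) = N.scale c (f.lin x) := by
  induction x using M.homogeneous_induction with
  | hom n x hx => rw [M.scale_of_mem c hx, N.scale_of_mem c (f.map_gr n x hx), map_smul]
  | add x y hx hy => simp [hx, hy]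

/-! ### Grading shifts -/

/-- The grading shift `M{a}`, with `(M{a})_n = M_{n - a}`. As `M{a} = k{a} ⊗ M`, the differentials
carry the Koszul sign `(-1)^(a₁+a₂+a₃)`. -/
@[reducible] def shift (a : Fin 3 → ℤ) (M : TriMod.{v} k) : TriMod.{v} k where
  carrier := M
  gr n := M.gr (n - a)
  isInternal := by
    refine isInternal_of_proj _ (fun n => M.proj (n - a)) (fun n x hx => M.proj_of_mem hx)
      (fun n m x h hx => M.proj_of_mem_ne (fun h' => h (sub_left_injective h')) hx) fun x => ?_
    have := M.mem_iSup_gr x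
    rwa [← (Equiv.subRight a).iSup_comp (g := M.gr)] at this
  d s := (∑ i, a i).negOnePow • M.d s
  d_mem s n x hx := by
    have := M.d_mem s _ x hx
    rw [show n - a + Pi.single s 1 = n + Pi.single s 1 - a by abel] at this
    rcases Int.units_eq_one_or (∑ i, a i).negOnePow with h | h <;> simpa [h] using this
  d_sq s x := by
    rcases Int.units_eq_one_or (∑ i, a i).negOnePow with h | h <;> simp [h, M.d_sq]
  d_anticomm s t x hst := by
    rcases Int.units_eq_one_or (∑ i, a i).negOnePow with h | h <;>
      simp [h, M.d_anticomm s t x hst]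

/-- The grading shift as an endofunctor of `ℳ₃`. -/
def shiftFunctor (k : Type u) [Field k] (a : Fin 3 → ℤ) : TriMod.{v} k ⥤ TriMod.{v} k where
  obj M := M.shift a
  map f := ⟨f.lin, fun n x hx => f.map_gr _ x hx, fun s x => by
    change f.lin (((∑ i, a i).negOnePow • _ : _ →ₗ[k] _) x) =
      ((∑ i, a i).negOnePow • _ : _ →ₗ[k] _) (f.lin x)
    rcases Int.units_eq_one_or (∑ i, a i).negOnePow with h | h
    · rw [h, one_smul, one_smul]; exact f.map_d s x
    · rw [h, Units.neg_smul, one_smul, Units.neg_smul, one_smul, LinearMap.neg_apply,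
        LinearMap.neg_apply, map_neg]
      exact congrArg Neg.neg (f.map_d s x)⟩

/-! ### Tensoring with the exterior algebra on one generator -/

/-- The tensor product `Λ[∂ₛ] ⊗ M` of (super) trigraded `Λ₃`-modules, where `Λ[∂ₛ] = k ⊕ k∂ₛ`
is the exterior algebra on `∂ₛ`, on which the other two differentials vanish.
The pair `(x, y)` stands for `1 ⊗ x + ∂ₛ ⊗ y`. -/
@[reducible] def adjoin (s : Fin 3) (M : TriMod.{v} k) : TriMod.{v} k where
  carrier := M × M
  gr n := (M.gr n).prod (M.gr (n - Pi.single s 1))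
  isInternal := by
    refine isInternal_of_proj _
      (fun n => (M.proj n).prodMap (M.proj (n - Pi.single s 1)))
      (fun n x hx => Prod.ext (M.proj_of_mem hx.1) (M.proj_of_mem hx.2))
      (fun n m x h hx => Prod.ext (M.proj_of_mem_ne h hx.1)
        (M.proj_of_mem_ne (fun h' => h (sub_left_injective h')) hx.2)) ?_
    rintro ⟨x, y⟩
    rw [show (x, y) = LinearMap.inl k M M x + LinearMap.inr k M M y by simp]
    refine Submodule.add_mem _ ?_ ?_
    · induction x using M.homogeneous_induction with
      | hom n x hx =>
        exact Submodule.mem_iSup_of_mem n ⟨hx, Submodule.zero_mem _⟩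
      | add x y hx hy => rw [map_add]; exact Submodule.add_mem _ hx hy
    · induction y using M.homogeneous_induction with
      | hom n x hx =>
        exact Submodule.mem_iSup_of_mem (n + Pi.single s 1)
          ⟨Submodule.zero_mem _, by simpa using hx⟩
      | add x y hx hy => rw [map_add]; exact Submodule.add_mem _ hx hy
  d t := if t = s then
      (M.d s ∘ₗ LinearMap.fst k M M).prod (LinearMap.fst k M M - M.d s ∘ₗ LinearMap.snd k M M)
    else (M.d t ∘ₗ LinearMap.fst k M M).prod (-(M.d t ∘ₗ LinearMap.snd k M M))
  d_mem t n x hx := by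
    have h1 := M.d_mem t _ _ hx.1
    have h2 := M.d_mem t _ _ hx.2
    by_cases h : t = s
    · subst h
      have h3 := hx.1
      simp only [sub_add_cancel] at h2
      simp only [↓reduceIte, Submodule.mem_prod, LinearMap.prod_apply, add_sub_cancel_right]
      exact ⟨h1, Submodule.sub_mem _ h3 h2⟩
    · rw [sub_add_eq_add_sub] at h2
      simp only [h, ↓reduceIte]
      exact ⟨h1, Submodule.neg_mem _ h2⟩
  d_sq t x := by
    by_cases h : t = s
    · subst h; ext <;> simp [M.d_sq]
    · ext <;> simp [h, M.d_sq]
  d_anticomm t t' x htt := by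
    by_cases h : t = s
    · subst h; ext <;> simp [htt.symm, M.d_anticomm t t' _ htt]
    · by_cases h' : t' = s
      · subst h'; ext <;> simp [htt, M.d_anticomm t t' _ htt]
      · ext <;> simp [h, h', M.d_anticomm t t' _ htt]

theorem adjoin_d_self (s : Fin 3) (M : TriMod.{v} k) (x : M × M) :
    (M.adjoin s).d s x = (M.d s x.1, x.1 - M.d s x.2) := by
  simp only [adjoin, if_pos]; rfl

theorem adjoin_d_of_ne {s t : Fin 3} (h : t ≠ s) (M : TriMod.{v} k) (x : M × M) :
    (M.adjoin s).d t x = (M.d t x.1, -M.d t x.2) := by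
  simp only [adjoin, if_neg h]; rfl

/-- The functor `M ↦ Λ[∂ₛ] ⊗ M`. -/
def adjoinFunctor (k : Type u) [Field k] (s : Fin 3) : TriMod.{v} k ⥤ TriMod.{v} k where
  obj M := M.adjoin s
  map f := ⟨f.lin.prodMap f.lin, fun n x hx => ⟨f.map_gr _ _ hx.1, f.map_gr _ _ hx.2⟩,
    fun t x => by
      by_cases h : t = s
      · subst h
        rw [adjoin_d_self, adjoin_d_self]
        exact Prod.ext (f.map_d _ _) ((map_sub f.lin _ _).trans (by rw [f.map_d]; rfl))
      · rw [adjoin_d_of_ne h, adjoin_d_of_ne h]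
        exact Prod.ext (f.map_d _ _) ((map_neg f.lin _).trans (by rw [f.map_d]; rfl))⟩

/-! ### The functors `𝒰ᵣ` and the transformations `inᵣ`, `outᵣ` -/

/-- The part `⨁_{i - j = r} ⨁ₖ M_{i,j,k}` of `M` in the plane `i - j = r`. -/
def planeSub (r : ℤ) (M : TriMod.{v} k) : Submodule k M :=
  ⨆ n : {n : Fin 3 → ℤ // n 0 - n 1 = r}, M.gr n

/-- The projection of `M` onto its part in the plane `i - j = r`, as an endomorphism of `M`. -/
noncomputable def planeProj (r : ℤ) (M : TriMod.{v} k) : M →ₗ[k] M :=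
  M.scale fun n => if n 0 - n 1 = r then 1 else 0

theorem gr_le_planeSub {r : ℤ} (M : TriMod.{v} k) {n : Fin 3 → ℤ} (h : n 0 - n 1 = r) :
    M.gr n ≤ M.planeSub r :=
  le_iSup (fun n : {n : Fin 3 → ℤ // n 0 - n 1 = r} => M.gr n) ⟨n, h⟩

theorem planeSub_le {r : ℤ} (M : TriMod.{v} k) {W : Submodule k M}
    (h : ∀ n : Fin 3 → ℤ, n 0 - n 1 = r → M.gr n ≤ W) : M.planeSub r ≤ W :=
  iSup_le fun n => h n n.2

theorem planeProj_mem (r : ℤ) (M : TriMod.{v} k) (x : M) : M.planeProj r x ∈ M.planeSub r := by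
  induction x using M.homogeneous_induction with
  | hom n x hx =>
    rw [planeProj, M.scale_of_mem _ hx]
    split_ifs with h
    · rw [one_smul]; exact M.gr_le_planeSub h hx
    · rw [zero_smul]; exact Submodule.zero_mem _
  | add x y hx hy => rw [map_add]; exact Submodule.add_mem _ hx hy

theorem proj_mem_planeSub {r : ℤ} (M : TriMod.{v} k) (n : Fin 3 → ℤ) (x : M)
    (hx : x ∈ M.planeSub r) : M.proj n x ∈ M.planeSub r := by
  suffices M.planeSub r ≤ (M.planeSub r).comap (M.proj n) from this hx
  refine M.planeSub_le fun m hm y hy => ?_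
  by_cases h : m = n
  · subst h; rw [Submodule.mem_comap, M.proj_of_mem hy]; exact M.gr_le_planeSub hm hy
  · rw [Submodule.mem_comap, M.proj_of_mem_ne h hy]; exact Submodule.zero_mem _

theorem d_mem_planeSub {r : ℤ} (M : TriMod.{v} k) (x : M) (hx : x ∈ M.planeSub r) :
    M.d 2 x ∈ M.planeSub r := by
  suffices M.planeSub r ≤ (M.planeSub r).comap (M.d 2) from this hx
  refine M.planeSub_le fun m hm y hy => M.gr_le_planeSub ?_ (M.d_mem 2 m y hy)
  simpa using hm

theorem hom_mem_planeSub {r : ℤ} {M N : TriMod.{v} k} (f : M ⟶ N) (x : M)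
    (hx : x ∈ M.planeSub r) : f.lin x ∈ N.planeSub r := by
  suffices M.planeSub r ≤ (N.planeSub r).comap f.lin from this hx
  exact M.planeSub_le fun m hm y hy => N.gr_le_planeSub hm (f.map_gr m y hy)

/-- The trigraded `Λ₃`-module `⨁_{i - j = r} M_{i,j}`, where `M_{i,j} = ν*(⨁ₖ M_{i,j,k})`:
the part of `M` in the plane `i - j = r`, with the `∂₃` of `M` and with `∂₁ = ∂₂ = 0`. -/
@[reducible] def plane (r : ℤ) (M : TriMod.{v} k) : TriMod.{v} k where
  carrier := M.planeSub r
  gr n := (M.gr n).comap (M.planeSub r).subtype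
  isInternal := by
    refine isInternal_of_proj _
      (fun n => (M.proj n).restrict (M.proj_mem_planeSub n))
      (fun n x hx => Subtype.ext (M.proj_of_mem hx))
      (fun n m x h hx => Subtype.ext (M.proj_of_mem_ne h hx)) ?_
    rintro ⟨x, hx⟩
    have h : M.planeSub r ≤
        (⨆ n, (M.gr n).comap (M.planeSub r).subtype).map (M.planeSub r).subtype := by
      refine M.planeSub_le fun n hn y hy => ?_
      exact ⟨⟨y, M.gr_le_planeSub hn hy⟩, Submodule.mem_iSup_of_mem n hy, rfl⟩
    obtain ⟨y, hy, hyx⟩ := h hx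
    rwa [show (⟨x, hx⟩ : M.planeSub r) = y from Subtype.ext hyx.symm]
  d s := if s = 2 then (M.d 2).restrict M.d_mem_planeSub else 0
  d_mem s n x hx := by
    by_cases h : s = 2
    · subst h; rw [if_pos rfl]; exact M.d_mem 2 n _ hx
    · rw [if_neg h]; exact Submodule.zero_mem _
  d_sq s x := by
    by_cases h : s = 2
    · subst h; rw [if_pos rfl]; exact Subtype.ext (M.d_sq 2 _)
    · rw [if_neg h]; rfl
  d_anticomm s t x hst := by
    by_cases h : s = 2
    · subst h; rw [if_neg hst.symm]; simp
    · rw [if_neg h]; simp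

theorem plane_d_two (r : ℤ) (M : TriMod.{v} k) (x : M.plane r) :
    (((M.plane r).d 2 x : M.planeSub r) : M) = M.d 2 (x : M) := rfl

theorem plane_d_of_ne {s : Fin 3} (h : s ≠ 2) (r : ℤ) (M : TriMod.{v} k) (x : M.plane r) :
    (M.plane r).d s x = 0 := by
  simp only [plane, if_neg h]; rfl

/-- The functor `M ↦ ⨁_{i - j = r} M_{i,j}`. -/
def planeFunctor (k : Type u) [Field k] (r : ℤ) : TriMod.{v} k ⥤ TriMod.{v} k where
  obj M := M.plane r
  map f := ⟨f.lin.restrict (hom_mem_planeSub f), fun n x hx => f.map_gr n _ hx, fun s x => by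
    by_cases h : s = 2
    · subst h; exact Subtype.ext (f.map_d 2 _)
    · rw [plane_d_of_ne h, plane_d_of_ne h, map_zero]⟩

/-- The functor `𝒰ᵣ(M) = ⨁_{i - j = r} Q ⊗ M_{i,j}`, where `Q = Λ₃ω / Λ₃∂₃ω = Λ[∂₁] ⊗ Λ[∂₂]`.
The element `((x, y), (z, w))` of `𝒰ᵣ(M)` stands for
`ω ⊗ x + ∂₂ω ⊗ y + ∂₁ω ⊗ z + ∂₁∂₂ω ⊗ w`. -/
def U (k : Type u) [Field k] (r : ℤ) : TriMod.{v} k ⥤ TriMod.{v} k :=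
  planeFunctor k r ⋙ adjoinFunctor k 1 ⋙ adjoinFunctor k 0

theorem U_d_zero (r : ℤ) (M : TriMod.{v} k) (x : ((M.plane r).adjoin 1).adjoin 0) :
    (((M.plane r).adjoin 1).adjoin 0).d 0 x = (0, x.1) := by
  have h : ∀ y : (M.plane r).adjoin 1, ((M.plane r).adjoin 1).d 0 y = 0 := fun y => by
    rw [adjoin_d_of_ne (by decide), plane_d_of_ne (by decide), plane_d_of_ne (by decide), neg_zero]
    rfl
  rw [adjoin_d_self, h, h, sub_zero]

theorem U_d_one (r : ℤ) (M : TriMod.{v} k) (x : ((M.plane r).adjoin 1).adjoin 0) :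
    (((M.plane r).adjoin 1).adjoin 0).d 1 x = ((0, x.1.1), (0, -x.2.1)) := by
  have h : ∀ y : (M.plane r).adjoin 1, ((M.plane r).adjoin 1).d 1 y = (0, y.1) := fun y => by
    rw [adjoin_d_self, plane_d_of_ne (by decide), plane_d_of_ne (by decide), sub_zero]
  rw [adjoin_d_of_ne (by decide), h, h, Prod.neg_mk, neg_zero]

theorem U_d_two (r : ℤ) (M : TriMod.{v} k) (x : ((M.plane r).adjoin 1).adjoin 0) :
    (((M.plane r).adjoin 1).adjoin 0).d 2 x =
      (((M.plane r).d 2 x.1.1, -(M.plane r).d 2 x.1.2),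
        (-(M.plane r).d 2 x.2.1, (M.plane r).d 2 x.2.2)) := by
  rw [adjoin_d_of_ne (by decide), adjoin_d_of_ne (by decide), adjoin_d_of_ne (by decide),
    Prod.neg_mk, neg_neg]

/-- The linear map `Q ⊗ M_{i,j} → M`, `q ω ⊗ m ↦ q m` (for `q` in the algebra spanned by `1`,
`∂₁`, `∂₂`, `∂₁∂₂`), summed over `i - j = r`. -/
def inLin (r : ℤ) (M : TriMod.{v} k) :
    (M.planeSub r × M.planeSub r) × (M.planeSub r × M.planeSub r) →ₗ[k] M where
  toFun x := (x.1.1 : M) + M.d 1 (x.1.2 : M) + M.d 0 (x.2.1 : M) + M.d 0 (M.d 1 (x.2.2 : M))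
  map_add' x y := by simp only [Prod.fst_add, Prod.snd_add, Submodule.coe_add, map_add]; abel
  map_smul' c x := by
    simp only [Prod.smul_fst, Prod.smul_snd, Submodule.coe_smul, map_smul, smul_add,
      RingHom.id_apply]

/-- The natural transformation `inᵣ : 𝒰ᵣ ⟶ Id`. -/
def inTrans (k : Type u) [Field k] (r : ℤ) : U.{v} k r ⟶ 𝟭 (TriMod.{v} k) where
  app M := ⟨inLin r M, by
      rintro n ⟨⟨x, y⟩, ⟨z, w⟩⟩ ⟨⟨hx, hy⟩, ⟨hz, hw⟩⟩
      have hy' := M.d_mem 1 _ _ hy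
      have hz' := M.d_mem 0 _ _ hz
      have hw' := M.d_mem 0 _ _ (M.d_mem 1 _ _ hw)
      simp only [sub_add_cancel] at hy' hz' hw'
      exact Submodule.add_mem _ (Submodule.add_mem _ (Submodule.add_mem _ hx hy') hz') hw', by
      intro s x
      have h10 : ∀ y, M.d 1 (M.d 0 y) = -M.d 0 (M.d 1 y) := fun y =>
        M.d_anticomm 1 0 y (by decide)
      have h20 : ∀ y, M.d 2 (M.d 0 y) = -M.d 0 (M.d 2 y) := fun y =>
        M.d_anticomm 2 0 y (by decide)
      have h21 : ∀ y, M.d 2 (M.d 1 y) = -M.d 1 (M.d 2 y) := fun y =>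
        M.d_anticomm 2 1 y (by decide)
      change inLin r M ((((M.plane r).adjoin 1).adjoin 0).d s x) = M.d s (inLin r M x)
      fin_cases s
      · refine (congrArg (inLin r M) (U_d_zero r M x)).trans ?_
        simp [inLin, M.d_sq]
      · refine (congrArg (inLin r M) (U_d_one r M x)).trans ?_
        simp [inLin, M.d_sq, h10]
      · refine (congrArg (inLin r M) (U_d_two r M x)).trans ?_
        simp [inLin, h20, h21]⟩
  naturality M N f := by
    ext x
    change inLin r N _ = f.lin (inLin r M x)
    simp only [inLin, LinearMap.coe_mk, AddHom.coe_mk, map_add, f.map_d]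
    rfl

/-- The sign `m ↦ (-1)^(i+j) m` for `m ∈ M_{i,j,k}`. -/
noncomputable def sign (M : TriMod.{v} k) : M →ₗ[k] M :=
  M.scale fun n => (-1) ^ (n 0 + n 1)

theorem sign_d_of_ne (M : TriMod.{v} k) {s : Fin 3} (hs : s ≠ 2) (x : M) :
    M.sign (M.d s x) = -M.d s (M.sign x) := by
  induction x using M.homogeneous_induction with
  | hom n x hx =>
    rw [sign, M.scale_of_mem _ hx, M.scale_of_mem _ (M.d_mem s n x hx), map_smul, ← neg_smul]
    congr 1
    have h : (n + Pi.single s 1 : Fin 3 → ℤ) 0 + (n + Pi.single s 1 : Fin 3 → ℤ) 1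
        = n 0 + n 1 + 1 := by
      fin_cases s
      · simp; ring
      · simp; ring
      · exact absurd rfl hs
    rw [h, zpow_add₀ (by simp)]
    simp
  | add x y hx hy => simp only [map_add, hx, hy, neg_add]

theorem sign_d_two (M : TriMod.{v} k) (x : M) : M.sign (M.d 2 x) = M.d 2 (M.sign x) := by
  induction x using M.homogeneous_induction with
  | hom n x hx =>
    rw [sign, M.scale_of_mem _ hx, M.scale_of_mem _ (M.d_mem 2 n x hx), map_smul]
    simp
  | add x y hx hy => simp only [map_add, hx, hy]

theorem planeProj_d_two (r : ℤ) (M : TriMod.{v} k) (x : M) :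
    M.planeProj r (M.d 2 x) = M.d 2 (M.planeProj r x) := by
  induction x using M.homogeneous_induction with
  | hom n x hx =>
    rw [planeProj, M.scale_of_mem _ hx, M.scale_of_mem _ (M.d_mem 2 n x hx), map_smul]
    simp
  | add x y hx hy => simp only [map_add, hx, hy]

theorem hom_planeProj (r : ℤ) {M N : TriMod.{v} k} (f : M ⟶ N) (x : M) :
    f.lin (M.planeProj r x) = N.planeProj r (f.lin x) :=
  hom_scale f _ x

theorem hom_sign {M N : TriMod.{v} k} (f : M ⟶ N) (x : M) :
    f.lin (M.sign x) = N.sign (f.lin x) :=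
  hom_scale f _ x

/-- The linear map
`m ↦ (-1)^(i+j) πᵣ(ω ⊗ ∂₁∂₂m + ∂₁ω ⊗ ∂₂m - ∂₂ω ⊗ ∂₁m + ∂₁∂₂ω ⊗ m)`, `m ∈ M_{i,j,k}`,
where `πᵣ` is the projection onto the plane `i - j = r` in the second factor. -/
noncomputable def outLin (r : ℤ) (M : TriMod.{v} k) :
    M →ₗ[k] (M.planeSub r × M.planeSub r) × (M.planeSub r × M.planeSub r) :=
  let π : M →ₗ[k] M.planeSub r := (M.planeProj r).codRestrict _ (M.planeProj_mem r)
  (((π ∘ₗ M.d 0 ∘ₗ M.d 1).prod (-(π ∘ₗ M.d 0))).prod ((π ∘ₗ M.d 1).prod π)) ∘ₗ M.sign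

/-- The natural transformation `outᵣ : Id ⟶ 𝒰ᵣ{-1,-1,0}`. -/
noncomputable def outTrans (k : Type u) [Field k] (r : ℤ) :
    𝟭 (TriMod.{v} k) ⟶ U.{v} k r ⋙ shiftFunctor k ![-1, -1, 0] where
  app M := ⟨outLin r M, by
      intro n x hx
      have hp : ∀ m y, y ∈ M.gr m → M.planeProj r y ∈ M.gr m := fun m y hy => M.scale_mem _ hy
      have h := M.scale_mem (fun n => (-1) ^ (n 0 + n 1)) hx
      have h0 := M.d_mem 0 _ _ h
      have h1 := M.d_mem 1 _ _ h
      have h01 := M.d_mem 0 _ _ h1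
      have ea : (![-1, -1, 0] : Fin 3 → ℤ) = -Pi.single 0 1 - Pi.single 1 1 := by
        ext i; fin_cases i <;> simp
      have e01 : n - ![-1, -1, 0] = n + Pi.single 1 1 + Pi.single 0 1 := by
        rw [ea]; abel
      have e0 : n - ![-1, -1, 0] - Pi.single 1 1 = n + Pi.single 0 1 := by
        rw [ea]; abel
      have e1 : n - ![-1, -1, 0] - Pi.single 0 1 = n + Pi.single 1 1 := by
        rw [ea]; abel
      have e : n - ![-1, -1, 0] - Pi.single 0 1 - Pi.single 1 1 = n := by
        rw [ea]; abel
      refine ⟨⟨?_, ?_⟩, ⟨?_, ?_⟩⟩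
      · change M.planeProj r _ ∈ M.gr (n - ![-1, -1, 0])
        rw [e01]; exact hp _ _ h01
      · change -M.planeProj r _ ∈ M.gr (n - ![-1, -1, 0] - Pi.single 1 1)
        rw [e0]; exact Submodule.neg_mem _ (hp _ _ h0)
      · change M.planeProj r _ ∈ M.gr (n - ![-1, -1, 0] - Pi.single 0 1)
        rw [e1]; exact hp _ _ h1
      · change M.planeProj r _ ∈ M.gr (n - ![-1, -1, 0] - Pi.single 0 1 - Pi.single 1 1)
        rw [e]; exact hp _ _ h, by
      intro s x
      have h10 : ∀ y, M.d 1 (M.d 0 y) = -M.d 0 (M.d 1 y) := fun y =>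
        M.d_anticomm 1 0 y (by decide)
      have h02 : ∀ y, M.d 0 (M.d 2 y) = -M.d 2 (M.d 0 y) := fun y =>
        M.d_anticomm 0 2 y (by decide)
      have h12 : ∀ y, M.d 1 (M.d 2 y) = -M.d 2 (M.d 1 y) := fun y =>
        M.d_anticomm 1 2 y (by decide)
      have hs : (∑ i, (![-1, -1, 0] : Fin 3 → ℤ) i).negOnePow = 1 := by
        simp [Fin.sum_univ_three]; rfl
      change outLin r M (M.d s x) = ((∑ i, (![-1, -1, 0] : Fin 3 → ℤ) i).negOnePow •
        (((M.plane r).adjoin 1).adjoin 0).d s) (outLin r M x)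
      rw [hs, one_smul]
      fin_cases s
      · refine Eq.trans ?_ (U_d_zero r M _).symm
        refine Prod.ext (Prod.ext ?_ ?_) (Prod.ext ?_ ?_) <;> refine Subtype.ext ?_ <;>
          simp [outLin, sign_d_of_ne, h10, M.d_sq]
      · refine Eq.trans ?_ (U_d_one r M _).symm
        refine Prod.ext (Prod.ext ?_ ?_) (Prod.ext ?_ ?_) <;> refine Subtype.ext ?_ <;>
          simp [outLin, sign_d_of_ne, M.d_sq]
      · refine Eq.trans ?_ (U_d_two r M _).symm
        refine Prod.ext (Prod.ext ?_ ?_) (Prod.ext ?_ ?_) <;> refine Subtype.ext ?_ <;>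
          simp [outLin, sign_d_two, h02, h12, planeProj_d_two]⟩
  naturality M N f := by
    ext x
    change outLin r N (f.lin x) = _
    refine Prod.ext (Prod.ext ?_ ?_) (Prod.ext ?_ ?_) <;> refine Subtype.ext ?_
    · change N.planeProj r (N.d 0 (N.d 1 (N.sign (f.lin x)))) =
        f.lin (M.planeProj r (M.d 0 (M.d 1 (M.sign x))))
      rw [hom_planeProj, f.map_d, f.map_d, hom_sign]
    · change -N.planeProj r (N.d 0 (N.sign (f.lin x))) =
        f.lin (-M.planeProj r (M.d 0 (M.sign x)))
      rw [map_neg, hom_planeProj, f.map_d, hom_sign]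
    · change N.planeProj r (N.d 1 (N.sign (f.lin x))) =
        f.lin (M.planeProj r (M.d 1 (M.sign x)))
      rw [hom_planeProj, f.map_d, hom_sign]
    · change N.planeProj r (N.sign (f.lin x)) = f.lin (M.planeProj r (M.sign x))
      rw [hom_planeProj, hom_sign]

/-! ### The `∂₃`-cone -/

/-- The `∂₃`-cone of `f : M ⟶ N`: the space `M{0,0,-1} ⊕ N` with
`∂₃(m, n) = (-∂₃m, f(m) + ∂₃n)` and with `∂ⱼ`, `j = 1, 2`, acting diagonally, so by `-∂ⱼ` on
`M{0,0,-1}` (the Koszul sign of the grading shift) and by `∂ⱼ` on `N`. -/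
@[reducible] def cone3 {M N : TriMod.{v} k} (f : M ⟶ N) : TriMod.{v} k where
  carrier := M × N
  gr n := (M.gr (n + Pi.single 2 1)).prod (N.gr n)
  isInternal := by
    refine isInternal_of_proj _
      (fun n => (M.proj (n + Pi.single 2 1)).prodMap (N.proj n))
      (fun n x hx => Prod.ext (M.proj_of_mem hx.1) (N.proj_of_mem hx.2))
      (fun n m x h hx => Prod.ext
        (M.proj_of_mem_ne (fun h' => h (add_left_injective _ h')) hx.1)
        (N.proj_of_mem_ne h hx.2)) ?_
    rintro ⟨x, y⟩
    rw [show (x, y) = LinearMap.inl k M N x + LinearMap.inr k M N y by simp]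
    refine Submodule.add_mem _ ?_ ?_
    · induction x using M.homogeneous_induction with
      | hom n x hx =>
        exact Submodule.mem_iSup_of_mem (n - Pi.single 2 1)
          ⟨by simpa using hx, Submodule.zero_mem _⟩
      | add x y hx hy => rw [map_add]; exact Submodule.add_mem _ hx hy
    · induction y using N.homogeneous_induction with
      | hom n x hx => exact Submodule.mem_iSup_of_mem n ⟨Submodule.zero_mem _, hx⟩
      | add x y hx hy => rw [map_add]; exact Submodule.add_mem _ hx hy
  d s := (-(M.d s ∘ₗ LinearMap.fst k M N)).prod
    ((if s = 2 then f.lin ∘ₗ LinearMap.fst k M N else 0) + N.d s ∘ₗ LinearMap.snd k M N)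
  d_mem s n x hx := by
    have h1 := M.d_mem s _ _ hx.1
    have h2 := N.d_mem s _ _ hx.2
    rw [add_right_comm] at h1
    refine ⟨Submodule.neg_mem _ h1, Submodule.add_mem _ ?_ h2⟩
    by_cases h : s = 2
    · subst h; rw [if_pos rfl]; exact f.map_gr _ _ hx.1
    · rw [if_neg h]; exact Submodule.zero_mem _
  d_sq s x := by
    by_cases h : s = 2
    · subst h; ext <;> simp [M.d_sq, N.d_sq, f.map_d]
    · ext <;> simp [M.d_sq, N.d_sq, h]
  d_anticomm s t x hst := by
    have h1 := M.d_anticomm s t x.1 hst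
    have h2 := N.d_anticomm s t x.2 hst
    by_cases h : s = 2
    · subst h; ext <;> simp [h1, h2, hst.symm, f.map_d]
      exact add_comm _ _
    · by_cases h' : t = 2
      · subst h'; ext <;> simp [h1, h2, hst, f.map_d]
        exact add_comm _ _
      · ext <;> simp [h1, h2, h, h']

/-- The `∂₃`-cone of a natural transformation of endofunctors of `ℳ₃`. -/
def cone3Functor {F G : TriMod.{v} k ⥤ TriMod.{v} k} (α : F ⟶ G) :
    TriMod.{v} k ⥤ TriMod.{v} k where
  obj M := cone3 (α.app M)
  map {M N} f := ⟨(F.map f).lin.prodMap (G.map f).lin,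
    fun n x hx => ⟨(F.map f).map_gr _ _ hx.1, (G.map f).map_gr _ _ hx.2⟩, fun s x => by
      have h1 := (F.map f).map_d s x.1
      have h2 := (G.map f).map_d s x.2
      have h3 : (G.map f).lin ((α.app M).lin x.1) = (α.app N).lin ((F.map f).lin x.1) :=
        congrArg (fun g : F.obj M ⟶ G.obj N => g.lin x.1) (α.naturality f).symm
      by_cases h : s = 2
      · subst h; ext <;> simp [h1, h2, h3]
      · ext <;> simp [h1, h2, h]⟩
  map_id M := by ext x <;> simp
  map_comp f g := by ext x <;> simp

/-- The functor `ℛᵣ = C₃(inᵣ)` on `ℳ₃`. -/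
def R (k : Type u) [Field k] (r : ℤ) : TriMod.{v} k ⥤ TriMod.{v} k :=
  cone3Functor (inTrans k r)

/-- The functor `ℛ'ᵣ = C₃(outᵣ){0,0,1}` on `ℳ₃`. -/
noncomputable def R' (k : Type u) [Field k] (r : ℤ) : TriMod.{v} k ⥤ TriMod.{v} k :=
  cone3Functor (outTrans k r) ⋙ shiftFunctor k ![0, 0, 1]

/-! ### Cokernels and direct sums -/

/-- The cokernel `N / f(M)` of a morphism `f : M ⟶ N`. -/
@[reducible] def coker {M N : TriMod.{v} k} (f : M ⟶ N) : TriMod.{v} k where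
  carrier := N ⧸ LinearMap.range f.lin
  gr n := (N.gr n).map (LinearMap.range f.lin).mkQ
  isInternal := by
    have hp : ∀ n, LinearMap.range f.lin ≤ (LinearMap.range f.lin).comap (N.proj n) := by
      rintro n _ ⟨x, rfl⟩
      exact ⟨M.proj n x, hom_scale f _ x⟩
    refine isInternal_of_proj _ (fun n => (LinearMap.range f.lin).mapQ _ (N.proj n) (hp n)) ?_ ?_ ?_
    · rintro n _ ⟨x, hx, rfl⟩
      simp [N.proj_of_mem hx]
    · rintro n m _ h ⟨x, hx, rfl⟩
      simp [N.proj_of_mem_ne h hx]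
    · intro x
      obtain ⟨x, rfl⟩ := Submodule.mkQ_surjective _ x
      rw [← Submodule.map_iSup]
      exact ⟨x, N.mem_iSup_gr x, rfl⟩
  d s := (LinearMap.range f.lin).mapQ _ (N.d s) (by
    rintro _ ⟨x, rfl⟩
    exact ⟨M.d s x, f.map_d s x⟩)
  d_mem := by
    rintro s n _ ⟨x, hx, rfl⟩
    exact ⟨N.d s x, N.d_mem s n x hx, rfl⟩
  d_sq s x := by
    obtain ⟨x, rfl⟩ := Submodule.mkQ_surjective _ x
    simp [N.d_sq]
  d_anticomm s t x hst := by
    obtain ⟨x, rfl⟩ := Submodule.mkQ_surjective _ x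
    simp [N.d_anticomm s t x hst]

/-- The projection `N ⟶ N / f(M)`. -/
def cokerProj {M N : TriMod.{v} k} (f : M ⟶ N) : N ⟶ coker f :=
  ⟨(LinearMap.range f.lin).mkQ, fun _ x hx => ⟨x, hx, rfl⟩, fun _ _ => rfl⟩

/-- The morphism out of `N / f(M)` induced by a morphism `g` with `f ≫ g = 0`. -/
def cokerDesc {M N P : TriMod.{v} k} (f : M ⟶ N) (g : N ⟶ P) (h : f ≫ g = 0) : coker f ⟶ P :=
  ⟨(LinearMap.range f.lin).liftQ g.lin (by
      rintro _ ⟨x, rfl⟩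
      exact congrArg (fun l : M ⟶ P => l.lin x) h), by
    rintro n _ ⟨x, hx, rfl⟩
    exact g.map_gr n x hx, by
    intro s x
    obtain ⟨x, rfl⟩ := Submodule.mkQ_surjective _ x
    exact g.map_d s x⟩

theorem cokerProj_desc {M N P : TriMod.{v} k} (f : M ⟶ N) (g : N ⟶ P) (h : f ≫ g = 0) :
    cokerProj f ≫ cokerDesc f g h = g := rfl

theorem comp_cokerProj {M N : TriMod.{v} k} (f : M ⟶ N) : f ≫ cokerProj f = 0 := by
  ext x
  exact (Submodule.Quotient.mk_eq_zero _).2 ⟨x, rfl⟩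

theorem coker_hom_ext {M N P : TriMod.{v} k} {f : M ⟶ N} {g h : coker f ⟶ P}
    (e : cokerProj f ≫ g = cokerProj f ≫ h) : g = h := by
  ext x
  obtain ⟨x, rfl⟩ := Submodule.mkQ_surjective _ x
  exact congrArg (fun l : N ⟶ P => l.lin x) e

theorem surjective_of_epi {M N : TriMod.{v} k} (f : M ⟶ N) [Epi f] :
    Function.Surjective f.lin := by
  have h : cokerProj f = 0 := by
    rw [← cancel_epi f, comp_cokerProj, Limits.comp_zero]
  intro y
  have : (LinearMap.range f.lin).mkQ y = 0 := congrArg (fun l : N ⟶ coker f => l.lin y) h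
  exact (Submodule.Quotient.mk_eq_zero _).1 this

/-- The direct sum `M ⊕ N`. -/
@[reducible] def dsum (M N : TriMod.{v} k) : TriMod.{v} k where
  carrier := M × N
  gr n := (M.gr n).prod (N.gr n)
  isInternal := by
    refine isInternal_of_proj _ (fun n => (M.proj n).prodMap (N.proj n))
      (fun n x hx => Prod.ext (M.proj_of_mem hx.1) (N.proj_of_mem hx.2))
      (fun n m x h hx => Prod.ext (M.proj_of_mem_ne h hx.1) (N.proj_of_mem_ne h hx.2)) ?_
    rintro ⟨x, y⟩
    rw [show (x, y) = LinearMap.inl k M N x + LinearMap.inr k M N y by simp]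
    refine Submodule.add_mem _ ?_ ?_
    · induction x using M.homogeneous_induction with
      | hom n x hx => exact Submodule.mem_iSup_of_mem n ⟨hx, Submodule.zero_mem _⟩
      | add x y hx hy => rw [map_add]; exact Submodule.add_mem _ hx hy
    · induction y using N.homogeneous_induction with
      | hom n x hx => exact Submodule.mem_iSup_of_mem n ⟨Submodule.zero_mem _, hx⟩
      | add x y hx hy => rw [map_add]; exact Submodule.add_mem _ hx hy
  d s := (M.d s).prodMap (N.d s)
  d_mem s n x hx := ⟨M.d_mem s _ _ hx.1, N.d_mem s _ _ hx.2⟩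
  d_sq s x := Prod.ext (M.d_sq s _) (N.d_sq s _)
  d_anticomm s t x hst := Prod.ext (M.d_anticomm s t _ hst) (N.d_anticomm s t _ hst)

/-! ### The inclusion `M ⟶ Λ₃ ⊗ M{-1,-1,-1}`, the suspension and the cone -/

/-- The functor `M ↦ Λ₃ ⊗ M{-1,-1,-1}`, where `Λ₃ = Λ[∂₁] ⊗ Λ[∂₂] ⊗ Λ[∂₃]`. -/
def freeHull (k : Type u) [Field k] : TriMod.{v} k ⥤ TriMod.{v} k :=
  adjoinFunctor k 2 ⋙ adjoinFunctor k 1 ⋙ adjoinFunctor k 0 ⋙ shiftFunctor k ![-1, -1, -1]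

/-- The inclusion `M ⟶ Λ₃ ⊗ M{-1,-1,-1}`, `m ↦ ∂₁∂₂∂₃ ⊗ m`. -/
def freeIncl (k : Type u) [Field k] : 𝟭 (TriMod.{v} k) ⟶ freeHull.{v} k where
  app M :=
    { lin := LinearMap.inr k ((M × M) × (M × M)) ((M × M) × (M × M)) ∘ₗ
        LinearMap.inr k (M × M) (M × M) ∘ₗ LinearMap.inr k M M
      map_gr := by
        intro n x hx
        have e : n - ![-1, -1, -1] - Pi.single 0 1 - Pi.single 1 1 - Pi.single 2 1 = n := by
          have : (![-1, -1, -1] : Fin 3 → ℤ) = -Pi.single 0 1 - Pi.single 1 1 - Pi.single 2 1 := by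
            ext i; fin_cases i <;> simp
          rw [this]; abel
        refine ⟨⟨⟨Submodule.zero_mem _, Submodule.zero_mem _⟩,
          ⟨Submodule.zero_mem _, Submodule.zero_mem _⟩⟩,
          ⟨⟨Submodule.zero_mem _, Submodule.zero_mem _⟩, ⟨Submodule.zero_mem _, ?_⟩⟩⟩
        change x ∈ M.gr (n - ![-1, -1, -1] - Pi.single 0 1 - Pi.single 1 1 - Pi.single 2 1)
        rwa [e]
      map_d := by
        intro s x
        have hs : (∑ i, (![-1, -1, -1] : Fin 3 → ℤ) i).negOnePow = -1 := by
          simp [Fin.sum_univ_three]; rfl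
        change (((0, 0), (0, 0)), ((0, 0), (0, M.d s x))) =
          ((∑ i, (![-1, -1, -1] : Fin 3 → ℤ) i).negOnePow •
          (((M.adjoin 2).adjoin 1).adjoin 0).d s) (((0, 0), (0, 0)), ((0, 0), (0, x)))
        rw [hs, Units.neg_smul, one_smul, LinearMap.neg_apply]
        fin_cases s <;> simp [adjoin] }
  naturality M N f := by
    ext x
    change (((0, 0), (0, 0)), ((0, 0), (0, f.lin x))) = (((f.lin 0, f.lin 0), (f.lin 0, f.lin 0)),
      ((f.lin 0, f.lin 0), (f.lin 0, f.lin x)))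
    simp only [map_zero]

/-- The functor on `ℳ₃` inducing the suspension `[1]` of the stable category: the cokernel of
`M ⟶ Λ₃ ⊗ M{-1,-1,-1}`. -/
def susp (k : Type u) [Field k] : TriMod.{v} k ⥤ TriMod.{v} k where
  obj M := coker ((freeIncl k).app M)
  map {M N} f := cokerDesc _ ((freeHull k).map f ≫ cokerProj _) (by
    rw [← Category.assoc, ← (freeIncl k).naturality, Category.assoc, comp_cokerProj,
      Limits.comp_zero])
  map_id M := coker_hom_ext (by rw [cokerProj_desc]; rfl)
  map_comp f g := coker_hom_ext (by
    rw [cokerProj_desc, ← Category.assoc, cokerProj_desc, Category.assoc, cokerProj_desc,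
      Functor.map_comp, Category.assoc])

/-- The morphism `M ⟶ N ⊕ Λ₃ ⊗ M{-1,-1,-1}`, `m ↦ (f(m), ∂₁∂₂∂₃ ⊗ m)`. -/
def coneEmb {M N : TriMod.{v} k} (f : M ⟶ N) : M ⟶ dsum N ((freeHull k).obj M) :=
  ⟨f.lin.prod ((freeIncl k).app M).lin,
    fun n x hx => ⟨f.map_gr n x hx, ((freeIncl k).app M).map_gr n x hx⟩,
    fun s x => Prod.ext (f.map_d s x) (((freeIncl k).app M).map_d s x)⟩

/-- The cone of `f : M ⟶ N`: the cokernel of `m ↦ (f(m), ∂₁∂₂∂₃ ⊗ m)`. -/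
def cone {M N : TriMod.{v} k} (f : M ⟶ N) : TriMod.{v} k := coker (coneEmb f)

/-- The morphism `N ⟶ cone f` induced by the inclusion of the first summand. -/
def coneIn {M N : TriMod.{v} k} (f : M ⟶ N) : N ⟶ cone f :=
  (⟨LinearMap.inl k N ((freeHull k).obj M), fun _ _ hx => ⟨hx, Submodule.zero_mem _⟩,
    fun s _ => Prod.ext rfl (map_zero (((freeHull k).obj M).d s)).symm⟩ :
      N ⟶ dsum N ((freeHull k).obj M)) ≫ cokerProj (coneEmb f)

/-- The morphism `cone f ⟶ M[1]` induced by `(n, p) ↦ -p`. The sign identifies the cone with the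
pushout of `f` along `M ⟶ Λ₃ ⊗ M{-1,-1,-1}`. -/
def coneOut {M N : TriMod.{v} k} (f : M ⟶ N) : cone f ⟶ (susp k).obj M :=
  cokerDesc (coneEmb f)
    ((⟨-LinearMap.snd k N ((freeHull k).obj M), fun _ _ hx => Submodule.neg_mem _ hx.2,
      fun s x => (map_neg (((freeHull k).obj M).d s) x.2).symm⟩ :
      dsum N ((freeHull k).obj M) ⟶ (freeHull k).obj M) ≫ cokerProj ((freeIncl k).app M)) (by
    ext x
    exact (Submodule.Quotient.mk_eq_zero _).2 ⟨-x, map_neg ((freeIncl k).app M).lin x⟩)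

/-! ### Projective objects -/

/-- The action of `∂₁∂₂∂₃` on linear maps `M → N` of odd degree, by iterated supercommutators. -/
def trace (M N : TriMod.{v} k) : (M →ₗ[k] N) →ₗ[k] (M →ₗ[k] N) where
  toFun h := N.d 0 ∘ₗ (N.d 1 ∘ₗ (N.d 2 ∘ₗ h + h ∘ₗ M.d 2) - (N.d 2 ∘ₗ h + h ∘ₗ M.d 2) ∘ₗ M.d 1) +
    (N.d 1 ∘ₗ (N.d 2 ∘ₗ h + h ∘ₗ M.d 2) - (N.d 2 ∘ₗ h + h ∘ₗ M.d 2) ∘ₗ M.d 1) ∘ₗ M.d 0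
  map_add' h h' := by ext x; simp; abel
  map_smul' c h := by ext x; simp [smul_add, smul_sub]

theorem trace_apply (M N : TriMod.{v} k) (h : M →ₗ[k] N) (x : M) :
    trace M N h x = N.d 0 (N.d 1 (N.d 2 (h x) + h (M.d 2 x)) - (N.d 2 (h (M.d 1 x)) +
      h (M.d 2 (M.d 1 x)))) + (N.d 1 (N.d 2 (h (M.d 0 x)) + h (M.d 2 (M.d 0 x))) -
        (N.d 2 (h (M.d 1 (M.d 0 x))) + h (M.d 2 (M.d 1 (M.d 0 x))))) := rfl

theorem d_trace (M N : TriMod.{v} k) (h : M →ₗ[k] N) (s : Fin 3) (x : M) :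
    trace M N h (M.d s x) = N.d s (trace M N h x) := by
  have m10 : ∀ y, M.d 1 (M.d 0 y) = -M.d 0 (M.d 1 y) := fun y => M.d_anticomm 1 0 y (by decide)
  have m20 : ∀ y, M.d 2 (M.d 0 y) = -M.d 0 (M.d 2 y) := fun y => M.d_anticomm 2 0 y (by decide)
  have m21 : ∀ y, M.d 2 (M.d 1 y) = -M.d 1 (M.d 2 y) := fun y => M.d_anticomm 2 1 y (by decide)
  have n10 : ∀ y, N.d 1 (N.d 0 y) = -N.d 0 (N.d 1 y) := fun y => N.d_anticomm 1 0 y (by decide)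
  have n20 : ∀ y, N.d 2 (N.d 0 y) = -N.d 0 (N.d 2 y) := fun y => N.d_anticomm 2 0 y (by decide)
  have n21 : ∀ y, N.d 2 (N.d 1 y) = -N.d 1 (N.d 2 y) := fun y => N.d_anticomm 2 1 y (by decide)
  rw [trace_apply, trace_apply]
  fin_cases s
  · simp [M.d_sq, N.d_sq]
  · simp [M.d_sq, N.d_sq, m10, m20, m21, n10]; abel
  · simp [M.d_sq, N.d_sq, m10, m20, m21, n20, n21]

/-- A linear map of degree `(-1,-1,-1)`. -/
def IsLowering {M N : TriMod.{v} k} (h : M →ₗ[k] N) : Prop :=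
  ∀ n x, x ∈ M.gr n → h x ∈ N.gr (n - 1)

theorem trace_mem {M N : TriMod.{v} k} {h : M →ₗ[k] N} (hh : IsLowering h) (n : Fin 3 → ℤ) (x : M)
    (hx : x ∈ M.gr n) : trace M N h x ∈ N.gr n := by
  have e1 : (1 : Fin 3 → ℤ) = Pi.single 0 1 + Pi.single 1 1 + Pi.single 2 1 := by
    ext i; fin_cases i <;> simp
  have key : ∀ m : Fin 3 → ℤ, ∀ y ∈ N.gr m, m = n → y ∈ N.gr n := fun m y hy e => e ▸ hy
  rw [trace_apply]
  simp only [map_add, map_sub]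
  refine Submodule.add_mem _ (Submodule.sub_mem _ (Submodule.add_mem _ ?_ ?_)
    (Submodule.add_mem _ ?_ ?_)) (Submodule.sub_mem _ (Submodule.add_mem _ ?_ ?_)
    (Submodule.add_mem _ ?_ ?_))
  · exact key _ _ (N.d_mem 0 _ _ (N.d_mem 1 _ _ (N.d_mem 2 _ _ (hh _ _ hx)))) (by rw [e1]; abel)
  · exact key _ _ (N.d_mem 0 _ _ (N.d_mem 1 _ _ (hh _ _ (M.d_mem 2 _ _ hx)))) (by rw [e1]; abel)
  · exact key _ _ (N.d_mem 0 _ _ (N.d_mem 2 _ _ (hh _ _ (M.d_mem 1 _ _ hx)))) (by rw [e1]; abel)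
  · exact key _ _ (N.d_mem 0 _ _ (hh _ _ (M.d_mem 2 _ _ (M.d_mem 1 _ _ hx)))) (by rw [e1]; abel)
  · exact key _ _ (N.d_mem 1 _ _ (N.d_mem 2 _ _ (hh _ _ (M.d_mem 0 _ _ hx)))) (by rw [e1]; abel)
  · exact key _ _ (N.d_mem 1 _ _ (hh _ _ (M.d_mem 2 _ _ (M.d_mem 0 _ _ hx)))) (by rw [e1]; abel)
  · exact key _ _ (N.d_mem 2 _ _ (hh _ _ (M.d_mem 1 _ _ (M.d_mem 0 _ _ hx)))) (by rw [e1]; abel)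
  · exact key _ _ (hh _ _ (M.d_mem 2 _ _ (M.d_mem 1 _ _ (M.d_mem 0 _ _ hx)))) (by rw [e1]; abel)

/-- The morphism obtained from a linear map of degree `(-1,-1,-1)` by the action of `∂₁∂₂∂₃`. -/
def traceHom {M N : TriMod.{v} k} (h : M →ₗ[k] N) (hh : IsLowering h) : M ⟶ N :=
  ⟨trace M N h, trace_mem hh, d_trace M N h⟩

theorem trace_comp {M N P : TriMod.{v} k} (h : M →ₗ[k] N) (g : N ⟶ P) (x : M) :
    trace M P (g.lin ∘ₗ h) x = g.lin (trace M N h x) := by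
  simp only [trace_apply, LinearMap.comp_apply, map_add, map_sub, g.map_d]

theorem comp_trace {M N P : TriMod.{v} k} (f : M ⟶ N) (h : N →ₗ[k] P) (x : M) :
    trace M P (h ∘ₗ f.lin) x = trace N P h (f.lin x) := by
  simp only [trace_apply, LinearMap.comp_apply, f.map_d]

/-- A surjective morphism has a degree-preserving linear section. -/
theorem exists_section {M N : TriMod.{v} k} (f : M ⟶ N) (hf : Function.Surjective f.lin) :
    ∃ σ : N →ₗ[k] M, (∀ n x, x ∈ N.gr n → σ x ∈ M.gr n) ∧ ∀ x, f.lin (σ x) = x := by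
  have h : ∀ n, ∃ g : N.gr n →ₗ[k] M.gr n, (f.lin.restrict (f.map_gr n)) ∘ₗ g = LinearMap.id := by
    intro n
    refine LinearMap.exists_rightInverse_of_surjective _ (LinearMap.range_eq_top.2 ?_)
    rintro ⟨y, hy⟩
    obtain ⟨x, rfl⟩ := hf y
    refine ⟨⟨M.proj n x, M.proj_mem n x⟩, Subtype.ext ?_⟩
    change f.lin (M.proj n x) = f.lin x
    rw [proj, hom_scale]
    exact N.proj_of_mem hy
  choose g hg using h
  let e := LinearEquiv.ofBijective (DirectSum.coeLinearMap N.gr) N.isInternal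
  have he : ∀ n x (hx : x ∈ N.gr n), e.symm x = DirectSum.lof k _ (fun i => N.gr i) n ⟨x, hx⟩ := by
    intro n x hx
    rw [LinearEquiv.symm_apply_eq]
    exact (DirectSum.coeLinearMap_lof N.gr n ⟨x, hx⟩).symm
  let σ : N →ₗ[k] M := DirectSum.toModule k _ M (fun n => (M.gr n).subtype ∘ₗ g n) ∘ₗ
    e.symm.toLinearMap
  have hσ : ∀ n x (hx : x ∈ N.gr n), σ x = g n ⟨x, hx⟩ := by
    intro n x hx
    simp [σ, he n x hx]
  refine ⟨σ, fun n x hx => ?_, fun x => ?_⟩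
  · rw [hσ n x hx]; exact (g n _).2
  · induction x using N.homogeneous_induction with
    | hom n x hx =>
      rw [hσ n x hx]
      exact congrArg Subtype.val (LinearMap.congr_fun (hg n) ⟨x, hx⟩)
    | add x y hx hy => rw [map_add, map_add, hx, hy]

theorem projective_of_trace {P : TriMod.{v} k} (h : P →ₗ[k] P) (hh : IsLowering h)
    (ht : trace P P h = LinearMap.id) : Projective P where
  factors {E X} f e _ := by
    obtain ⟨σ, hσ, hσe⟩ := exists_section e (surjective_of_epi e)
    refine ⟨traceHom (σ ∘ₗ f.lin ∘ₗ h) fun n x hx => hσ _ _ (f.map_gr _ _ (hh n x hx)), ?_⟩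
    ext x
    change e.lin (trace P E (σ ∘ₗ f.lin ∘ₗ h) x) = f.lin x
    rw [← trace_comp, show e.lin ∘ₗ σ ∘ₗ f.lin ∘ₗ h = f.lin ∘ₗ h from
      LinearMap.ext fun x => hσe _, trace_comp, ht]
    rfl

/-- The module `Λ₃ ⊗ M`. -/
@[reducible] def free (M : TriMod.{v} k) : TriMod.{v} k := ((M.adjoin 2).adjoin 1).adjoin 0

/-- The morphism `Λ₃ ⊗ M ⟶ M` given by the augmentation of `Λ₃`. -/
def freeCounit (M : TriMod.{v} k) : free M ⟶ M :=
  ⟨LinearMap.fst k M M ∘ₗ LinearMap.fst k (M × M) (M × M) ∘ₗ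
    LinearMap.fst k ((M × M) × (M × M)) ((M × M) × (M × M)),
    fun n x hx => hx.1.1.1, fun s x => by fin_cases s <;> simp [adjoin]⟩

theorem exists_trace_free (M : TriMod.{v} k) :
    ∃ h : free M →ₗ[k] free M, IsLowering h ∧ trace (free M) (free M) h = LinearMap.id := by
  have e1 : (1 : Fin 3 → ℤ) = Pi.single 0 1 + Pi.single 1 1 + Pi.single 2 1 := by
    ext i; fin_cases i <;> simp
  refine ⟨LinearMap.inl k ((M × M) × (M × M)) ((M × M) × (M × M)) ∘ₗ
    LinearMap.inl k (M × M) (M × M) ∘ₗ LinearMap.inl k M M ∘ₗ LinearMap.snd k M M ∘ₗ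
    LinearMap.snd k (M × M) (M × M) ∘ₗ
    LinearMap.snd k ((M × M) × (M × M)) ((M × M) × (M × M)), ?_, ?_⟩
  · intro n x hx
    have h := hx.2.2.2
    have e : n - 1 = n - Pi.single 0 1 - Pi.single 1 1 - Pi.single 2 1 := by rw [e1]; abel
    rw [← e] at h
    exact ⟨⟨⟨h, Submodule.zero_mem _⟩, ⟨Submodule.zero_mem _, Submodule.zero_mem _⟩⟩,
      ⟨⟨Submodule.zero_mem _, Submodule.zero_mem _⟩, ⟨Submodule.zero_mem _,
        Submodule.zero_mem _⟩⟩⟩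
  · refine LinearMap.ext fun x => ?_
    rw [trace_apply]
    obtain ⟨⟨⟨x0, x1⟩, ⟨x2, x3⟩⟩, ⟨⟨x4, x5⟩, ⟨x6, x7⟩⟩⟩ := x
    simp [adjoin]

theorem exists_trace_of_projective (P : TriMod.{v} k) [Projective P] :
    ∃ h : P →ₗ[k] P, IsLowering h ∧ trace P P h = LinearMap.id := by
  have hepi : Epi (freeCounit P) := ⟨fun {Q} g h e => by
    ext x
    exact congrArg (fun l : free P ⟶ Q => l.lin (((x, 0), (0, 0)), ((0, 0), (0, 0)))) e⟩
  obtain ⟨h, hh, ht⟩ := exists_trace_free P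
  let σ : P ⟶ free P := Projective.factorThru (𝟙 P) (freeCounit P)
  have hσ : ∀ x, (freeCounit P).lin (σ.lin x) = x := fun x =>
    congrArg (fun l : P ⟶ P => l.lin x) (Projective.factorThru_comp (𝟙 P) (freeCounit P))
  refine ⟨(freeCounit P).lin ∘ₗ h ∘ₗ σ.lin, fun n x hx => (freeCounit P).map_gr _ _
    (hh _ _ (σ.map_gr _ _ hx)), LinearMap.ext fun x => ?_⟩
  rw [trace_comp, comp_trace, ht]
  exact hσ x

/-- A morphism factors through a projective object if and only if it is obtained from a linear map
of degree `(-1,-1,-1)` by the action of `∂₁∂₂∂₃`. -/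
theorem factors_iff {M N : TriMod.{v} k} (f : M ⟶ N) :
    (∃ (P : TriMod.{v} k) (a : M ⟶ P) (b : P ⟶ N), Projective P ∧ f = a ≫ b) ↔
      ∃ h : M →ₗ[k] N, IsLowering h ∧ trace M N h = f.lin := by
  constructor
  · rintro ⟨P, a, b, hP, rfl⟩
    obtain ⟨h, hh, ht⟩ := exists_trace_of_projective P
    refine ⟨b.lin ∘ₗ h ∘ₗ a.lin, fun n x hx => b.map_gr _ _ (hh _ _ (a.map_gr _ _ hx)),
      LinearMap.ext fun x => ?_⟩
    rw [trace_comp, comp_trace, ht]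
    rfl
  · rintro ⟨h, hh, ht⟩
    obtain ⟨h', hh', ht'⟩ := exists_trace_free N
    let u : N →ₗ[k] free N := LinearMap.inl k ((N × N) × (N × N)) ((N × N) × (N × N)) ∘ₗ
      LinearMap.inl k (N × N) (N × N) ∘ₗ LinearMap.inl k N N
    refine ⟨free N, traceHom (u ∘ₗ h) fun n x hx => ⟨⟨⟨hh n x hx, Submodule.zero_mem _⟩,
      ⟨Submodule.zero_mem _, Submodule.zero_mem _⟩⟩,
      ⟨⟨Submodule.zero_mem _, Submodule.zero_mem _⟩, ⟨Submodule.zero_mem _,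
        Submodule.zero_mem _⟩⟩⟩, freeCounit N, projective_of_trace h' hh' ht', ?_⟩
    ext x
    change f.lin x = (freeCounit N).lin (trace M (free N) (u ∘ₗ h) x)
    rw [← trace_comp, ← ht]
    rfl

/-! ### The stable category -/

/-- Two morphisms of `ℳ₃` are identified in the stable category if their difference factors
through a projective object. -/
def stableRel (k : Type u) [Field k] : HomRel (TriMod.{v} k) := fun M N f g =>
  ∃ (P : TriMod.{v} k) (a : M ⟶ P) (b : P ⟶ N), Projective P ∧ f - g = a ≫ b

instance : Congruence (stableRel.{v} k) where
  comp_left := by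
    rintro L M N f g g' ⟨P, a, b, hP, h⟩
    exact ⟨P, f ≫ a, b, hP, by rw [← Preadditive.comp_sub, h, Category.assoc]⟩
  comp_right := by
    rintro L M N f f' g ⟨P, a, b, hP, h⟩
    exact ⟨P, a, b ≫ g, hP, by rw [← Preadditive.sub_comp, h, Category.assoc]⟩
  equivalence {M N} :=
    { refl f := (factors_iff (f - f)).2 ⟨0, fun _ _ _ => Submodule.zero_mem _, by simp⟩
      symm := by
        rintro f g ⟨P, a, b, hP, h⟩
        exact ⟨P, -a, b, hP, by rw [Preadditive.neg_comp, ← h, neg_sub]⟩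
      trans := by
        intro f g h hfg hgh
        obtain ⟨x, hx, hx'⟩ := (factors_iff (f - g)).1 hfg
        obtain ⟨y, hy, hy'⟩ := (factors_iff (g - h)).1 hgh
        exact (factors_iff (f - h)).2 ⟨x + y,
          fun n z hz => Submodule.add_mem _ (hx n z hz) (hy n z hz), by simp [hx', hy']⟩ }

/-- The stable category `𝒮ℳ₃`: the objects of `ℳ₃`, with the morphisms of `ℳ₃` modulo those that
factor through a projective object. -/
abbrev StableCat (k : Type u) [Field k] := CategoryTheory.Quotient (stableRel.{v} k)

/-- The quotient functor `ℳ₃ ⥤ 𝒮ℳ₃`. -/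
abbrev toStable (k : Type u) [Field k] : TriMod.{v} k ⥤ StableCat.{v} k :=
  CategoryTheory.Quotient.functor (stableRel.{v} k)

theorem trace_adjoin (s : Fin 3) {M N : TriMod.{v} k} (h : M →ₗ[k] N) :
    trace (M.adjoin s) (N.adjoin s) (h.prodMap (-h)) = (trace M N h).prodMap (trace M N h) := by
  refine LinearMap.ext fun x => ?_
  change _ = (trace M N h x.1, trace M N h x.2)
  rw [trace_apply, trace_apply, trace_apply]
  fin_cases s
  · refine Prod.ext (by simp [adjoin]) (by simp [adjoin]; abel)
  · refine Prod.ext (by simp [adjoin]) (by simp [adjoin]; abel)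
  · refine Prod.ext (by simp [adjoin]) (by simp [adjoin]; abel)

theorem isLowering_adjoin (s : Fin 3) {M N : TriMod.{v} k} {h : M →ₗ[k] N} (hh : IsLowering h) :
    IsLowering (M := M.adjoin s) (N := N.adjoin s) (h.prodMap (-h)) := fun n x hx =>
  ⟨hh _ _ hx.1, Submodule.neg_mem _ (by
    have := hh _ _ hx.2
    rwa [sub_right_comm] at this)⟩

theorem trace_shift_of_odd (a : Fin 3 → ℤ) (ha : (∑ i, a i).negOnePow = -1) {M N : TriMod.{v} k}
    (h : M →ₗ[k] N) : trace (M.shift a) (N.shift a) h = -trace M N h := by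
  have hd : ∀ (L : TriMod.{v} k) (s : Fin 3) (x : L), (L.shift a).d s x = -L.d s x := by
    intro L s x
    change ((∑ i, a i).negOnePow • L.d s) x = _
    rw [ha, Units.neg_smul, one_smul, LinearMap.neg_apply]
  refine LinearMap.ext fun x => ?_
  rw [LinearMap.neg_apply, trace_apply, trace_apply]
  simp only [hd, map_neg, map_sub, map_add]
  abel

theorem freeHull_trace {M N : TriMod.{v} k} (f : M ⟶ N) (h : M →ₗ[k] N) (hh : IsLowering h)
    (hf : trace M N h = f.lin) :
    ∃ h' : (freeHull k).obj M →ₗ[k] (freeHull k).obj N, IsLowering h' ∧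
      trace _ _ h' = ((freeHull k).map f).lin ∧
      ∀ x, h' (((freeIncl k).app M).lin x) = ((freeIncl k).app N).lin (h x) := by
  let h1 : M.adjoin 2 →ₗ[k] N.adjoin 2 := h.prodMap (-h)
  let h2 : (M.adjoin 2).adjoin 1 →ₗ[k] (N.adjoin 2).adjoin 1 := h1.prodMap (-h1)
  let h3 : free M →ₗ[k] free N := h2.prodMap (-h2)
  have l3 : IsLowering h3 :=
    isLowering_adjoin 0 (isLowering_adjoin 1 (isLowering_adjoin 2 hh))
  have t3 : trace (free M) (free N) h3 =
      ((f.lin.prodMap f.lin).prodMap (f.lin.prodMap f.lin)).prodMap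
        ((f.lin.prodMap f.lin).prodMap (f.lin.prodMap f.lin)) := by
    rw [← hf, ← trace_adjoin 2, ← trace_adjoin 1, ← trace_adjoin 0]
  refine ⟨-h3, fun n x hx => Submodule.neg_mem _ ?_, ?_, fun x => ?_⟩
  · have := l3 _ _ hx
    rwa [sub_right_comm] at this
  · have hs : (∑ i, (![-1, -1, -1] : Fin 3 → ℤ) i).negOnePow = -1 := by
      simp [Fin.sum_univ_three]; rfl
    refine Eq.trans ?_ t3
    refine (trace_shift_of_odd _ hs (M := free M) (N := free N) (-h3)).trans ?_
    rw [map_neg, neg_neg]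
  · change -(((h 0, -h 0), -(h 0, -h 0)), -((h 0, -h 0), -(h 0, -h x))) =
      (((0, 0), (0, 0)), ((0, 0), (0, h x)))
    simp

theorem susp_trace {M N : TriMod.{v} k} (f : M ⟶ N) (h : M →ₗ[k] N) (hh : IsLowering h)
    (hf : trace M N h = f.lin) : ∃ h' : (susp k).obj M →ₗ[k] (susp k).obj N,
      IsLowering h' ∧ trace _ _ h' = ((susp k).map f).lin := by
  obtain ⟨H, hH, htH, hι⟩ := freeHull_trace f h hh hf
  let h' : (susp k).obj M →ₗ[k] (susp k).obj N :=
    (LinearMap.range ((freeIncl k).app M).lin).mapQ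
      (LinearMap.range ((freeIncl k).app N).lin) H (by
        rintro _ ⟨x, rfl⟩
        exact ⟨h x, (hι x).symm⟩)
  refine ⟨h', ?_, LinearMap.ext fun x => ?_⟩
  · rintro n _ ⟨x, hx, rfl⟩
    exact ⟨H x, hH n x hx, rfl⟩
  · obtain ⟨x, rfl⟩ := Submodule.mkQ_surjective _ x
    change trace _ _ h' ((cokerProj ((freeIncl k).app M)).lin x) =
      (cokerProj ((freeIncl k).app N)).lin (((freeHull k).map f).lin x)
    refine (comp_trace (cokerProj ((freeIncl k).app M)) h' x).symm.trans ?_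
    refine (trace_comp H (cokerProj ((freeIncl k).app N)) x).trans ?_
    rw [htH]

theorem susp_map_sub {M N : TriMod.{v} k} (f g : M ⟶ N) :
    (susp k).map (f - g) = (susp k).map f - (susp k).map g := by
  refine coker_hom_ext ?_
  ext x
  have h : ((freeHull k).map (f - g)).lin x =
      ((freeHull k).map f).lin x - ((freeHull k).map g).lin x := rfl
  exact (congrArg (cokerProj ((freeIncl k).app N)).lin h).trans (map_sub _ _ _)

/-- The suspension `[1]` of the stable category. -/
def stableSusp (k : Type u) [Field k] : StableCat.{v} k ⥤ StableCat.{v} k :=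
  CategoryTheory.Quotient.lift (stableRel.{v} k) (susp k ⋙ toStable k) (by
    intro M N f g hfg
    obtain ⟨h, hh, ht⟩ := (factors_iff (f - g)).1 hfg
    obtain ⟨h', hh', ht'⟩ := susp_trace (f - g) h hh ht
    refine CategoryTheory.Quotient.sound _
      ((factors_iff ((susp k).map f - (susp k).map g)).2 ⟨h', hh', ?_⟩)
    rw [ht', susp_map_sub])

/-- The distinguished triangles `X ⟶ Y ⟶ Z ⟶ X[1]` of the stable category: those isomorphic to
`M ⟶ N ⟶ cone u ⟶ M[1]` for a morphism `u : M ⟶ N` of `ℳ₃`. -/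
def IsDistinguished {X Y Z : StableCat.{v} k} (f : X ⟶ Y) (g : Y ⟶ Z)
    (h : Z ⟶ (stableSusp k).obj X) : Prop :=
  ∃ (M N : TriMod.{v} k) (u : M ⟶ N) (a : X ≅ (toStable k).obj M) (b : Y ≅ (toStable k).obj N)
    (c : Z ≅ (toStable k).obj (cone u)),
    f ≫ b.hom = a.hom ≫ (toStable k).map u ∧
    g ≫ c.hom = b.hom ≫ (toStable k).map (coneIn u) ∧
    h ≫ (stableSusp k).map a.hom = c.hom ≫
      ((toStable k).map (coneOut u) : _ ⟶ (stableSusp k).obj ((toStable k).obj M))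

/-- An endofunctor `F` of the stable category is exact if it commutes with the suspension and, with
respect to a suitable isomorphism `F(X[1]) ≅ F(X)[1]`, natural in `X`, it preserves distinguished
triangles. -/
def IsExact (F : StableCat.{v} k ⥤ StableCat.{v} k) : Prop :=
  ∃ ξ : stableSusp k ⋙ F ≅ F ⋙ stableSusp k,
    ∀ ⦃X Y Z : StableCat.{v} k⦄ (f : X ⟶ Y) (g : Y ⟶ Z) (h : Z ⟶ (stableSusp k).obj X),
      IsDistinguished f g h → IsDistinguished (F.map f) (F.map g) (F.map h ≫ ξ.hom.app X)

end TriMod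

/-! ### The braid group -/

/-- The defining relations of the braid group on generators `σᵣ`, `r ∈ ℤ`. -/
def braidRels : Set (FreeGroup ℤ) :=
  {w | ∃ r : ℤ, w = FreeGroup.of r * FreeGroup.of (r + 1) * FreeGroup.of r *
    (FreeGroup.of (r + 1) * FreeGroup.of r * FreeGroup.of (r + 1))⁻¹} ∪
  {w | ∃ r s : ℤ, 1 < |r - s| ∧
    w = FreeGroup.of r * FreeGroup.of s * (FreeGroup.of s * FreeGroup.of r)⁻¹}

/-- The braid group `Br_∞` on infinitely many strands, with generators enumerated by integers. -/
abbrev BraidInf : Type := PresentedGroup braidRels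

namespace TriMod

variable {k : Type u} [Field k]

/-! ### Stably zero morphisms -/

/-! Stable equality is made computable by `factors_iff`: a morphism of `ℳ₃` is stably zero if and
only if it arises from a linear map of degree `(-1,-1,-1)` by iterated supercommutators with `∂₃`,
`∂₂`, `∂₁` (`trace`). The other general input is that projective objects are injective
(`exists_extension`).

Descent. An exact endofunctor `G` of `ℳ₃` that preserves projectives induces an exact functor on the
stable category (`isExact_descend`). Since the hull `Λ₃ ⊗ G M{-1,-1,-1}` is injective, the inclusion
of `G M` into it extends over `G` of the hull of `M`. The extension is not natural, but its defects
vanish on `G M` and pass through projectives, so the induced maps on suspensions and cones are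
stably what they should be. The functors `ℛᵣ` and `ℛ'ᵣ` qualify: a `∂₃`-cone is an extension, and
`𝒰ᵣ` preserves projectives because a projective module is `∂₃`-contractible by a homotopy that
preserves the planes `i - j = r`.

Homotopies. In `trace` the supercommutator with `∂₃` can be taken last. So let `H` be a
`∂₃`-homotopy that anticommutes with `∂₁` and `∂₂`, and let `G` have degree `(-1,-1,0)`. If the
iterated supercommutator of `∂₁` and `∂₂` with `G` is the identity on the image of `H`, then `∂₃H +
H∂₃` is the trace of `G ∘ H` (`exists_trace_of_homotopy`). On `Q ⊗ V`, where `∂₁` and `∂₂` vanish on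
`V`, the contraction `∂₁∂₂ω ⊗ v ↦ ω ⊗ v` is such a `G`. Hence Gaussian elimination for the
differential `∂₃` is allowed in the stable category as long as the homotopies take values in
summands of the form `Q ⊗ V`.

Inverses. Write `Mᵣ` for the part of `M` in the plane `i - j = r`. Only `ω` and `∂₁∂₂ω` preserve the
planes, so `ℛᵣ(M)ᵣ` consists of `ω ⊗ Mᵣ`, `∂₁∂₂ω ⊗ Mᵣ` and `Mᵣ`. In `ℛ'ᵣ ℛᵣ(M)`, built from `𝒰ᵣ(M)`,
`M` and `Q ⊗ ℛᵣ(M)ᵣ`, the map `in` cancels `ω ⊗ Mᵣ` against `Mᵣ`, and `out` cancels `𝒰ᵣ(M)` against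
`Q ⊗ ∂₁∂₂ω ⊗ Mᵣ`; what is left is `M` (`isIso_counitHom`). The other order is dual
(`isIso_counitHom'`).

Relations. If `|r - s| > 1`, then `Q ⊗ Mₛ` does not meet the plane `r`, so the two cones do not
interact and can be interchanged already in `ℳ₃` (`isIso_commHom`). If `t = r ± 1`, elimination in
the plane `r` of `ℛₜ ℛᵣ(M)` leaves a shifted copy of `Mₜ` (`retract_contraction`). This reduces `ℛᵣ
ℛₜ ℛᵣ(M)` to a model made of two copies of `Q ⊗ Mᵣ`, two copies of `Q ⊗ Mₜ` and `M`. The model is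
symmetric in `r` and `t` (`isIso_modelHom`), which gives the braid relation.

Action. Isomorphism classes of exact endofunctors form a monoid in which the classes of the `ℛᵣ` are
units that satisfy the braid relations. The universal property of `Br_∞` gives a homomorphism, and
representatives of its values are the functors `Φ_g`. -/

theorem toStable_map_eq_iff {M N : TriMod.{v} k} (f g : M ⟶ N) :
    (toStable k).map f = (toStable k).map g ↔
      ∃ h : M →ₗ[k] N, IsLowering h ∧ trace M N h = (f - g).lin := by
  rw [CategoryTheory.Quotient.functor_map_eq_iff]
  exact factors_iff (f - g)

theorem toStable_map_eq_of_factors {M N P : TriMod.{v} k} {f g : M ⟶ N} (hP : Projective P)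
    (a : M ⟶ P) (b : P ⟶ N) (h : f - g = a ≫ b) :
    (toStable k).map f = (toStable k).map g :=
  CategoryTheory.Quotient.sound _ ⟨P, a, b, hP, h⟩

theorem isIso_toStable_map {M N : TriMod.{v} k} (f : M ⟶ N) (g : N ⟶ M)
    (h : (toStable k).map (f ≫ g) = (toStable k).map (𝟙 M))
    (h' : (toStable k).map (g ≫ f) = (toStable k).map (𝟙 N)) : IsIso ((toStable k).map f) :=
  ⟨(toStable k).map g, by rw [← Functor.map_comp, h, CategoryTheory.Functor.map_id],
    by rw [← Functor.map_comp, h', CategoryTheory.Functor.map_id]⟩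

/-! ### Short exact sequences -/

/-- The sequence `A ⟶ X ⟶ C ⟶ 0` is exact. -/
structure RightExact {A X C : TriMod.{v} k} (i : A ⟶ X) (p : X ⟶ C) : Prop where
  surj : Function.Surjective p.lin
  comp : ∀ a, p.lin (i.lin a) = 0
  exact : ∀ x, p.lin x = 0 → ∃ a, i.lin a = x

theorem rightExact_cokerProj {A X : TriMod.{v} k} (i : A ⟶ X) : RightExact i (cokerProj i) where
  surj := Submodule.mkQ_surjective _
  comp a := (Submodule.Quotient.mk_eq_zero _).2 ⟨a, rfl⟩
  exact _ hx := (Submodule.Quotient.mk_eq_zero _).1 hx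

theorem RightExact.hom_ext {A X C D : TriMod.{v} k} {i : A ⟶ X} {p : X ⟶ C}
    (h : RightExact i p) {f g : C ⟶ D} (e : p ≫ f = p ≫ g) : f = g := by
  refine TriMod.hom_ext fun y => ?_
  obtain ⟨x, rfl⟩ := h.surj y
  exact congrArg (fun l : X ⟶ D => l.lin x) e

/-- Composing `f` with a graded linear section of `p` works: the choice of lift is irrelevant
because two lifts differ by an element of `i(A)`, which `f` kills. The same independence makes the
composite commute with the differentials. -/
theorem RightExact.exists_desc {A X C D : TriMod.{v} k} {i : A ⟶ X} {p : X ⟶ C}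
    (h : RightExact i p) (f : X ⟶ D) (hf : i ≫ f = 0) : ∃ g : C ⟶ D, p ≫ g = f := by
  obtain ⟨σ, hσ, hp⟩ := exists_section p h.surj
  have key : ∀ x, f.lin (σ (p.lin x)) = f.lin x := by
    intro x
    obtain ⟨a, ha⟩ := h.exact (σ (p.lin x) - x) (by rw [map_sub, hp, sub_self])
    have h2 : f.lin (i.lin a) = 0 := congrArg (fun l : A ⟶ D => l.lin a) hf
    rw [ha, map_sub] at h2
    exact sub_eq_zero.1 h2
  refine ⟨⟨f.lin ∘ₗ σ, fun n x hx => f.map_gr _ _ (hσ _ _ hx), fun s x => ?_⟩, ?_⟩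
  · obtain ⟨x, rfl⟩ := h.surj x
    rw [← p.map_d, LinearMap.comp_apply, LinearMap.comp_apply, key, key, f.map_d]
  · ext x
    exact key x

/-- A morphism between cokernels is stably zero if it is covered by a morphism that vanishes on
the kernel and has values in a projective object. -/
theorem RightExact.toStable_eq {A X C Y D : TriMod.{v} k} {i : A ⟶ X} {p : X ⟶ C}
    (h : RightExact i p) (hY : Projective Y) (δ : X ⟶ Y) (q : Y ⟶ D) (hδ : i ≫ δ = 0)
    {f g : C ⟶ D} (e : p ≫ (f - g) = δ ≫ q) : (toStable k).map f = (toStable k).map g := by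
  obtain ⟨δ', rfl⟩ := h.exists_desc δ hδ
  exact toStable_map_eq_of_factors hY δ' q (h.hom_ext (by rw [e, Category.assoc]))

/-- An injective morphism has a degree-preserving linear retraction. -/
theorem exists_retraction {M N : TriMod.{v} k} (f : M ⟶ N) (hf : Function.Injective f.lin) :
    ∃ ρ : N →ₗ[k] M, (∀ n x, x ∈ N.gr n → ρ x ∈ M.gr n) ∧ ∀ x, ρ (f.lin x) = x := by
  obtain ⟨σ, hσ, hp⟩ := exists_section (cokerProj f) (rightExact_cokerProj f).surj
  -- The retraction is `y ↦ f⁻¹(y - σ[y])`, where `σ` splits the cokernel projection. Each of its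
  -- properties is verified after applying the injective map `f`.
  have h1 : ∀ y : N, ∃ x : M, f.lin x = y - σ ((cokerProj f).lin y) := fun y =>
    (rightExact_cokerProj f).exact _ (by rw [map_sub, hp, sub_self])
  choose ρ hρ using h1
  refine ⟨⟨⟨ρ, fun x y => hf ?_⟩, fun c x => hf ?_⟩, fun n x hx => ?_, fun x => hf ?_⟩
  · rw [map_add, hρ, hρ, hρ, map_add, map_add]; abel
  · rw [RingHom.id_apply, map_smul, hρ, hρ, map_smul, map_smul, smul_sub]
  · have h2 : f.lin (ρ x) ∈ N.gr n := by
      rw [hρ]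
      exact Submodule.sub_mem _ hx (hσ _ _ ((cokerProj f).map_gr _ _ hx))
    have h3 : f.lin (M.proj n (ρ x)) = f.lin (ρ x) :=
      (hom_scale f _ _).trans (N.proj_of_mem h2)
    change ρ x ∈ _
    rw [← hf h3]
    exact M.proj_mem n _
  · change f.lin (ρ (f.lin x)) = _
    rw [hρ, show (cokerProj f).lin (f.lin x) = 0 from (rightExact_cokerProj f).comp x, map_zero,
      sub_zero]

/-- Projective objects are injective. -/
theorem exists_extension {A X P : TriMod.{v} k} (hP : Projective P) (i : A ⟶ X)
    (hi : Function.Injective i.lin) (f : A ⟶ P) : ∃ g : X ⟶ P, i ≫ g = f := by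
  obtain ⟨h, hh, ht⟩ := exists_trace_of_projective P
  obtain ⟨ρ, hρ, hρi⟩ := exists_retraction i hi
  -- The retraction `ρ` is only linear. Taking the trace makes the extension `Λ₃`-linear, and on `A`
  -- it gives back `f` because the trace of `h` is the identity.
  refine ⟨traceHom (h ∘ₗ f.lin ∘ₗ ρ) fun n x hx => hh _ _ (f.map_gr _ _ (hρ _ _ hx)), ?_⟩
  ext x
  change trace X P (h ∘ₗ f.lin ∘ₗ ρ) (i.lin x) = f.lin x
  rw [← comp_trace, show (h ∘ₗ f.lin ∘ₗ ρ) ∘ₗ i.lin = h ∘ₗ f.lin from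
    LinearMap.ext fun x => by simp [hρi], comp_trace, ht]
  rfl

/-- The shift is odd, so it negates all three differentials and with them the trace; replacing `h`
by `-h` compensates. -/
theorem projective_freeHull (M : TriMod.{v} k) : Projective ((freeHull k).obj M) := by
  obtain ⟨h, hh, ht⟩ := exists_trace_free M
  have hs : (∑ i, (![-1, -1, -1] : Fin 3 → ℤ) i).negOnePow = -1 := by
    simp [Fin.sum_univ_three]; rfl
  refine projective_of_trace (P := (freeHull k).obj M) (-h)
    (fun n x hx => Submodule.neg_mem _ ?_) ?_
  · have := hh _ _ hx
    rwa [sub_right_comm] at this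
  · refine (trace_shift_of_odd _ hs (M := free M) (N := free M) (-h)).trans ?_
    rw [map_neg, neg_neg, ht]
    rfl

/-- The inclusion of `M` into `Λ₃ ⊗ M{-1,-1,-1}`. -/
abbrev hullIncl (M : TriMod.{v} k) : M ⟶ (freeHull k).obj M := (freeIncl k).app M

/-- The projection of `Λ₃ ⊗ M{-1,-1,-1}` onto `M[1]`. -/
def suspProj (M : TriMod.{v} k) : (freeHull k).obj M ⟶ (susp k).obj M := cokerProj (hullIncl M)

/-- The projection of `N ⊕ Λ₃ ⊗ M{-1,-1,-1}` onto the cone of `u : M ⟶ N`. -/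
def coneProj {M N : TriMod.{v} k} (u : M ⟶ N) : dsum N ((freeHull k).obj M) ⟶ cone u :=
  cokerProj (coneEmb u)

theorem rightExact_susp (M : TriMod.{v} k) : RightExact (hullIncl M) (suspProj M) :=
  rightExact_cokerProj _

theorem rightExact_cone {M N : TriMod.{v} k} (u : M ⟶ N) :
    RightExact (coneEmb u) (coneProj u) :=
  rightExact_cokerProj _

theorem RightExact.comp_eq_zero {A X C : TriMod.{v} k} {i : A ⟶ X} {p : X ⟶ C}
    (h : RightExact i p) : i ≫ p = 0 :=
  TriMod.hom_ext h.comp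

theorem freeIncl_injective (M : TriMod.{v} k) :
    Function.Injective (hullIncl M).lin := fun _ _ h =>
  congrArg (fun y : (((M × M) × (M × M)) × ((M × M) × (M × M))) => y.2.2.2) h

/-! ### Biproduct structure of `dsum` -/

/-- The first inclusion into a direct sum. -/
def dsumInl (M N : TriMod.{v} k) : M ⟶ dsum M N :=
  ⟨LinearMap.inl k M N, fun _ _ hx => ⟨hx, Submodule.zero_mem _⟩,
    fun s _ => Prod.ext rfl (map_zero (N.d s)).symm⟩

/-- The second inclusion into a direct sum. -/
def dsumInr (M N : TriMod.{v} k) : N ⟶ dsum M N :=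
  ⟨LinearMap.inr k M N, fun _ _ hx => ⟨Submodule.zero_mem _, hx⟩,
    fun s _ => Prod.ext (map_zero (M.d s)).symm rfl⟩

/-- The first projection of a direct sum. -/
def dsumFst (M N : TriMod.{v} k) : dsum M N ⟶ M :=
  ⟨LinearMap.fst k M N, fun _ _ hx => hx.1, fun _ _ => rfl⟩

/-- The second projection of a direct sum. -/
def dsumSnd (M N : TriMod.{v} k) : dsum M N ⟶ N :=
  ⟨LinearMap.snd k M N, fun _ _ hx => hx.2, fun _ _ => rfl⟩

theorem dsumInl_fst (M N : TriMod.{v} k) : dsumInl M N ≫ dsumFst M N = 𝟙 M := rfl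

theorem dsumInr_snd (M N : TriMod.{v} k) : dsumInr M N ≫ dsumSnd M N = 𝟙 N := rfl

theorem dsumInl_snd (M N : TriMod.{v} k) : dsumInl M N ≫ dsumSnd M N = 0 := rfl

theorem dsumInr_fst (M N : TriMod.{v} k) : dsumInr M N ≫ dsumFst M N = 0 := rfl

theorem dsum_total (M N : TriMod.{v} k) :
    dsumFst M N ≫ dsumInl M N + dsumSnd M N ≫ dsumInr M N = 𝟙 (dsum M N) := by
  refine TriMod.hom_ext fun x => ?_
  change ((x.1, 0) + (0, x.2) : M × N) = x
  simp

/-! ### Exact functors on `ℳ₃` that preserve projective objects -/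

/-- Exact additive endofunctors of `ℳ₃`. -/
structure PreservesExact (G : TriMod.{v} k ⥤ TriMod.{v} k) : Prop where
  add : ∀ {M N : TriMod.{v} k} (f g : M ⟶ N), G.map (f + g) = G.map f + G.map g
  rightExact : ∀ {A X C : TriMod.{v} k} (i : A ⟶ X) (p : X ⟶ C), RightExact i p →
    RightExact (G.map i) (G.map p)
  inj : ∀ {M N : TriMod.{v} k} (f : M ⟶ N), Function.Injective f.lin →
    Function.Injective (G.map f).lin

/-- Endofunctors of `ℳ₃` that preserve projective objects. -/
def PreservesProjective (G : TriMod.{v} k ⥤ TriMod.{v} k) : Prop :=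
  ∀ P : TriMod.{v} k, Projective P → Projective (G.obj P)

namespace PreservesExact

variable {G : TriMod.{v} k ⥤ TriMod.{v} k}

theorem map_zero (hG : PreservesExact G) (M N : TriMod.{v} k) : G.map (0 : M ⟶ N) = 0 := by
  have h := hG.add (0 : M ⟶ N) 0
  rw [add_zero] at h
  exact left_eq_add.1 h

theorem map_neg (hG : PreservesExact G) {M N : TriMod.{v} k} (f : M ⟶ N) :
    G.map (-f) = -G.map f := by
  rw [eq_neg_iff_add_eq_zero, ← hG.add, neg_add_cancel, hG.map_zero]

theorem map_sub (hG : PreservesExact G) {M N : TriMod.{v} k} (f g : M ⟶ N) :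
    G.map (f - g) = G.map f - G.map g := by
  rw [sub_eq_add_neg, hG.add, hG.map_neg, sub_eq_add_neg]

end PreservesExact

/-- The functor on the stable category induced by an exact functor that preserves projective
objects. -/
def descend (G : TriMod.{v} k ⥤ TriMod.{v} k) (hG : PreservesExact G)
    (hP : PreservesProjective G) : StableCat.{v} k ⥤ StableCat.{v} k :=
  CategoryTheory.Quotient.lift (stableRel.{v} k) (G ⋙ toStable k) (by
    rintro M N f g ⟨P, a, b, h, e⟩
    exact toStable_map_eq_of_factors (hP P h) (G.map a) (G.map b)
      (by rw [← hG.map_sub, e, Functor.map_comp]))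

/-! ### Suspensions and cones under an exact functor that preserves projectives. -/

section Exactness

variable {G : TriMod.{v} k ⥤ TriMod.{v} k}

/-- The target is projective, hence injective, and `G` keeps the inclusion of `M` into its hull
injective. Nothing makes this choice natural in `M`. -/
theorem exists_hullComparison (hG : PreservesExact G) (M : TriMod.{v} k) :
    ∃ κ : G.obj ((freeHull k).obj M) ⟶ (freeHull k).obj (G.obj M),
      G.map (hullIncl M) ≫ κ = hullIncl (G.obj M) :=
  exists_extension (projective_freeHull _) _ (hG.inj _ (freeIncl_injective M)) _

/-- An extension of `G M ⟶ Λ₃ ⊗ G M{-1,-1,-1}` to `G (Λ₃ ⊗ M{-1,-1,-1})`. -/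
noncomputable def hullComparison (hG : PreservesExact G) (M : TriMod.{v} k) :
    G.obj ((freeHull k).obj M) ⟶ (freeHull k).obj (G.obj M) :=
  (exists_hullComparison hG M).choose

theorem freeIncl_hullComparison (hG : PreservesExact G) (M : TriMod.{v} k) :
    G.map (hullIncl M) ≫ hullComparison hG M = hullIncl (G.obj M) :=
  (exists_hullComparison hG M).choose_spec

theorem exists_suspComparison (hG : PreservesExact G) (M : TriMod.{v} k) :
    ∃ κ : G.obj ((susp k).obj M) ⟶ (susp k).obj (G.obj M),
      G.map (suspProj M) ≫ κ =
        hullComparison hG M ≫ suspProj (G.obj M) :=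
  (hG.rightExact _ _ (rightExact_susp M)).exists_desc _ (by
    rw [← Category.assoc, freeIncl_hullComparison, (rightExact_susp _).comp_eq_zero])

/-- The morphism `G (M[1]) ⟶ (G M)[1]`. -/
noncomputable def suspComparison (hG : PreservesExact G) (M : TriMod.{v} k) :
    G.obj ((susp k).obj M) ⟶ (susp k).obj (G.obj M) :=
  (exists_suspComparison hG M).choose

theorem proj_suspComparison (hG : PreservesExact G) (M : TriMod.{v} k) :
    G.map (suspProj M) ≫ suspComparison hG M =
      hullComparison hG M ≫ suspProj (G.obj M) :=
  (exists_suspComparison hG M).choose_spec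

theorem hullIncl_naturality {M N : TriMod.{v} k} (f : M ⟶ N) :
    f ≫ hullIncl N = hullIncl M ≫ (freeHull k).map f := (freeIncl k).naturality f

theorem proj_susp_map {M N : TriMod.{v} k} (f : M ⟶ N) :
    suspProj M ≫ (susp k).map f =
      (freeHull k).map f ≫ suspProj N := rfl

/-- The square of hulls commutes only up to a defect. This defect vanishes on `G M`, since both
sides restrict there to the same map, and it lands in the projective hull of `G N`; on cokernels it
therefore becomes stably zero. -/
theorem suspComparison_naturality (hG : PreservesExact G) {M N : TriMod.{v} k} (f : M ⟶ N) :
    (toStable k).map (G.map ((susp k).map f) ≫ suspComparison hG N) =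
      (toStable k).map (suspComparison hG M ≫ (susp k).map (G.map f)) := by
  refine (hG.rightExact _ _ (rightExact_susp M)).toStable_eq (projective_freeHull (G.obj N))
    (G.map ((freeHull k).map f) ≫ hullComparison hG N -
      hullComparison hG M ≫ (freeHull k).map (G.map f)) (suspProj _) ?_ ?_
  · rw [Preadditive.comp_sub, ← Category.assoc, ← Functor.map_comp, ← hullIncl_naturality,
      ← Category.assoc, freeIncl_hullComparison, ← hullIncl_naturality, Functor.map_comp,
      Category.assoc, freeIncl_hullComparison, sub_self]
  · rw [Preadditive.comp_sub, Preadditive.sub_comp, ← Category.assoc, ← Functor.map_comp,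
      proj_susp_map, Functor.map_comp, Category.assoc, proj_suspComparison, ← Category.assoc
      (G.map (suspProj _)), proj_suspComparison, Category.assoc, Category.assoc, Category.assoc,
      proj_susp_map]

/-- For two direct sums with a common summand `A`, the composite of `1 ⊕ a` and `1 ⊕ b` differs from
the identity only on the other summand. It is applied with `A = G N` and with the two hulls as other
summands, so that the defect passes through a projective. -/
theorem biprod_comp_sub_id {C : Type*} [Category* C] [Preadditive C] {X A B X' B' : C}
    {f : X ⟶ A} {g : X ⟶ B} {i : A ⟶ X} {j : B ⟶ X} {f' : X' ⟶ A} {g' : X' ⟶ B'} {i' : A ⟶ X'}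
    {j' : B' ⟶ X'} (h : f ≫ i + g ≫ j = 𝟙 X) (h1 : i' ≫ f' = 𝟙 A) (h2 : i' ≫ g' = 0)
    (h3 : j' ≫ f' = 0) (h4 : j' ≫ g' = 𝟙 B') (a : B ⟶ B') (b : B' ⟶ B) :
    (f ≫ i' + (g ≫ a) ≫ j') ≫ (f' ≫ i + (g' ≫ b) ≫ j) - 𝟙 X = (g ≫ (a ≫ b - 𝟙 B)) ≫ j := by
  have e1 : (f ≫ i' + (g ≫ a) ≫ j') ≫ f' = f := by
    rw [Preadditive.add_comp, Category.assoc, h1, Category.assoc, h3, Category.comp_id,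
      Limits.comp_zero, add_zero]
  have e2 : (f ≫ i' + (g ≫ a) ≫ j') ≫ g' = g ≫ a := by
    rw [Preadditive.add_comp, Category.assoc, h2, Category.assoc, h4, Category.comp_id,
      Limits.comp_zero, zero_add]
  rw [← h, Preadditive.comp_add, ← Category.assoc _ f', e1, ← Category.assoc _ (g' ≫ b),
    ← Category.assoc _ g', e2, Preadditive.comp_sub, Preadditive.sub_comp, Category.assoc,
    Category.comp_id]
  simp only [Category.assoc]
  abel

/-- If `i : A ⟶ X` and `i' : A ⟶ X'` are related by morphisms `α : X ⟶ X'` and `β : X' ⟶ X` whose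
composites differ from the identities by morphisms through projective objects that vanish on `A`,
then the induced morphism of cokernels is a stable isomorphism. -/
theorem isIso_toStable_of_rightExact {A X X' C C' Y Y' : TriMod.{v} k} {i : A ⟶ X} {i' : A ⟶ X'}
    {p : X ⟶ C} {p' : X' ⟶ C'} (h : RightExact i p) (h' : RightExact i' p') {α : X ⟶ X'}
    {β : X' ⟶ X} (hβ : i' ≫ β = i) (hY : Projective Y) (hY' : Projective Y')
    (δ : X ⟶ Y) (q : Y ⟶ X) (δ' : X' ⟶ Y') (q' : Y' ⟶ X')
    (e : α ≫ β - 𝟙 X = δ ≫ q) (e' : β ≫ α - 𝟙 X' = δ' ≫ q') (hδ : i ≫ δ = 0) (hδ' : i' ≫ δ' = 0)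
    {f : C ⟶ C'} (hf : p ≫ f = α ≫ p') : IsIso ((toStable k).map f) := by
  obtain ⟨g, hg⟩ := h'.exists_desc (β ≫ p) (by
    rw [← Category.assoc, hβ]
    ext x
    exact h.comp x)
  refine isIso_toStable_map f g ?_ ?_
  · refine h.toStable_eq hY δ (q ≫ p) hδ ?_
    rw [Preadditive.comp_sub, ← Category.assoc, hf, Category.assoc, hg, ← Category.assoc δ, ← e,
      Preadditive.sub_comp, Category.comp_id, Category.id_comp, Category.assoc]
  · refine h'.toStable_eq hY' δ' (q' ≫ p') hδ' ?_
    rw [Preadditive.comp_sub, ← Category.assoc, hg, Category.assoc, hf, ← Category.assoc δ', ← e',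
      Preadditive.sub_comp, Category.comp_id, Category.id_comp, Category.assoc]

/-- Here preservation of projectives enters: `G` of the hull is projective, hence injective, so a
comparison exists in the reverse direction as well. -/
theorem exists_hullComparison_inv (hP : PreservesProjective G)
    (M : TriMod.{v} k) : ∃ l : (freeHull k).obj (G.obj M) ⟶ G.obj ((freeHull k).obj M),
      hullIncl (G.obj M) ≫ l = G.map (hullIncl M) :=
  exists_extension (hP _ (projective_freeHull _)) _ (freeIncl_injective _) _

/-- The two hull comparisons need not be mutually inverse. Their composites agree with the
identities on `G M`, and the differences live on projective objects, which is enough on the stable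
cokernels. -/
theorem isIso_suspComparison (hG : PreservesExact G) (hP : PreservesProjective G)
    (M : TriMod.{v} k) : IsIso ((toStable k).map (suspComparison hG M)) := by
  obtain ⟨l, hl⟩ := exists_hullComparison_inv hP M
  have hk := freeIncl_hullComparison hG M
  refine isIso_toStable_of_rightExact (hG.rightExact _ _ (rightExact_susp M))
    (rightExact_susp (G.obj M)) hl (hP _ (projective_freeHull M))
    (projective_freeHull (G.obj M)) (hullComparison hG M ≫ l - 𝟙 _) (𝟙 _)
    (l ≫ hullComparison hG M - 𝟙 _) (𝟙 _) (Category.comp_id _).symm (Category.comp_id _).symm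
    ?_ ?_ (proj_suspComparison hG M)
  · rw [Preadditive.comp_sub, ← Category.assoc, hk, hl, Category.comp_id, sub_self]
  · rw [Preadditive.comp_sub, ← Category.assoc, hl, hk, Category.comp_id]
    exact sub_self _

/-- The morphism `G (N ⊕ Λ₃ ⊗ M{-1,-1,-1}) ⟶ G N ⊕ Λ₃ ⊗ G M{-1,-1,-1}`. -/
noncomputable def dsumComparison (hG : PreservesExact G) (M N : TriMod.{v} k) :
    G.obj (dsum N ((freeHull k).obj M)) ⟶ dsum (G.obj N) ((freeHull k).obj (G.obj M)) :=
  G.map (dsumFst _ _) ≫ dsumInl _ _ + (G.map (dsumSnd _ _) ≫ hullComparison hG M) ≫ dsumInr _ _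

theorem coneEmb_eq {M N : TriMod.{v} k} (u : M ⟶ N) :
    coneEmb u = u ≫ dsumInl _ _ + hullIncl M ≫ dsumInr _ _ := by
  refine TriMod.hom_ext fun x => ?_
  change (u.lin x, (hullIncl M).lin x) = (u.lin x, 0) + (0, (hullIncl M).lin x)
  rw [Prod.mk_add_mk, add_zero, zero_add]

theorem coneEmb_fst {M N : TriMod.{v} k} (u : M ⟶ N) : coneEmb u ≫ dsumFst _ _ = u := rfl

theorem coneEmb_snd {M N : TriMod.{v} k} (u : M ⟶ N) :
    coneEmb u ≫ dsumSnd _ _ = hullIncl M := rfl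

theorem coneIn_eq {M N : TriMod.{v} k} (u : M ⟶ N) :
    coneIn u = dsumInl _ _ ≫ coneProj u := rfl

theorem proj_coneOut {M N : TriMod.{v} k} (u : M ⟶ N) :
    coneProj u ≫ coneOut u = -(dsumSnd _ _ ≫ suspProj M) := by
  refine TriMod.hom_ext fun x => ?_
  exact map_neg (suspProj M).lin x.2

theorem coneEmb_dsumComparison (hG : PreservesExact G) {M N : TriMod.{v} k} (u : M ⟶ N) :
    G.map (coneEmb u) ≫ dsumComparison hG M N = coneEmb (G.map u) := by
  rw [dsumComparison, Preadditive.comp_add, ← Category.assoc, ← Functor.map_comp, coneEmb_fst,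
    ← Category.assoc, ← Category.assoc, ← Functor.map_comp, coneEmb_snd, freeIncl_hullComparison,
    coneEmb_eq]

theorem exists_coneComparison (hG : PreservesExact G) {M N : TriMod.{v} k} (u : M ⟶ N) :
    ∃ c : G.obj (cone u) ⟶ cone (G.map u),
      G.map (coneProj u) ≫ c = dsumComparison hG M N ≫ coneProj (G.map u) :=
  (hG.rightExact _ _ (rightExact_cone u)).exists_desc _ (by
    rw [← Category.assoc, coneEmb_dsumComparison, (rightExact_cone _).comp_eq_zero])

/-- The comparison is the identity on `G N` and the hull comparison on the other summand. Hence the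
composites with the reverse comparison differ from the identities only in the projective summand,
and the differences vanish on the image of `G M`. -/
theorem isIso_coneComparison (hG : PreservesExact G) (hP : PreservesProjective G)
    {M N : TriMod.{v} k} (u : M ⟶ N) {c : G.obj (cone u) ⟶ cone (G.map u)}
    (hc : G.map (coneProj u) ≫ c =
      dsumComparison hG M N ≫ coneProj (G.map u)) : IsIso ((toStable k).map c) := by
  obtain ⟨l, hl⟩ := exists_hullComparison_inv hP M
  have hk := freeIncl_hullComparison hG M
  have h1 : G.map (dsumInl N ((freeHull k).obj M)) ≫ G.map (dsumFst _ _) = 𝟙 _ := by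
    rw [← Functor.map_comp, dsumInl_fst, CategoryTheory.Functor.map_id]
  have h2 : G.map (dsumInl N ((freeHull k).obj M)) ≫ G.map (dsumSnd _ _) = 0 := by
    rw [← Functor.map_comp, dsumInl_snd, hG.map_zero]
  have h3 : G.map (dsumInr N ((freeHull k).obj M)) ≫ G.map (dsumFst _ _) = 0 := by
    rw [← Functor.map_comp, dsumInr_fst, hG.map_zero]
  have h4 : G.map (dsumInr N ((freeHull k).obj M)) ≫ G.map (dsumSnd _ _) = 𝟙 _ := by
    rw [← Functor.map_comp, dsumInr_snd, CategoryTheory.Functor.map_id]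
  have h5 : G.map (dsumFst N ((freeHull k).obj M)) ≫ G.map (dsumInl _ _) +
      G.map (dsumSnd _ _) ≫ G.map (dsumInr _ _) = 𝟙 _ := by
    rw [← Functor.map_comp, ← Functor.map_comp, ← hG.add, dsum_total, CategoryTheory.Functor.map_id]
  have c1 : G.map (coneEmb u) ≫ G.map (dsumFst _ _) = G.map u := by
    rw [← Functor.map_comp, coneEmb_fst]
  have c2 : G.map (coneEmb u) ≫ G.map (dsumSnd _ _) = G.map (hullIncl M) := by
    rw [← Functor.map_comp, coneEmb_snd]
  refine isIso_toStable_of_rightExact (hG.rightExact _ _ (rightExact_cone u))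
    (rightExact_cone (G.map u)) 
    (β := dsumFst _ _ ≫ G.map (dsumInl _ _) + (dsumSnd _ _ ≫ l) ≫ G.map (dsumInr _ _)) ?_
    (hP _ (projective_freeHull M)) (projective_freeHull (G.obj M))
    (G.map (dsumSnd _ _) ≫ (hullComparison hG M ≫ l - 𝟙 _)) (G.map (dsumInr _ _))
    (dsumSnd _ _ ≫ (l ≫ hullComparison hG M - 𝟙 _)) (dsumInr _ _) ?_ ?_ ?_ ?_ hc
  · rw [Preadditive.comp_add, ← Category.assoc, ← Category.assoc, ← Category.assoc, coneEmb_fst,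
      coneEmb_snd, hl, ← c1, ← c2, Category.assoc, Category.assoc, ← Preadditive.comp_add, h5,
      Category.comp_id]
  · exact biprod_comp_sub_id h5 (dsumInl_fst _ _) (dsumInl_snd _ _) (dsumInr_fst _ _)
      (dsumInr_snd _ _) _ _
  · exact biprod_comp_sub_id (dsum_total _ _) h1 h2 h3 h4 _ _
  · rw [← Category.assoc, c2, Preadditive.comp_sub, ← Category.assoc, hk, hl, Category.comp_id,
      sub_self]
  · rw [← Category.assoc, coneEmb_snd, Preadditive.comp_sub, ← Category.assoc, hl, hk,
      Category.comp_id]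
    exact sub_self _

theorem coneIn_comparison (hG : PreservesExact G) {M N : TriMod.{v} k} (u : M ⟶ N)
    {c : G.obj (cone u) ⟶ cone (G.map u)}
    (hc : G.map (coneProj u) ≫ c = dsumComparison hG M N ≫ coneProj (G.map u)) :
    G.map (coneIn u) ≫ c = coneIn (G.map u) := by
  have h1 : G.map (dsumInl N ((freeHull k).obj M)) ≫ G.map (dsumFst _ _) = 𝟙 _ := by
    rw [← Functor.map_comp, dsumInl_fst, CategoryTheory.Functor.map_id]
  have h2 : G.map (dsumInl N ((freeHull k).obj M)) ≫ G.map (dsumSnd _ _) = 0 := by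
    rw [← Functor.map_comp, dsumInl_snd, hG.map_zero]
  rw [coneIn_eq, coneIn_eq, Functor.map_comp, Category.assoc, hc, ← Category.assoc,
    dsumComparison, Preadditive.comp_add, ← Category.assoc, h1, ← Category.assoc,
    ← Category.assoc, h2, Limits.zero_comp, Limits.zero_comp, add_zero, Category.id_comp]

/-- The maps on cones and on suspensions are induced by the same hull comparison, so this square
commutes in `ℳ₃` itself and not just stably. -/
theorem coneOut_comparison (hG : PreservesExact G) {M N : TriMod.{v} k} (u : M ⟶ N)
    {c : G.obj (cone u) ⟶ cone (G.map u)}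
    (hc : G.map (coneProj u) ≫ c = dsumComparison hG M N ≫ coneProj (G.map u)) :
    G.map (coneOut u) ≫ suspComparison hG M = c ≫ coneOut (G.map u) := by
  refine (hG.rightExact _ _ (rightExact_cone u)).hom_ext ?_
  rw [← Category.assoc, ← Functor.map_comp, proj_coneOut, hG.map_neg, Preadditive.neg_comp,
    Functor.map_comp, Category.assoc, proj_suspComparison, ← Category.assoc (G.map (coneProj u)), hc,
    Category.assoc _ (coneProj _),
    proj_coneOut, Preadditive.comp_neg, ← Category.assoc, ← Category.assoc, dsumComparison,
    Preadditive.add_comp, Category.assoc _ (dsumInl _ _), dsumInl_snd, Limits.comp_zero, zero_add,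
    Category.assoc _ (dsumInr _ _), dsumInr_snd, Category.comp_id]

/-- The natural isomorphism `G (M[1]) ≅ (G M)[1]` on the stable category. -/
noncomputable def descendSuspIso (hG : PreservesExact G) (hP : PreservesProjective G) :
    stableSusp k ⋙ descend G hG hP ≅ descend G hG hP ⋙ stableSusp k :=
  CategoryTheory.Quotient.natIsoLift _ (NatIso.ofComponents
    (fun M => @asIso _ _ _ _ ((toStable k).map (suspComparison hG M))
      (isIso_suspComparison hG hP M))
    (fun {M N} f => by
      refine Eq.trans ((toStable k).map_comp (G.map ((susp k).map f)) _).symm (Eq.trans ?_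
        ((toStable k).map_comp _ ((susp k).map (G.map f))))
      exact suspComparison_naturality hG f))

/-- An exact functor on `ℳ₃` that preserves projective objects induces an exact functor on the
stable category. -/
theorem isExact_descend (hG : PreservesExact G) (hP : PreservesProjective G) :
    IsExact (descend G hG hP) := by
  refine ⟨descendSuspIso hG hP, ?_⟩
  rintro X Y Z f g h ⟨M, N, u, a, b, c, h1, h2, h3⟩
  obtain ⟨e, he⟩ := exists_coneComparison hG u
  have hi := isIso_coneComparison hG hP u he
  refine ⟨G.obj M, G.obj N, G.map u, (descend G hG hP).mapIso a, (descend G hG hP).mapIso b,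
    (descend G hG hP).mapIso c ≪≫ @asIso _ _ _ _ ((toStable k).map e) hi, ?_, ?_, ?_⟩
  · have := congrArg (descend G hG hP).map h1
    rwa [Functor.map_comp, Functor.map_comp] at this
  · have := congrArg (descend G hG hP).map h2
    rw [Functor.map_comp, Functor.map_comp] at this
    rw [Iso.trans_hom, Functor.mapIso_hom, ← Category.assoc, this, Category.assoc]
    refine congrArg (fun t => (descend G hG hP).map b.hom ≫ t) ?_
    exact ((toStable k).map_comp (G.map (coneIn u)) e).symm.trans
      (congrArg _ (coneIn_comparison hG u he))
  · have := ((descend G hG hP).map_comp h ((stableSusp k).map a.hom)).symm.trans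
      ((congrArg (descend G hG hP).map h3).trans
        ((descend G hG hP).map_comp c.hom ((toStable k).map (coneOut u))))
    -- Naturality of the suspension isomorphism is what moves it past the identification `a` of the
    -- first vertex.
    have hn := (descendSuspIso hG hP).hom.naturality a.hom
    rw [Functor.mapIso_hom, Category.assoc]
    refine (congrArg (fun t => (descend G hG hP).map h ≫ t) hn.symm).trans ?_
    rw [← Category.assoc]
    refine (congrArg (fun t => t ≫ (descendSuspIso hG hP).hom.app ((toStable k).obj M))
      this).trans ?_
    refine (Category.assoc _ _ _).trans (Eq.trans ?_ (Category.assoc _ _ _).symm)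
    refine congrArg (fun t => (descend G hG hP).map c.hom ≫ t) ?_
    refine ((toStable k).map_comp (G.map (coneOut u)) (suspComparison hG M)).symm.trans
      (Eq.trans ?_ ((toStable k).map_comp e (coneOut (G.map u))))
    exact congrArg _ (coneOut_comparison hG u he)

end Exactness

end TriMod

namespace TriMod

variable {k : Type u} [Field k]

/-! ### Exactness of the functors `ℛᵣ` and `ℛ'ᵣ` on `ℳ₃` -/

theorem preservesExact_id : PreservesExact (𝟭 (TriMod.{v} k)) where
  add _ _ := rfl
  rightExact _ _ h := h
  inj _ h := h

theorem PreservesExact.comp {F G : TriMod.{v} k ⥤ TriMod.{v} k} (hF : PreservesExact F)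
    (hG : PreservesExact G) : PreservesExact (F ⋙ G) where
  add f g := by rw [Functor.comp_map, hF.add, hG.add]; rfl
  rightExact _ _ h := hG.rightExact _ _ (hF.rightExact _ _ h)
  inj _ h := hG.inj _ (hF.inj _ h)

theorem preservesExact_shift (a : Fin 3 → ℤ) : PreservesExact (shiftFunctor.{v} k a) where
  add _ _ := rfl
  rightExact _ _ h := ⟨h.surj, h.comp, h.exact⟩
  inj _ h := h

theorem preservesExact_adjoin (s : Fin 3) : PreservesExact (adjoinFunctor.{v} k s) where
  add _ _ := rfl
  rightExact i p h := ⟨Function.Surjective.prodMap h.surj h.surj,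
    fun a => Prod.ext (h.comp a.1) (h.comp a.2), fun x hx => by
      obtain ⟨a, ha⟩ := h.exact x.1 (congrArg Prod.fst hx)
      obtain ⟨b, hb⟩ := h.exact x.2 (congrArg Prod.snd hx)
      exact ⟨(a, b), Prod.ext ha hb⟩⟩
  inj _ h := Function.Injective.prodMap h h

theorem planeProj_of_mem {r : ℤ} (M : TriMod.{v} k) {x : M} (hx : x ∈ M.planeSub r) :
    M.planeProj r x = x := by
  suffices M.planeSub r ≤ LinearMap.eqLocus (M.planeProj r) LinearMap.id from this hx
  refine M.planeSub_le fun n hn y hy => ?_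
  rw [LinearMap.mem_eqLocus, planeProj, M.scale_of_mem _ hy, if_pos hn, one_smul]
  rfl

/-- Morphisms commute with the projection onto the plane, so a preimage of an element of the plane
can be replaced by its projection. -/
theorem preservesExact_plane (r : ℤ) : PreservesExact (planeFunctor.{v} k r) where
  add _ _ := rfl
  rightExact {A X C} i p h := ⟨fun (y : C.planeSub r) => by
      obtain ⟨x, hx⟩ := h.surj (y : C)
      refine ⟨⟨X.planeProj r x, X.planeProj_mem r x⟩, Subtype.ext ?_⟩
      change p.lin (X.planeProj r x) = y
      rw [hom_planeProj, hx, planeProj_of_mem _ y.2],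
    fun (a : A.planeSub r) => Subtype.ext (h.comp a), fun (x : X.planeSub r) hx => by
      obtain ⟨a, ha⟩ := h.exact x (congrArg Subtype.val hx)
      refine ⟨⟨A.planeProj r a, A.planeProj_mem r a⟩, Subtype.ext ?_⟩
      change i.lin (A.planeProj r a) = x
      rw [hom_planeProj, ha, planeProj_of_mem _ x.2]⟩
  inj _ h x y e := Subtype.ext (h (congrArg Subtype.val e))

/-- Exactness does not involve the differentials, and on underlying graded spaces the cone is the
direct sum of `F` and `G`. -/
theorem preservesExact_cone3 {F G : TriMod.{v} k ⥤ TriMod.{v} k} (α : F ⟶ G)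
    (hF : PreservesExact F) (hG : PreservesExact G) : PreservesExact (cone3Functor α) where
  add f g := by
    refine TriMod.hom_ext fun x => Prod.ext ?_ ?_
    · exact congrArg (fun l => Hom.lin l x.1) (hF.add f g)
    · exact congrArg (fun l => Hom.lin l x.2) (hG.add f g)
  rightExact i p h := ⟨Function.Surjective.prodMap (hF.rightExact i p h).surj
      (hG.rightExact i p h).surj,
    fun a => Prod.ext ((hF.rightExact i p h).comp a.1) ((hG.rightExact i p h).comp a.2),
    fun x hx => by
      obtain ⟨a, ha⟩ := (hF.rightExact i p h).exact x.1 (congrArg Prod.fst hx)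
      obtain ⟨b, hb⟩ := (hG.rightExact i p h).exact x.2 (congrArg Prod.snd hx)
      exact ⟨(a, b), Prod.ext ha hb⟩⟩
  inj f h := Function.Injective.prodMap (hF.inj f h) (hG.inj f h)

theorem preservesExact_U (r : ℤ) : PreservesExact (U.{v} k r) :=
  (preservesExact_plane r).comp ((preservesExact_adjoin 1).comp (preservesExact_adjoin 0))

theorem preservesExact_R (r : ℤ) : PreservesExact (R.{v} k r) :=
  preservesExact_cone3 _ (preservesExact_U r) preservesExact_id

theorem preservesExact_R' (r : ℤ) : PreservesExact (R'.{v} k r) :=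
  (preservesExact_cone3 _ preservesExact_id
    ((preservesExact_U r).comp (preservesExact_shift _))).comp (preservesExact_shift _)

/-! ### Homotopies -/

/-- A linear map of degree `a`. -/
def HasDeg {M N : TriMod.{v} k} (a : Fin 3 → ℤ) (h : M →ₗ[k] N) : Prop :=
  ∀ n x, x ∈ M.gr n → h x ∈ N.gr (n + a)

theorem mem_gr_congr {M : TriMod.{v} k} {n m : Fin 3 → ℤ} {x : M} (h : x ∈ M.gr n) (e : n = m) :
    x ∈ M.gr m := e ▸ h

/-- The action of `∂₁∂₂` on linear maps of odd degree, by iterated supercommutators. -/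
def trace2 (M N : TriMod.{v} k) (h : M →ₗ[k] N) : M →ₗ[k] N :=
  N.d 0 ∘ₗ (N.d 1 ∘ₗ h + h ∘ₗ M.d 1) - (N.d 1 ∘ₗ h + h ∘ₗ M.d 1) ∘ₗ M.d 0

theorem trace2_apply (M N : TriMod.{v} k) (h : M →ₗ[k] N) (x : M) :
    trace2 M N h x = N.d 0 (N.d 1 (h x) + h (M.d 1 x)) -
      (N.d 1 (h (M.d 0 x)) + h (M.d 1 (M.d 0 x))) := rfl

/-- Since `∂₃` anticommutes with `∂₁` and `∂₂`, its supercommutator can be taken last instead of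
first. A trace is thereby displayed as a `∂₃`-boundary, with `trace2 M N h` as the null-homotopy. -/
theorem trace_eq_trace2 (M N : TriMod.{v} k) (h : M →ₗ[k] N) (x : M) :
    trace M N h x = N.d 2 (trace2 M N h x) + trace2 M N h (M.d 2 x) := by
  have m20 : ∀ y, M.d 2 (M.d 0 y) = -M.d 0 (M.d 2 y) := fun y => M.d_anticomm 2 0 y (by decide)
  have m21 : ∀ y, M.d 2 (M.d 1 y) = -M.d 1 (M.d 2 y) := fun y => M.d_anticomm 2 1 y (by decide)
  have n20 : ∀ y, N.d 2 (N.d 0 y) = -N.d 0 (N.d 2 y) := fun y => N.d_anticomm 2 0 y (by decide)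
  have n21 : ∀ y, N.d 2 (N.d 1 y) = -N.d 1 (N.d 2 y) := fun y => N.d_anticomm 2 1 y (by decide)
  rw [trace_apply, trace2_apply, trace2_apply]
  simp [m20, m21, n20, n21]
  abel

theorem trace2_hasDeg {M N : TriMod.{v} k} {h : M →ₗ[k] N} (hh : IsLowering h) :
    HasDeg (-Pi.single 2 1) (trace2 M N h) := by
  have e1 : (1 : Fin 3 → ℤ) = Pi.single 0 1 + Pi.single 1 1 + Pi.single 2 1 := by
    ext i; fin_cases i <;> simp
  intro n x hx
  rw [trace2_apply, map_add]
  refine Submodule.sub_mem _ (Submodule.add_mem _ ?_ ?_) (Submodule.add_mem _ ?_ ?_)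
  · exact mem_gr_congr (N.d_mem 0 _ _ (N.d_mem 1 _ _ (hh _ _ hx))) (by rw [e1]; abel)
  · exact mem_gr_congr (N.d_mem 0 _ _ (hh _ _ (M.d_mem 1 _ _ hx))) (by rw [e1]; abel)
  · exact mem_gr_congr (N.d_mem 1 _ _ (hh _ _ (M.d_mem 0 _ _ hx))) (by rw [e1]; abel)
  · exact mem_gr_congr (hh _ _ (M.d_mem 1 _ _ (M.d_mem 0 _ _ hx))) (by rw [e1]; abel)

/-- The action of `∂₁∂₂` on linear endomorphisms of even degree, by iterated supercommutators. -/
def adTrace {M : TriMod.{v} k} (G : M →ₗ[k] M) (x : M) : M :=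
  M.d 0 (M.d 1 (G x) - G (M.d 1 x)) + (M.d 1 (G (M.d 0 x)) - G (M.d 1 (M.d 0 x)))

/-- A `∂₃`-homotopy that anticommutes with `∂₁` and `∂₂`. -/
structure IsHomotopy {A B : TriMod.{v} k} (H : A →ₗ[k] B) : Prop where
  deg : HasDeg (-Pi.single 2 1) H
  d_zero : ∀ x, H (A.d 0 x) = -B.d 0 (H x)
  d_one : ∀ x, H (A.d 1 x) = -B.d 1 (H x)

/-- Because `H` anticommutes with `∂₁` and `∂₂`, their supercommutators with `G ∘ H` act on `G`
alone. So `trace2` of `G ∘ H` is `adTrace G` applied after `H`, which is `H`, and the full trace is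
the `∂₃`-boundary of `H`. -/
theorem exists_trace_of_homotopy {A B : TriMod.{v} k} {H : A →ₗ[k] B} (hH : IsHomotopy H)
    (G : B →ₗ[k] B) (hG : HasDeg (-Pi.single 0 1 - Pi.single 1 1) G)
    (hGH : ∀ x, adTrace G (H x) = H x) :
    ∃ h : A →ₗ[k] B, IsLowering h ∧ ∀ x, trace A B h x = B.d 2 (H x) + H (A.d 2 x) := by
  have e1 : (1 : Fin 3 → ℤ) = Pi.single 0 1 + Pi.single 1 1 + Pi.single 2 1 := by
    ext i; fin_cases i <;> simp
  have key : ∀ x, trace2 A B (G ∘ₗ H) x = H x := by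
    intro x
    rw [← hGH x, adTrace, trace2_apply]
    simp only [LinearMap.comp_apply, hH.d_zero, hH.d_one, map_neg, map_add, map_sub]
    abel
  refine ⟨G ∘ₗ H, fun n x hx => mem_gr_congr (hG _ _ (hH.deg n x hx)) (by rw [e1]; abel),
    fun x => ?_⟩
  rw [trace_eq_trace2, key, key]

/-- Morphisms are stably equal if they are related by a `∂₃`-homotopy that anticommutes with `∂₁`
and `∂₂` and whose values lie in a part of the target that is free over `Λ[∂₁, ∂₂]`. -/
theorem toStable_eq_of_homotopy {A B : TriMod.{v} k} {φ ψ : A ⟶ B} {H : A →ₗ[k] B}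
    (hH : IsHomotopy H) (G : B →ₗ[k] B) (hG : HasDeg (-Pi.single 0 1 - Pi.single 1 1) G)
    (hGH : ∀ x, adTrace G (H x) = H x)
    (h : ∀ x, φ.lin x - ψ.lin x = B.d 2 (H x) + H (A.d 2 x)) :
    (toStable k).map φ = (toStable k).map ψ := by
  obtain ⟨t, ht, e⟩ := exists_trace_of_homotopy hH G hG hGH
  refine (toStable_map_eq_iff φ ψ).2 ⟨t, ht, LinearMap.ext fun x => ?_⟩
  rw [e, ← h]
  rfl

/-- A deformation retraction for the `∂₃`-differential, compatible with `∂₁` and `∂₂` and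
concentrated in a part of the source that is free over `Λ[∂₁, ∂₂]`, is a stable isomorphism. -/
theorem isIso_of_retraction {A B : TriMod.{v} k} {p : A ⟶ B} {s : B ⟶ A} (hsp : s ≫ p = 𝟙 B)
    {H : A →ₗ[k] A} (hH : IsHomotopy H) (G : A →ₗ[k] A)
    (hG : HasDeg (-Pi.single 0 1 - Pi.single 1 1) G) (hGH : ∀ x, adTrace G (H x) = H x)
    (h : ∀ x, x - s.lin (p.lin x) = A.d 2 (H x) + H (A.d 2 x)) :
    IsIso ((toStable k).map p) :=
  isIso_toStable_map p s
    (toStable_eq_of_homotopy (φ := 𝟙 A) (ψ := p ≫ s) hH G hG hGH h).symm (by rw [hsp])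

/-! ### The modules `Q ⊗ V` -/

/-- The differentials `∂₁` and `∂₂` vanish on `V`. -/
structure Flat (V : TriMod.{v} k) : Prop where
  d_zero : ∀ x : V, V.d 0 x = 0
  d_one : ∀ x : V, V.d 1 x = 0

theorem flat_plane (r : ℤ) (M : TriMod.{v} k) : Flat (M.plane r) :=
  ⟨plane_d_of_ne (by decide) r M, plane_d_of_ne (by decide) r M⟩

/-- The module `Q ⊗ V = Λ[∂₁] ⊗ Λ[∂₂] ⊗ V`. The element `((x, y), (z, w))` stands for
`ω ⊗ x + ∂₂ω ⊗ y + ∂₁ω ⊗ z + ∂₁∂₂ω ⊗ w`. -/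
@[reducible] def ext2 (V : TriMod.{v} k) : TriMod.{v} k := (V.adjoin 1).adjoin 0

theorem ext2_d_zero {V : TriMod.{v} k} (hV : Flat V) (x : ext2 V) :
    (ext2 V).d 0 x = (0, x.1) := by
  have h : ∀ y : V.adjoin 1, (V.adjoin 1).d 0 y = 0 := fun y => by
    rw [adjoin_d_of_ne (by decide), hV.d_zero, hV.d_zero, neg_zero]
    rfl
  rw [adjoin_d_self, h, h, sub_zero]

theorem ext2_d_one {V : TriMod.{v} k} (hV : Flat V) (x : ext2 V) :
    (ext2 V).d 1 x = ((0, x.1.1), (0, -x.2.1)) := by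
  have h : ∀ y : V.adjoin 1, (V.adjoin 1).d 1 y = (0, y.1) := fun y => by
    rw [adjoin_d_self, hV.d_one, hV.d_one, sub_zero]
  rw [adjoin_d_of_ne (by decide), h, h, Prod.neg_mk, neg_zero]

theorem ext2_d_two {V : TriMod.{v} k} (x : ext2 V) :
    (ext2 V).d 2 x = ((V.d 2 x.1.1, -V.d 2 x.1.2), (-V.d 2 x.2.1, V.d 2 x.2.2)) := by
  rw [adjoin_d_of_ne (by decide), adjoin_d_of_ne (by decide), adjoin_d_of_ne (by decide),
    Prod.neg_mk, neg_neg]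

/-- The operator `∂₁∂₂ω ⊗ v ↦ ω ⊗ v` on `Q ⊗ V`. -/
def contr2 (V : TriMod.{v} k) : ext2 V →ₗ[k] ext2 V :=
  LinearMap.inl k (V × V) (V × V) ∘ₗ LinearMap.inl k V V ∘ₗ LinearMap.snd k V V ∘ₗ
    LinearMap.snd k (V × V) (V × V)

theorem contr2_apply {V : TriMod.{v} k} (x : ext2 V) : contr2 V x = ((x.2.2, 0), (0, 0)) := rfl

theorem contr2_hasDeg (V : TriMod.{v} k) : HasDeg (-Pi.single 0 1 - Pi.single 1 1) (contr2 V) :=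
  fun n x hx => ⟨⟨mem_gr_congr hx.2.2 (by abel), Submodule.zero_mem _⟩,
    ⟨Submodule.zero_mem _, Submodule.zero_mem _⟩⟩

/-- Each of the four terms of `adTrace` recovers exactly one of the four coefficients. This is the
form in which freeness of `Q ⊗ V` over `Λ[∂₁, ∂₂]` is used in all later contractions. -/
theorem adTrace_contr2 {V : TriMod.{v} k} (hV : Flat V) (x : ext2 V) :
    adTrace (contr2 V) x = x := by
  obtain ⟨⟨a, b⟩, ⟨c, d⟩⟩ := x
  rw [adTrace]
  simp -proj only [ext2_d_zero hV, ext2_d_one hV, contr2_apply]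
  simp

/-- The operator `q ⊗ v ↦ (-1)^|q| q ⊗ h(v)` from `Q ⊗ V` to `Q ⊗ W`. -/
def oddMap {V W : TriMod.{v} k} (h : V →ₗ[k] W) : ext2 V →ₗ[k] ext2 W :=
  (h.prodMap (-h)).prodMap (-(h.prodMap (-h)))

theorem oddMap_apply {V W : TriMod.{v} k} (h : V →ₗ[k] W) (x : ext2 V) :
    oddMap h x = ((h x.1.1, -h x.1.2), (-h x.2.1, h x.2.2)) :=
  Prod.ext rfl (Prod.ext rfl (neg_neg _))

theorem oddMap_hasDeg {V W : TriMod.{v} k} {h : V →ₗ[k] W} {a : Fin 3 → ℤ} (hh : HasDeg a h) :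
    HasDeg (M := ext2 V) (N := ext2 W) a (oddMap h) := fun n x hx => by
  rw [oddMap_apply]
  exact ⟨⟨hh _ _ hx.1.1, Submodule.neg_mem _ (mem_gr_congr (hh _ _ hx.1.2) (by abel))⟩,
    ⟨Submodule.neg_mem _ (mem_gr_congr (hh _ _ hx.2.1) (by abel)),
      mem_gr_congr (hh _ _ hx.2.2) (by abel)⟩⟩

theorem oddMap_d_zero {V W : TriMod.{v} k} (hV : Flat V) (hW : Flat W) (h : V →ₗ[k] W)
    (x : ext2 V) : oddMap h ((ext2 V).d 0 x) = -(ext2 W).d 0 (oddMap h x) := by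
  rw [ext2_d_zero hV, ext2_d_zero hW, oddMap_apply, oddMap_apply]
  simp

theorem oddMap_d_one {V W : TriMod.{v} k} (hV : Flat V) (hW : Flat W) (h : V →ₗ[k] W)
    (x : ext2 V) : oddMap h ((ext2 V).d 1 x) = -(ext2 W).d 1 (oddMap h x) := by
  rw [ext2_d_one hV, ext2_d_one hW, oddMap_apply, oddMap_apply]
  simp

/-- On flat modules `∂₁` and `∂₂` act on the factor `Q` only, and the sign `(-1)^|q|` turns
commutation into anticommutation. -/
theorem isHomotopy_oddMap {V W : TriMod.{v} k} (hV : Flat V) (hW : Flat W) {h : V →ₗ[k] W}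
    (hh : HasDeg (-Pi.single 2 1) h) : IsHomotopy (A := ext2 V) (B := ext2 W) (oddMap h) where
  deg := oddMap_hasDeg hh
  d_zero := oddMap_d_zero hV hW h
  d_one := oddMap_d_one hV hW h

/-- The sign `(-1)^|q|` of `oddMap` cancels the Koszul sign of `∂₃` on `Q ⊗ V`, so a null-homotopy
on `V` yields one on `Q ⊗ V` coefficient by coefficient. -/
theorem oddMap_d_two {V W : TriMod.{v} k} (h : V →ₗ[k] W) (x : ext2 V) :
    (ext2 W).d 2 (oddMap h x) + oddMap h ((ext2 V).d 2 x) =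
      ((W.d 2 (h x.1.1) + h (V.d 2 x.1.1), W.d 2 (h x.1.2) + h (V.d 2 x.1.2)),
        (W.d 2 (h x.2.1) + h (V.d 2 x.2.1), W.d 2 (h x.2.2) + h (V.d 2 x.2.2))) := by
  rw [ext2_d_two, ext2_d_two, oddMap_apply, oddMap_apply]
  simp

/-! ### Preservation of projective objects -/

theorem HasDeg.mem_planeSub {M N : TriMod.{v} k} {h : M →ₗ[k] N} {a : Fin 3 → ℤ}
    (hh : HasDeg a h) {r s : ℤ} (e : r + (a 0 - a 1) = s) (x : M) (hx : x ∈ M.planeSub r) :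
    h x ∈ N.planeSub s := by
  suffices M.planeSub r ≤ (N.planeSub s).comap h from this hx
  refine M.planeSub_le fun m hm y hy => N.gr_le_planeSub ?_ (hh m y hy)
  rw [Pi.add_apply, Pi.add_apply, ← e, ← hm]
  ring

/-- The functor `𝒰ᵣ` forgets `∂₁` and `∂₂` of `P`, but a trace expressing the identity leaves behind
a `∂₃`-contraction `trace2 P P h`. It has degree `(0,0,-1)` and so preserves the plane; tensored
with `Q` it exhibits the identity of `𝒰ᵣ(P)` as a trace. -/
theorem preservesProjective_U (r : ℤ) : PreservesProjective (U.{v} k r) := by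
  intro P hP
  obtain ⟨h, hh, ht⟩ := exists_trace_of_projective P
  let K : P.plane r →ₗ[k] P.plane r :=
    (trace2 P P h).restrict ((trace2_hasDeg hh).mem_planeSub (by simp))
  have hK : HasDeg (-Pi.single 2 1) K := fun n x hx => trace2_hasDeg hh n _ hx
  obtain ⟨t, ht', e⟩ := exists_trace_of_homotopy
    (isHomotopy_oddMap (flat_plane r P) (flat_plane r P) hK) (contr2 _) (contr2_hasDeg _)
    (fun x => adTrace_contr2 (flat_plane r P) _)
  have e' : ∀ x : P.plane r, (P.plane r).d 2 (K x) + K ((P.plane r).d 2 x) = x := fun x =>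
    Subtype.ext ((trace_eq_trace2 P P h x).symm.trans (by rw [ht]; rfl))
  refine projective_of_trace (P := ext2 (P.plane r)) t ht' (LinearMap.ext fun x => ?_)
  rw [e, oddMap_d_two, e', e', e', e']
  rfl

/-- An even shift leaves the trace unchanged. An odd one negates it, since the trace is a threefold
supercommutator, and then `-h` is the witness. -/
theorem preservesProjective_shift (a : Fin 3 → ℤ) :
    PreservesProjective (shiftFunctor.{v} k a) := by
  intro P hP
  obtain ⟨h, hh, ht⟩ := exists_trace_of_projective P
  rcases Int.units_eq_one_or (∑ i, a i).negOnePow with hs | hs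
  · refine projective_of_trace (P := P.shift a) h
      (fun n x hx => mem_gr_congr (M := P) (hh _ _ hx) (sub_right_comm _ _ _)) ?_
    refine Eq.trans (LinearMap.ext fun x => ?_) ht
    have hd : ∀ (s : Fin 3) (x : P), (P.shift a).d s x = P.d s x := by
      intro s x
      change ((∑ i, a i).negOnePow • P.d s) x = _
      rw [hs, one_smul]
    rw [trace_apply, trace_apply]
    simp only [hd]
  · refine projective_of_trace (P := P.shift a) (-h)
      (fun n x hx => Submodule.neg_mem _
        (mem_gr_congr (M := P) (hh _ _ hx) (sub_right_comm _ _ _))) ?_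
    refine (trace_shift_of_odd _ hs (M := P) (N := P) (-h)).trans ?_
    rw [map_neg, neg_neg, ht]

/-- An extension of projective objects is projective. -/
theorem RightExact.projective {A X C : TriMod.{v} k} {i : A ⟶ X} {p : X ⟶ C}
    (h : RightExact i p) (hi : Function.Injective i.lin) (hA : Projective A)
    (hC : Projective C) : Projective X := by
  -- As `A` is also injective, the inclusion splits. The identity of `X` is then the sum of a
  -- morphism through `A` and one through `C`, both of which are traces.
  obtain ⟨ρ, hρ⟩ := exists_extension hA i hi (𝟙 A)
  obtain ⟨g, hg⟩ := h.exists_desc (𝟙 X - ρ ≫ i) (by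
    rw [Preadditive.comp_sub, ← Category.assoc, hρ, Category.id_comp, Category.comp_id, sub_self])
  obtain ⟨t, ht, e⟩ := (factors_iff (ρ ≫ i)).1 ⟨A, ρ, i, hA, rfl⟩
  obtain ⟨t', ht', e'⟩ := (factors_iff (p ≫ g)).1 ⟨C, p, g, hC, rfl⟩
  refine projective_of_trace (t + t') (fun n x hx => Submodule.add_mem _ (ht n x hx)
    (ht' n x hx)) ?_
  rw [map_add, e, e', hg]
  exact LinearMap.ext fun x => add_sub_cancel (i.lin (ρ.lin x)) x

theorem shift_neg_e3_d (M : TriMod.{v} k) (s : Fin 3) (x : M) :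
    (M.shift ![0, 0, -1]).d s x = -M.d s x := by
  have hs : (∑ i, (![0, 0, -1] : Fin 3 → ℤ) i).negOnePow = -1 := by
    simp [Fin.sum_univ_three]
  change ((∑ i, (![0, 0, -1] : Fin 3 → ℤ) i).negOnePow • M.d s) x = _
  rw [hs, Units.neg_smul, one_smul, LinearMap.neg_apply]

theorem shift_e3_d (M : TriMod.{v} k) (s : Fin 3) (x : M) :
    (M.shift ![0, 0, 1]).d s x = -M.d s x := by
  have hs : (∑ i, (![0, 0, 1] : Fin 3 → ℤ) i).negOnePow = -1 := by
    simp [Fin.sum_univ_three]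
  change ((∑ i, (![0, 0, 1] : Fin 3 → ℤ) i).negOnePow • M.d s) x = _
  rw [hs, Units.neg_smul, one_smul, LinearMap.neg_apply]

theorem shift_U_d (M : TriMod.{v} k) (s : Fin 3) (x : M) :
    (M.shift ![-1, -1, 0]).d s x = M.d s x := by
  have hs : (∑ i, (![-1, -1, 0] : Fin 3 → ℤ) i).negOnePow = 1 := by
    simp [Fin.sum_univ_three]; rfl
  change ((∑ i, (![-1, -1, 0] : Fin 3 → ℤ) i).negOnePow • M.d s) x = _
  rw [hs, one_smul]

theorem neg_e3_eq : (![0, 0, -1] : Fin 3 → ℤ) = -Pi.single 2 1 := by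
  ext i; fin_cases i <;> simp

theorem e3_eq : (![0, 0, 1] : Fin 3 → ℤ) = Pi.single 2 1 := by
  ext i; fin_cases i <;> simp

theorem U_shift_eq : (![-1, -1, 0] : Fin 3 → ℤ) = -Pi.single 0 1 - Pi.single 1 1 := by
  ext i; fin_cases i <;> simp

theorem cone3_d_two {M N : TriMod.{v} k} (f : M ⟶ N) (x : M × N) :
    (cone3 f).d 2 x = (-M.d 2 x.1, f.lin x.1 + N.d 2 x.2) := rfl

theorem cone3_d_zero {M N : TriMod.{v} k} (f : M ⟶ N) (x : M × N) :
    (cone3 f).d 0 x = (-M.d 0 x.1, N.d 0 x.2) := Prod.ext rfl (zero_add _)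

theorem cone3_d_one {M N : TriMod.{v} k} (f : M ⟶ N) (x : M × N) :
    (cone3 f).d 1 x = (-M.d 1 x.1, N.d 1 x.2) := Prod.ext rfl (zero_add _)

theorem cone3_d_of_ne {M N : TriMod.{v} k} (f : M ⟶ N) {s : Fin 3} (hs : s ≠ 2) (x : M × N) :
    (cone3 f).d s x = (-M.d s x.1, N.d s x.2) := by
  fin_cases s
  · exact cone3_d_zero f x
  · exact cone3_d_one f x
  · exact absurd rfl hs

/-- The inclusion of `N` into the `∂₃`-cone of `f : M ⟶ N`. -/
def cone3Inr {M N : TriMod.{v} k} (f : M ⟶ N) : N ⟶ cone3 f where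
  lin := LinearMap.inr k M N
  map_gr _ _ hx := ⟨Submodule.zero_mem _, hx⟩
  map_d s x := by
    by_cases hs : s = 2
    · subst hs
      rw [cone3_d_two]
      exact Prod.ext (by simp) (by simp)
    · rw [cone3_d_of_ne f hs]
      exact Prod.ext (by simp) (by simp)

/-- The projection of the `∂₃`-cone of `f : M ⟶ N` onto `M{0,0,-1}`. -/
def cone3Fst {M N : TriMod.{v} k} (f : M ⟶ N) : cone3 f ⟶ M.shift ![0, 0, -1] where
  lin := LinearMap.fst k M N
  map_gr n x hx := mem_gr_congr (M := M) (m := n - ![0, 0, -1]) hx.1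
    (by rw [neg_e3_eq, sub_neg_eq_add])
  map_d s x := (shift_neg_e3_d M s x.1).symm

theorem rightExact_cone3 {M N : TriMod.{v} k} (f : M ⟶ N) :
    RightExact (cone3Inr f) (cone3Fst f) where
  surj x := ⟨((x, 0) : M × N), rfl⟩
  comp (_ : N) := show (0 : M) = 0 from rfl
  exact (x : M × N) (hx : x.1 = 0) := ⟨x.2, Prod.ext hx.symm rfl⟩

/-- The cone is an extension of the shifted `F P` by `G P`. -/
theorem preservesProjective_cone3 {F G : TriMod.{v} k ⥤ TriMod.{v} k} (α : F ⟶ G)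
    (hF : PreservesProjective F) (hG : PreservesProjective G) :
    PreservesProjective (cone3Functor α) := fun P hP =>
  (rightExact_cone3 (α.app P)).projective (fun _ _ h => congrArg Prod.snd h) (hG P hP)
    (preservesProjective_shift _ _ (hF P hP))

theorem preservesProjective_R (r : ℤ) : PreservesProjective (R.{v} k r) :=
  preservesProjective_cone3 _ (preservesProjective_U r) fun _ h => h

theorem preservesProjective_R' (r : ℤ) : PreservesProjective (R'.{v} k r) := fun P hP =>
  preservesProjective_shift _ _ (preservesProjective_cone3 _ (fun _ h => h)
    (fun N h => preservesProjective_shift _ ((U k r).obj N) (preservesProjective_U r N h)) P hP)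

end TriMod

namespace TriMod

variable {k : Type u} [Field k]

/-! ### Degrees, signs and projections -/

theorem HasDeg.scale {M N : TriMod.{v} k} {h : M →ₗ[k] N} {a : Fin 3 → ℤ} (hh : HasDeg a h)
    {c c' : (Fin 3 → ℤ) → k} (e : ∀ n, c n = c' (n + a)) (x : M) :
    h (M.scale c x) = N.scale c' (h x) := by
  induction x using M.homogeneous_induction with
  | hom n x hx => rw [M.scale_of_mem c hx, N.scale_of_mem c' (hh n x hx), map_smul, e]
  | add x y hx hy => simp only [map_add, hx, hy]

theorem HasDeg.planeProj {M N : TriMod.{v} k} {h : M →ₗ[k] N} {a : Fin 3 → ℤ} (hh : HasDeg a h)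
    {r s : ℤ} (e : r + (a 0 - a 1) = s) (x : M) :
    h (M.planeProj r x) = N.planeProj s (h x) := by
  refine hh.scale (fun n => ?_) x
  have : (n 0 - n 1 = r) ↔ ((n + a) 0 - (n + a) 1 = s) := by
    rw [Pi.add_apply, Pi.add_apply]; omega
  simp only [this]

theorem HasDeg.sign_even {M N : TriMod.{v} k} {h : M →ₗ[k] N} {a : Fin 3 → ℤ} (hh : HasDeg a h)
    (e : Even (a 0 + a 1)) (x : M) : h (M.sign x) = N.sign (h x) := by
  refine hh.scale (fun n => ?_) x
  rw [Pi.add_apply, Pi.add_apply, show n 0 + a 0 + (n 1 + a 1) = n 0 + n 1 + (a 0 + a 1) by ring,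
    zpow_add₀ (neg_ne_zero.2 one_ne_zero) (n 0 + n 1), e.neg_one_zpow, mul_one]

theorem HasDeg.sign_odd {M N : TriMod.{v} k} {h : M →ₗ[k] N} {a : Fin 3 → ℤ} (hh : HasDeg a h)
    (e : Odd (a 0 + a 1)) (x : M) : h (M.sign x) = -N.sign (h x) := by
  have h1 : HasDeg a (N := N) (-h) := fun n x hx => Submodule.neg_mem _ (hh n x hx)
  rw [← map_neg]
  refine hh.scale (c' := fun n => -(-1) ^ (n 0 + n 1)) (fun n => ?_) x |>.trans ?_
  · rw [Pi.add_apply, Pi.add_apply,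
      show n 0 + a 0 + (n 1 + a 1) = n 0 + n 1 + (a 0 + a 1) by ring,
      zpow_add₀ (neg_ne_zero.2 one_ne_zero) (n 0 + n 1), e.neg_one_zpow, mul_neg_one, neg_neg]
  · clear h1
    generalize h x = y
    induction y using N.homogeneous_induction with
    | hom n y hy =>
      rw [N.scale_of_mem _ hy, sign, N.scale_of_mem _ (Submodule.neg_mem _ hy), neg_smul, smul_neg]
    | add x y hx hy => rw [map_add, hx, hy, neg_add, map_add]

theorem sign_sign (M : TriMod.{v} k) (x : M) : M.sign (M.sign x) = x := by
  induction x using M.homogeneous_induction with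
  | hom n x hx =>
    rw [sign, M.scale_of_mem _ hx, map_smul, M.scale_of_mem _ hx, smul_smul, ← mul_zpow]
    simp
  | add x y hx hy => rw [map_add, map_add, hx, hy]

theorem sign_mem_planeSub {r : ℤ} (M : TriMod.{v} k) (x : M) (hx : x ∈ M.planeSub r) :
    M.sign x ∈ M.planeSub r :=
  HasDeg.mem_planeSub (a := 0) (fun n x hx => mem_gr_congr (M.scale_mem _ hx) (add_zero n).symm)
    (by simp) x hx

theorem planeProj_of_mem_ne {r s : ℤ} (hrs : r ≠ s) (M : TriMod.{v} k) {x : M}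
    (hx : x ∈ M.planeSub r) : M.planeProj s x = 0 := by
  suffices M.planeSub r ≤ LinearMap.ker (M.planeProj s) from this hx
  refine M.planeSub_le fun n hn y hy => ?_
  rw [LinearMap.mem_ker, planeProj, M.scale_of_mem _ hy, if_neg (by rw [hn]; exact hrs), zero_smul]

theorem plane_subtype_hasDeg (r : ℤ) (M : TriMod.{v} k) :
    HasDeg (M := M.plane r) (N := M) 0 (M.planeSub r).subtype := fun n _ hx =>
  mem_gr_congr hx (add_zero n).symm

theorem coe_plane_sign {r : ℤ} {M : TriMod.{v} k} (x : M.planeSub r) :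
    (((M.plane r).sign x : M.planeSub r) : M) = M.sign x :=
  (plane_subtype_hasDeg r M).sign_even (by simp) x

theorem plane_planeProj_self {r : ℤ} {M : TriMod.{v} k} (x : M.planeSub r) :
    (M.plane r).planeProj r x = x :=
  Subtype.ext (((plane_subtype_hasDeg r M).planeProj (by simp) x).trans (planeProj_of_mem _ x.2))

theorem plane_planeProj_ne {r s : ℤ} (hrs : r ≠ s) {M : TriMod.{v} k} (x : M.planeSub r) :
    (M.plane r).planeProj s x = 0 :=
  Subtype.ext (((plane_subtype_hasDeg r M).planeProj (by simp) x).trans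
    (planeProj_of_mem_ne hrs _ x.2))

theorem mem_planeSub_plane {r : ℤ} {M : TriMod.{v} k} (x : M.planeSub r) :
    x ∈ (M.plane r).planeSub r := by
  rw [← plane_planeProj_self x]
  exact planeProj_mem _ _ _

theorem ext2_sign {V : TriMod.{v} k} (x : ext2 V) :
    (ext2 V).sign x = ((V.sign x.1.1, -V.sign x.1.2), (-V.sign x.2.1, V.sign x.2.2)) := by
  have h0 : HasDeg (M := ext2 V) (N := V) 0
      (LinearMap.fst k V V ∘ₗ LinearMap.fst k (V × V) (V × V)) :=
    fun n x hx => mem_gr_congr hx.1.1 (by abel)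
  have h1 : HasDeg (M := ext2 V) (N := V) (-Pi.single 1 1)
      (LinearMap.snd k V V ∘ₗ LinearMap.fst k (V × V) (V × V)) :=
    fun n x hx => mem_gr_congr hx.1.2 (by abel)
  have h2 : HasDeg (M := ext2 V) (N := V) (-Pi.single 0 1)
      (LinearMap.fst k V V ∘ₗ LinearMap.snd k (V × V) (V × V)) :=
    fun n x hx => mem_gr_congr hx.2.1 (by abel)
  have h3 : HasDeg (M := ext2 V) (N := V) (-Pi.single 0 1 - Pi.single 1 1)
      (LinearMap.snd k V V ∘ₗ LinearMap.snd k (V × V) (V × V)) :=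
    fun n x hx => mem_gr_congr hx.2.2 (by abel)
  exact Prod.ext (Prod.ext (h0.sign_even (by simp) x) (h1.sign_odd (by simp) x))
    (Prod.ext (h2.sign_odd (by simp) x) (h3.sign_even (by simp) x))

theorem ext2_planeProj (r : ℤ) {V : TriMod.{v} k} (x : ext2 V) :
    (ext2 V).planeProj r x = ((V.planeProj r x.1.1, V.planeProj (r + 1) x.1.2),
      (V.planeProj (r - 1) x.2.1, V.planeProj r x.2.2)) := by
  have h0 : HasDeg (M := ext2 V) (N := V) 0
      (LinearMap.fst k V V ∘ₗ LinearMap.fst k (V × V) (V × V)) :=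
    fun n x hx => mem_gr_congr hx.1.1 (by abel)
  have h1 : HasDeg (M := ext2 V) (N := V) (-Pi.single 1 1)
      (LinearMap.snd k V V ∘ₗ LinearMap.fst k (V × V) (V × V)) :=
    fun n x hx => mem_gr_congr hx.1.2 (by abel)
  have h2 : HasDeg (M := ext2 V) (N := V) (-Pi.single 0 1)
      (LinearMap.fst k V V ∘ₗ LinearMap.snd k (V × V) (V × V)) :=
    fun n x hx => mem_gr_congr hx.2.1 (by abel)
  have h3 : HasDeg (M := ext2 V) (N := V) (-Pi.single 0 1 - Pi.single 1 1)
      (LinearMap.snd k V V ∘ₗ LinearMap.snd k (V × V) (V × V)) :=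
    fun n x hx => mem_gr_congr hx.2.2 (by abel)
  exact Prod.ext (Prod.ext (h0.planeProj (by simp) x) (h1.planeProj (by simp) x))
    (Prod.ext (h2.planeProj (by simp; ring) x) (h3.planeProj (by simp) x))

theorem cone3_fst_hasDeg {M N : TriMod.{v} k} (f : M ⟶ N) :
    HasDeg (M := cone3 f) (N := M) (Pi.single 2 1) (LinearMap.fst k M N) := fun _ _ hx => hx.1

theorem cone3_snd_hasDeg {M N : TriMod.{v} k} (f : M ⟶ N) :
    HasDeg (M := cone3 f) (N := N) 0 (LinearMap.snd k M N) := fun n _ hx =>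
  mem_gr_congr hx.2 (add_zero n).symm

theorem cone3_sign {M N : TriMod.{v} k} (f : M ⟶ N) (x : M × N) :
    (cone3 f).sign x = (M.sign x.1, N.sign x.2) :=
  Prod.ext ((cone3_fst_hasDeg f).sign_even (by simp) x)
    ((cone3_snd_hasDeg f).sign_even (by simp) x)

theorem cone3_planeProj (r : ℤ) {M N : TriMod.{v} k} (f : M ⟶ N) (x : M × N) :
    (cone3 f).planeProj r x = (M.planeProj r x.1, N.planeProj r x.2) :=
  Prod.ext ((cone3_fst_hasDeg f).planeProj (by simp) x)
    ((cone3_snd_hasDeg f).planeProj (by simp) x)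

theorem mem_planeSub_cone3 {r : ℤ} {M N : TriMod.{v} k} {f : M ⟶ N} {x : M × N} :
    x ∈ (cone3 f).planeSub r ↔ x.1 ∈ M.planeSub r ∧ x.2 ∈ N.planeSub r := by
  constructor
  · intro h
    exact ⟨(cone3_fst_hasDeg f).mem_planeSub (by simp) x h,
      (cone3_snd_hasDeg f).mem_planeSub (by simp) x h⟩
  · rintro ⟨h1, h2⟩
    have e : x = (cone3 f).planeProj r x := by
      rw [cone3_planeProj, planeProj_of_mem _ h1, planeProj_of_mem _ h2]
    rw [e]
    exact planeProj_mem _ _ _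

theorem mem_planeSub_ext2 {r : ℤ} {V : TriMod.{v} k} {x : ext2 V} :
    x ∈ (ext2 V).planeSub r ↔ (x.1.1 ∈ V.planeSub r ∧ x.1.2 ∈ V.planeSub (r + 1)) ∧
      (x.2.1 ∈ V.planeSub (r - 1) ∧ x.2.2 ∈ V.planeSub r) := by
  constructor
  · intro h
    have e := ext2_planeProj r x
    rw [planeProj_of_mem _ h] at e
    rw [e]
    exact ⟨⟨planeProj_mem _ _ _, planeProj_mem _ _ _⟩, ⟨planeProj_mem _ _ _, planeProj_mem _ _ _⟩⟩
  · rintro ⟨⟨h1, h2⟩, ⟨h3, h4⟩⟩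
    have e : x = (ext2 V).planeProj r x := by
      rw [ext2_planeProj, planeProj_of_mem _ h1, planeProj_of_mem _ h2, planeProj_of_mem _ h3,
        planeProj_of_mem _ h4]
    rw [e]
    exact planeProj_mem _ _ _

theorem planeSub_shift (r : ℤ) (M : TriMod.{v} k) (a : Fin 3 → ℤ) (ha : a 0 = a 1) :
    (M.shift a).planeSub r = M.planeSub r := by
  refine le_antisymm ?_ ?_
  · refine planeSub_le (M.shift a) fun n hn => M.gr_le_planeSub ?_
    rw [Pi.sub_apply, Pi.sub_apply, ha]
    omega
  · refine planeSub_le M fun n hn x hx => (M.shift a).gr_le_planeSub (n := n + a) ?_ ?_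
    · rw [Pi.add_apply, Pi.add_apply, ha]
      omega
    · exact mem_gr_congr (M := M) hx (add_sub_cancel_right n a).symm

/-! ### The morphisms `inᵣ` and `outᵣ` -/

/-- The morphism `inᵣ : 𝒰ᵣ(M) ⟶ M`. -/
def inHom (r : ℤ) (M : TriMod.{v} k) : ext2 (M.plane r) ⟶ M := (inTrans k r).app M

/-- The morphism `outᵣ : M ⟶ 𝒰ᵣ(M){-1,-1,0}`. -/
noncomputable def outHom (r : ℤ) (M : TriMod.{v} k) :
    M ⟶ (ext2 (M.plane r)).shift ![-1, -1, 0] := (outTrans k r).app M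

theorem inHom_apply {r : ℤ} {M : TriMod.{v} k} (x : ext2 (M.plane r)) :
    (inHom r M).lin x = (x.1.1 : M) + M.d 1 (x.1.2 : M) + M.d 0 (x.2.1 : M) +
      M.d 0 (M.d 1 (x.2.2 : M)) := rfl

theorem outHom_fst_fst {r : ℤ} {M : TriMod.{v} k} (x : M) :
    ((((outHom r M).lin x).1.1 : M.planeSub r) : M) =
      M.planeProj r (M.d 0 (M.d 1 (M.sign x))) := rfl

theorem outHom_fst_snd {r : ℤ} {M : TriMod.{v} k} (x : M) :
    ((((outHom r M).lin x).1.2 : M.planeSub r) : M) = -M.planeProj r (M.d 0 (M.sign x)) := rfl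

theorem outHom_snd_fst {r : ℤ} {M : TriMod.{v} k} (x : M) :
    ((((outHom r M).lin x).2.1 : M.planeSub r) : M) = M.planeProj r (M.d 1 (M.sign x)) := rfl

theorem outHom_snd_snd {r : ℤ} {M : TriMod.{v} k} (x : M) :
    ((((outHom r M).lin x).2.2 : M.planeSub r) : M) = M.planeProj r (M.sign x) := rfl

/-- The morphism `Q ⊗ V ⟶ Q ⊗ W` induced by a morphism `V ⟶ W`. -/
def ext2Map {V W : TriMod.{v} k} (f : V ⟶ W) : ext2 V ⟶ ext2 W :=
  (adjoinFunctor k 0).map ((adjoinFunctor k 1).map f)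

theorem ext2Map_apply {V W : TriMod.{v} k} (f : V ⟶ W) (x : ext2 V) :
    (ext2Map f).lin x = ((f.lin x.1.1, f.lin x.1.2), (f.lin x.2.1, f.lin x.2.2)) := rfl

/-- The morphism `M_{i-j=r} ⟶ N_{i-j=r}` induced by a morphism `M ⟶ N`. -/
def planeHom (r : ℤ) {M N : TriMod.{v} k} (f : M ⟶ N) : M.plane r ⟶ N.plane r :=
  (planeFunctor k r).map f

theorem outHom_naturality {r : ℤ} {M N : TriMod.{v} k} (f : M ⟶ N) (x : M) :
    (outHom r N).lin (f.lin x) = (ext2Map (planeHom r f)).lin ((outHom r M).lin x) :=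
  congrArg (fun g => Hom.lin g x) ((outTrans k r).naturality f)

theorem inHom_naturality {r : ℤ} {M N : TriMod.{v} k} (f : M ⟶ N) (x : ext2 (M.plane r)) :
    (inHom r N).lin ((ext2Map (planeHom r f)).lin x) = f.lin ((inHom r M).lin x) :=
  congrArg (fun g => Hom.lin g x) ((inTrans k r).naturality f)

theorem d_hasDeg (M : TriMod.{v} k) (s : Fin 3) : HasDeg (N := M) (Pi.single s 1) (M.d s) :=
  M.d_mem s

theorem d_zero_mem_planeSub {r : ℤ} {M : TriMod.{v} k} {x : M} (hx : x ∈ M.planeSub r) :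
    M.d 0 x ∈ M.planeSub (r + 1) :=
  (d_hasDeg M 0).mem_planeSub (by simp) x hx

theorem d_one_mem_planeSub {r : ℤ} {M : TriMod.{v} k} {x : M} (hx : x ∈ M.planeSub r) :
    M.d 1 x ∈ M.planeSub (r - 1) :=
  (d_hasDeg M 1).mem_planeSub (by simp; ring) x hx

theorem d_zero_one_mem_planeSub {r : ℤ} {M : TriMod.{v} k} {x : M} (hx : x ∈ M.planeSub r) :
    M.d 0 (M.d 1 x) ∈ M.planeSub r := by
  have := d_zero_mem_planeSub (d_one_mem_planeSub hx)
  rwa [sub_add_cancel] at this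

/-- The operator `∂₁∂₂` on the part of `M` in the plane `i - j = r`. -/
def planeD01 (r : ℤ) (M : TriMod.{v} k) : M.planeSub r →ₗ[k] M.planeSub r :=
  (M.d 0 ∘ₗ M.d 1).restrict fun _ hx => d_zero_one_mem_planeSub hx

theorem coe_planeD01 {r : ℤ} {M : TriMod.{v} k} (x : M.planeSub r) :
    (planeD01 r M x : M) = M.d 0 (M.d 1 x) := rfl

/-- The operator `oddMap` of the sign multiplies `q ⊗ m` by the parity of its full first two
degrees, and `in` preserves degrees; so the two signs cancel. It serves to remove the sign built
into `out`. -/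
theorem sign_inHom {r : ℤ} {M : TriMod.{v} k} (t : ext2 (M.plane r)) :
    M.sign ((inHom r M).lin (oddMap (M.plane r).sign t)) = (inHom r M).lin t := by
  have e : ∀ y : M.plane r, M.sign (((M.plane r).sign y : M.planeSub r) : M) = (y : M.planeSub r) :=
    fun y => by rw [coe_plane_sign, sign_sign]
  rw [inHom_apply, inHom_apply, oddMap_apply]
  simp only [map_add, map_neg, NegMemClass.coe_neg, sign_d_of_ne M (s := 0) (by decide),
    sign_d_of_ne M (s := 1) (by decide), neg_neg]
  rw [e t.1.1, e t.1.2, e t.2.1, e t.2.2]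

/-- This is `out ∘ in` up to sign. Terms in which just one of `∂₁`, `∂₂` acts on an element of the
plane `r` leave that plane and are projected away. What survives is `∂₁∂₂` on the coefficients,
together with the shift of the `ω`-coefficient into the `∂₁∂₂ω`-position. -/
theorem outHom_signed {r : ℤ} {M : TriMod.{v} k} (t : ext2 (M.plane r)) :
    (outHom r M).lin ((inHom r M).lin (oddMap (M.plane r).sign t)) =
      ((planeD01 r M t.1.1, -planeD01 r M t.1.2),
        (-planeD01 r M t.2.1, (t.1.1 + planeD01 r M t.2.2 : M.planeSub r))) := by
  have m10 : ∀ y, M.d 1 (M.d 0 y) = -M.d 0 (M.d 1 y) := fun y => M.d_anticomm 1 0 y (by decide)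
  have p : ∀ x : M.planeSub r, M.planeProj r x = x := fun x => planeProj_of_mem _ x.2
  have p0 : ∀ x : M.planeSub r, M.planeProj r (M.d 0 x) = 0 := fun x =>
    planeProj_of_mem_ne (by omega) _ (d_zero_mem_planeSub x.2)
  have p1 : ∀ x : M.planeSub r, M.planeProj r (M.d 1 x) = 0 := fun x =>
    planeProj_of_mem_ne (by omega) _ (d_one_mem_planeSub x.2)
  have p01 : ∀ x : M.planeSub r, M.planeProj r (M.d 0 (M.d 1 x)) = M.d 0 (M.d 1 x) := fun x =>
    planeProj_of_mem _ (d_zero_one_mem_planeSub x.2)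
  refine Prod.ext (Prod.ext (Subtype.ext ?_) (Subtype.ext ?_))
    (Prod.ext (Subtype.ext ?_) (Subtype.ext ?_))
  · rw [outHom_fst_fst, sign_inHom, inHom_apply]
    simp [m10, M.d_sq, p01, coe_planeD01]
  · rw [outHom_fst_snd, sign_inHom, inHom_apply]
    simp [M.d_sq, p01, p0, coe_planeD01]
  · rw [outHom_snd_fst, sign_inHom, inHom_apply]
    simp [m10, M.d_sq, p01, p1, coe_planeD01]
  · rw [outHom_snd_snd, sign_inHom, inHom_apply]
    simp [p, p0, p1, p01, coe_planeD01]

end TriMod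

namespace TriMod

variable {k : Type u} [Field k]

/-! ### The dual `∂₃`-cone -/

/-- The module `C₃(o){0,0,1}` for a morphism `o : N ⟶ E{-1,-1,0}`. -/
@[reducible] def cocone3 {N E : TriMod.{v} k} (o : N ⟶ E.shift ![-1, -1, 0]) : TriMod.{v} k :=
  (cone3 o).shift ![0, 0, 1]

section Cocone

variable {N E : TriMod.{v} k} (o : N ⟶ E.shift ![-1, -1, 0])

theorem cocone3_d_zero (x : N × E) : (cocone3 o).d 0 x = (N.d 0 x.1, -E.d 0 x.2) := by
  refine (shift_e3_d (cone3 o) 0 x).trans ?_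
  rw [cone3_d_zero, shift_U_d]
  exact Prod.ext (neg_neg _) rfl

theorem cocone3_d_one (x : N × E) : (cocone3 o).d 1 x = (N.d 1 x.1, -E.d 1 x.2) := by
  refine (shift_e3_d (cone3 o) 1 x).trans ?_
  rw [cone3_d_one, shift_U_d]
  exact Prod.ext (neg_neg _) rfl

theorem cocone3_d_two (x : N × E) :
    (cocone3 o).d 2 x = (N.d 2 x.1, -o.lin x.1 - E.d 2 x.2) := by
  refine (shift_e3_d (cone3 o) 2 x).trans ?_
  rw [cone3_d_two, shift_U_d]
  exact Prod.ext (neg_neg _) (neg_add' _ _)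

theorem cocone3_gr (n : Fin 3 → ℤ) (x : N × E) : x ∈ (cocone3 o).gr n ↔
    x.1 ∈ N.gr n ∧ x.2 ∈ E.gr (n - Pi.single 2 1 + Pi.single 0 1 + Pi.single 1 1) := by
  have e1 : n - ![0, 0, 1] + Pi.single 2 1 = n := by rw [e3_eq, sub_add_cancel]
  have e2 : n - ![0, 0, 1] - ![-1, -1, 0] =
      n - Pi.single 2 1 + Pi.single 0 1 + Pi.single 1 1 := by
    rw [e3_eq, U_shift_eq]; abel
  rw [← e2]
  nth_rw 2 [← e1]
  rfl

end Cocone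

/-! ### Criteria for `ℛ'ᵣ ℛᵣ ≅ Id` and `ℛᵣ ℛ'ᵣ ≅ Id` -/

section CoconeCone

variable {E F M : TriMod.{v} k} {i : E ⟶ M} {o : cone3 i ⟶ F.shift ![-1, -1, 0]}
  {f : F →ₗ[k] E}

/-- The morphism `(u, m, w) ↦ m + i (f w)` from the total complex `E ⟶ M ⊕ F ⟶ 0` to `M`. -/
def coconeCounit (hf : HasDeg (Pi.single 2 1 - Pi.single 0 1 - Pi.single 1 1) f)
    (hfd : ∀ s w, f (F.d s w) = -E.d s (f w)) (hfo : ∀ n, f (o.lin n) = n.1) :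
    cocone3 o ⟶ M where
  lin := LinearMap.snd k E M ∘ₗ LinearMap.fst k (E × M) F +
    i.lin ∘ₗ f ∘ₗ LinearMap.snd k (E × M) F
  map_gr n x hx := by
    obtain ⟨h1, h2⟩ := (cocone3_gr o n x).1 hx
    exact Submodule.add_mem _ h1.2 (mem_gr_congr (i.map_gr _ _ (hf _ _ h2)) (by abel))
  map_d s x := by
    obtain ⟨⟨u, m⟩, w⟩ := x
    change _ = M.d s (m + i.lin (f w))
    have e : ∀ y : (E × M) × F, (cocone3 o).d s ((u, m), w) = y →
        y.1.2 + i.lin (f y.2) = M.d s (m + i.lin (f w)) →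
        (LinearMap.snd k E M ∘ₗ LinearMap.fst k (E × M) F +
          i.lin ∘ₗ f ∘ₗ LinearMap.snd k (E × M) F) ((cocone3 o).d s ((u, m), w)) =
          M.d s (m + i.lin (f w)) := by
      rintro y hy h
      rw [hy]
      exact h
    fin_cases s
    · refine e _ (cocone3_d_zero o _) ?_
      rw [cone3_d_zero, map_neg, hfd, neg_neg, i.map_d, map_add]
      rfl
    · refine e _ (cocone3_d_one o _) ?_
      rw [cone3_d_one, map_neg, hfd, neg_neg, i.map_d, map_add]
      rfl
    · refine e _ (cocone3_d_two o _) ?_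
      rw [cone3_d_two, map_sub, map_neg, hfo, hfd, sub_neg_eq_add, map_add, map_neg, i.map_d,
        map_add]
      change i.lin u + M.d 2 m + (-i.lin u + _) = M.d 2 m + _
      abel

theorem coconeCounit_apply (hf : HasDeg (Pi.single 2 1 - Pi.single 0 1 - Pi.single 1 1) f)
    (hfd : ∀ s w, f (F.d s w) = -E.d s (f w)) (hfo : ∀ n, f (o.lin n) = n.1) (x : (E × M) × F) :
    (coconeCounit hf hfd hfo).lin x = x.1.2 + i.lin (f x.2) := rfl

/-- This is an elimination lemma. As `f` is left inverse to `o` on `E`, the summand `E` cancels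
against a part of `F`; `g` contracts the remainder of `F`, and `σ` is a null-homotopy of `o` on `M`.
The section is `m ↦ (0, m, -σ m)`, and the contraction `(u, m, w) ↦ (-f w, 0, -g w)` has values in
`E ⊕ F` only, where `GE` and `GF` provide the freeness needed for a stable isomorphism. -/
theorem isIso_coconeCounit (hf : HasDeg (Pi.single 2 1 - Pi.single 0 1 - Pi.single 1 1) f)
    (hfd : ∀ s w, f (F.d s w) = -E.d s (f w)) (hfo : ∀ n, f (o.lin n) = n.1)
    (σ : M →ₗ[k] F) (hσ : HasDeg (-Pi.single 2 1 + Pi.single 0 1 + Pi.single 1 1) σ)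
    (hσ0 : ∀ m, σ (M.d 0 m) = -F.d 0 (σ m)) (hσ1 : ∀ m, σ (M.d 1 m) = -F.d 1 (σ m))
    (hσ2 : ∀ m, F.d 2 (σ m) + σ (M.d 2 m) = o.lin (((0, m) : E × M))) (hfσ : ∀ m, f (σ m) = 0)
    (g : F →ₗ[k] F) (hg : HasDeg (-Pi.single 2 1) g)
    (hg0 : ∀ w, g (F.d 0 w) = -F.d 0 (g w)) (hg1 : ∀ w, g (F.d 1 w) = -F.d 1 (g w))
    (hgo : ∀ n : E × M, g (o.lin n) = σ n.2)
    (hg2 : ∀ w, F.d 2 (g w) + g (F.d 2 w) + o.lin (((f w, 0) : E × M)) = w + σ (i.lin (f w)))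
    (GE : E →ₗ[k] E) (hGE : HasDeg (-Pi.single 0 1 - Pi.single 1 1) GE)
    (hGE' : ∀ x, adTrace GE x = x)
    (GF : F →ₗ[k] F) (hGF : HasDeg (-Pi.single 0 1 - Pi.single 1 1) GF)
    (hGF' : ∀ x, adTrace GF x = x) :
    IsIso ((toStable k).map (coconeCounit hf hfd hfo)) := by
  let s : M ⟶ cocone3 o :=
    { lin := (LinearMap.inr k E M).prod (-σ)
      map_gr := fun n m hm => (cocone3_gr o n _).2 ⟨⟨Submodule.zero_mem _, hm⟩,
        Submodule.neg_mem _ (mem_gr_congr (hσ _ _ hm) (by abel))⟩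
      map_d := fun s m => by
        change (((0, M.d s m), -σ (M.d s m)) : (E × M) × F) =
          (cocone3 o).d s (((0, m), -σ m) : (E × M) × F)
        fin_cases s
        · refine Eq.trans ?_ (cocone3_d_zero o _).symm
          rw [cone3_d_zero]
          refine Prod.ext (Prod.ext ?_ rfl) ?_
          · simp
          · simp [hσ0]
        · refine Eq.trans ?_ (cocone3_d_one o _).symm
          rw [cone3_d_one]
          refine Prod.ext (Prod.ext ?_ rfl) ?_
          · simp
          · simp [hσ1]
        · refine Eq.trans ?_ (cocone3_d_two o _).symm
          rw [cone3_d_two]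
          refine Prod.ext (Prod.ext ?_ ?_) ?_
          · simp
          · simp
          · simp [← hσ2] }
  let H : cocone3 o →ₗ[k] cocone3 o :=
    (LinearMap.inl k E M ∘ₗ (-f)).prod (-g) ∘ₗ LinearMap.snd k (E × M) F
  let G : cocone3 o →ₗ[k] cocone3 o := (GE.prodMap (0 : M →ₗ[k] M)).prodMap GF
  have hH : ∀ x : (E × M) × F, H x = (((-f x.2, 0), -g x.2) : (E × M) × F) := fun _ => rfl
  have hG : ∀ x : (E × M) × F, G x = (((GE x.1.1, 0), GF x.2) : (E × M) × F) := fun _ => rfl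
  refine isIso_of_retraction (s := s) ?_ (H := H) ⟨?_, ?_, ?_⟩ G ?_ ?_ ?_
  · refine TriMod.hom_ext fun m => ?_
    change m + i.lin (f (-σ m)) = m
    rw [map_neg, hfσ, neg_zero, map_zero, add_zero]
  · intro n x hx
    obtain ⟨h1, h2⟩ := (cocone3_gr o n x).1 hx
    refine (cocone3_gr o _ _).2 ⟨⟨?_, Submodule.zero_mem _⟩, ?_⟩
    · exact Submodule.neg_mem _ (mem_gr_congr (hf _ _ h2) (by abel))
    · exact Submodule.neg_mem _ (mem_gr_congr (hg _ _ h2) (by abel))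
  · intro x
    rw [cocone3_d_zero, hH, hH, cocone3_d_zero, cone3_d_zero]
    simp [hfd, hg0]
  · intro x
    rw [cocone3_d_one, hH, hH, cocone3_d_one, cone3_d_one]
    simp [hfd, hg1]
  · intro n x hx
    obtain ⟨h1, h2⟩ := (cocone3_gr o n x).1 hx
    refine (cocone3_gr o _ _).2 ⟨⟨?_, Submodule.zero_mem _⟩, ?_⟩
    · exact mem_gr_congr (hGE _ _ h1.1) (by abel)
    · exact mem_gr_congr (hGF _ _ h2) (by abel)
  · intro x
    have e1 := hGE' (-f x.2)
    have e2 := hGF' (-g x.2)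
    have h0 : ⇑((cocone3 o).d 0) = fun x : (E × M) × F =>
        (((-E.d 0 x.1.1, M.d 0 x.1.2), -F.d 0 x.2) : (E × M) × F) := funext fun x => by
      rw [cocone3_d_zero, cone3_d_zero]
    have h1 : ⇑((cocone3 o).d 1) = fun x : (E × M) × F =>
        (((-E.d 1 x.1.1, M.d 1 x.1.2), -F.d 1 x.2) : (E × M) × F) := funext fun x => by
      rw [cocone3_d_one, cone3_d_one]
    rw [adTrace] at e1 e2 ⊢
    rw [h0, h1, hH]
    simp only [hG]
    refine Prod.ext (Prod.ext ?_ ?_) ?_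
    · refine Eq.trans ?_ e1
      simp only [Prod.fst_add, Prod.fst_sub, map_neg, map_sub, neg_neg, neg_sub]
      abel
    · simp
    · refine Eq.trans ?_ e2
      simp only [Prod.snd_add, Prod.snd_sub, map_neg, map_sub, neg_neg, neg_sub]
      abel
  · intro x
    obtain ⟨⟨u, m⟩, w⟩ := x
    rw [cocone3_d_two, hH, hH, cocone3_d_two, cone3_d_two]
    change (((u, m), w) : (E × M) × F) - ((0, m + i.lin (f w)), -σ (m + i.lin (f w))) = _
    have e1 := hg2 w
    have e2 : o.lin (((-f w, 0) : E × M)) = -o.lin (((f w, 0) : E × M)) := by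
      have e3 : (((-f w, 0) : E × M)) = -((f w, 0) : E × M) := Prod.ext rfl neg_zero.symm
      exact (congrArg o.lin e3).trans (map_neg o.lin _)
    refine Prod.ext (Prod.ext ?_ ?_) ?_
    · simp [hfd, hfo]
    · simp
    · simp only [Prod.snd_add, Prod.snd_sub, e2, map_neg, map_sub, map_add, hgo]
      have e3 := sub_eq_zero.2 e1
      rw [← sub_eq_zero, ← neg_eq_zero, ← e3]
      abel

end CoconeCone

end TriMod

namespace TriMod

variable {k : Type u} [Field k]

/-! ### The isomorphism `ℛ'ᵣ ℛᵣ ≅ Id` -/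

theorem eq_zero_of_mem_planeSub_plane {r s : ℤ} (hrs : r ≠ s) {M : TriMod.{v} k}
    {x : M.planeSub r} (hx : x ∈ (M.plane r).planeSub s) : x = 0 := by
  rw [← planeProj_of_mem _ hx, plane_planeProj_ne hrs]

theorem oddMap_oddMap {V W X : TriMod.{v} k} (g : W →ₗ[k] X) (h : V →ₗ[k] W) (x : ext2 V) :
    oddMap g (oddMap h x) = ((g (h x.1.1), g (h x.1.2)), (g (h x.2.1), g (h x.2.2))) := by
  rw [oddMap_apply, oddMap_apply]
  simp

theorem oddMap_congr {V W X : TriMod.{v} k} {g : V →ₗ[k] X} {h : W →ₗ[k] X} {x : ext2 V}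
    {y : ext2 W} (e0 : g x.1.1 = h y.1.1) (e1 : g x.1.2 = h y.1.2) (e2 : g x.2.1 = h y.2.1)
    (e3 : g x.2.2 = h y.2.2) : oddMap g x = oddMap h y := by
  rw [oddMap_apply, oddMap_apply, e0, e1, e2, e3]

theorem oddMap_d_two_of_anticomm {V W : TriMod.{v} k} {h : V →ₗ[k] W}
    (hh : ∀ x, W.d 2 (h x) + h (V.d 2 x) = 0) (x : ext2 V) :
    oddMap h ((ext2 V).d 2 x) = -(ext2 W).d 2 (oddMap h x) := by
  rw [eq_neg_iff_add_eq_zero, add_comm, oddMap_d_two, hh, hh, hh, hh]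
  rfl

theorem oddMap_anticomm {V W : TriMod.{v} k} (hV : Flat V) (hW : Flat W) {h : V →ₗ[k] W}
    (hh : ∀ x, W.d 2 (h x) + h (V.d 2 x) = 0) (s : Fin 3) (x : ext2 V) :
    oddMap h ((ext2 V).d s x) = -(ext2 W).d s (oddMap h x) := by
  fin_cases s
  · exact oddMap_d_zero hV hW h x
  · exact oddMap_d_one hV hW h x
  · exact oddMap_d_two_of_anticomm hh x

section Counit

variable {r : ℤ} {M : TriMod.{v} k}

theorem outHom_d (s : Fin 3) (x : M) :
    (outHom r M).lin (M.d s x) = (ext2 (M.plane r)).d s ((outHom r M).lin x) :=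
  ((outHom r M).map_d s x).trans (shift_U_d _ _ _)

theorem outHom_hasDeg :
    HasDeg (N := ext2 (M.plane r)) (Pi.single 0 1 + Pi.single 1 1) (outHom r M).lin :=
  fun n x hx => mem_gr_congr (M := ext2 (M.plane r)) (n := n - ![-1, -1, 0])
    ((outHom r M).map_gr n x hx) (by rw [U_shift_eq]; abel)

/-- The module `ℛᵣ(M)`. -/
@[reducible] def RObj (r : ℤ) (M : TriMod.{v} k) : TriMod.{v} k := cone3 (inHom r M)

/-- Among the four basis elements of `Q` only `ω` and `∂₁∂₂ω` have equal first two degrees, so the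
other two coefficients vanish in the plane `r`. -/
theorem coe_RPlane (w : (RObj r M).planeSub r) :
    (w : ext2 (M.plane r) × M) =
      ((((w : ext2 (M.plane r) × M).1.1.1, 0), (0, (w : ext2 (M.plane r) × M).1.2.2)),
        (w : ext2 (M.plane r) × M).2) := by
  have h := (mem_planeSub_ext2.1 (mem_planeSub_cone3.1 w.2).1)
  exact Prod.ext (Prod.ext (Prod.ext rfl (eq_zero_of_mem_planeSub_plane (by omega) h.1.2))
    (Prod.ext (eq_zero_of_mem_planeSub_plane (by omega) h.2.1) rfl)) rfl

variable (r M) in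
/-- The map `v ↦ (ω ⊗ v, 0)` from `M_{i-j=r}` to `ℛᵣ(M)_{i-j=r}`. -/
def RPlaneUnit : M.plane r →ₗ[k] (RObj r M).plane r :=
  LinearMap.codRestrict ((RObj r M).planeSub r)
    (LinearMap.inl k (ext2 (M.plane r)) M ∘ₗ
      LinearMap.inl k (M.plane r × M.plane r) (M.plane r × M.plane r) ∘ₗ
      LinearMap.inl k (M.plane r) (M.plane r)) fun _ =>
    mem_planeSub_cone3.2 ⟨mem_planeSub_ext2.2 ⟨⟨mem_planeSub_plane _, Submodule.zero_mem _⟩,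
      ⟨Submodule.zero_mem _, Submodule.zero_mem _⟩⟩, Submodule.zero_mem _⟩

theorem coe_RPlaneUnit (v : M.plane r) :
    ((RPlaneUnit r M v : (RObj r M).planeSub r) : ext2 (M.plane r) × M) =
      (((v, 0), (0, 0)), 0) := rfl

variable (r M) in
/-- The map `(∂₁∂₂ω ⊗ v, m) ↦ ± v` from `ℛᵣ(M)_{i-j=r}` to `M_{i-j=r}`. -/
noncomputable def RPlaneTop : (RObj r M).plane r →ₗ[k] M.plane r :=
  (M.plane r).sign ∘ₗ LinearMap.snd k (M.plane r) (M.plane r) ∘ₗ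
    LinearMap.snd k (M.plane r × M.plane r) (M.plane r × M.plane r) ∘ₗ
    LinearMap.fst k (ext2 (M.plane r)) M ∘ₗ ((RObj r M).planeSub r).subtype

theorem RPlaneTop_apply (w : (RObj r M).planeSub r) :
    RPlaneTop r M w = (M.plane r).sign (w : ext2 (M.plane r) × M).1.2.2 := rfl

variable (r M) in
/-- The projection from `ℛᵣ(M)_{i-j=r}` to `M_{i-j=r}`. -/
def RPlaneSnd : (RObj r M).plane r →ₗ[k] M.plane r :=
  (LinearMap.snd k (ext2 (M.plane r)) M).restrict fun _ hx => (mem_planeSub_cone3.1 hx).2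

theorem coe_RPlaneSnd (w : (RObj r M).planeSub r) :
    ((RPlaneSnd r M w : M.planeSub r) : M) = (w : ext2 (M.plane r) × M).2 := rfl

theorem RPlaneTop_hasDeg :
    HasDeg (Pi.single 2 1 - Pi.single 0 1 - Pi.single 1 1) (RPlaneTop r M) := fun n w hw =>
  (M.plane r).scale_mem _ (mem_gr_congr (M := M.plane r) hw.1.2.2 (by abel))

theorem RPlaneUnit_hasDeg : HasDeg (-Pi.single 2 1) (RPlaneUnit r M) := fun n v hv =>
  ⟨⟨⟨mem_gr_congr (M := M.plane r) hv (by abel), Submodule.zero_mem _⟩,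
    ⟨Submodule.zero_mem _, Submodule.zero_mem _⟩⟩, Submodule.zero_mem _⟩

theorem RPlaneSnd_hasDeg : HasDeg 0 (RPlaneSnd r M) := fun n w hw =>
  mem_gr_congr (M := M.plane r) hw.2 (by abel)

theorem RPlaneTop_d_two (w : (RObj r M).plane r) :
    (M.plane r).d 2 (RPlaneTop r M w) + RPlaneTop r M (((RObj r M).plane r).d 2 w) = 0 := by
  have e : (((((RObj r M).plane r).d 2 w : (RObj r M).planeSub r) :
      ext2 (M.plane r) × M)).1.2.2 =
      -(M.plane r).d 2 ((w : (RObj r M).planeSub r) : ext2 (M.plane r) × M).1.2.2 := by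
    rw [plane_d_two, cone3_d_two, ext2_d_two]
    rfl
  rw [RPlaneTop_apply, RPlaneTop_apply, e, map_neg, sign_d_two]
  exact add_neg_cancel _

/-- In `ℛᵣ(M)` the element `ω ⊗ v` is attached to `v` by `in`. Hence `v ↦ ω ⊗ v` is a null-homotopy
of the inclusion of the plane of `M`. -/
theorem RPlaneUnit_d_two (v : M.plane r) :
    ((RObj r M).plane r).d 2 (RPlaneUnit r M v) + RPlaneUnit r M ((M.plane r).d 2 v) =
      (planeHom r (cone3Inr (inHom r M))).lin v := by
  refine Subtype.ext ?_
  change (RObj r M).d 2 ((((v, 0), (0, 0)), 0) : ext2 (M.plane r) × M) +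
    (((((M.plane r).d 2 v, 0), (0, 0)), 0) : ext2 (M.plane r) × M) =
      ((0, ((v : M.planeSub r) : M)) : ext2 (M.plane r) × M)
  rw [cone3_d_two, ext2_d_two, inHom_apply]
  refine Prod.ext ?_ ?_
  · simp
  · simp

theorem RPlaneTop_unit (v : M.plane r) : RPlaneTop r M (RPlaneUnit r M v) = 0 := by
  rw [RPlaneTop_apply]
  exact map_zero _

section

variable (n : ext2 (M.plane r) × M)

theorem outHom_RObj_fst_fst :
    ((((outHom r (RObj r M)).lin n).1.1 : (RObj r M).planeSub r) : ext2 (M.plane r) × M) =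
      ((((0, 0), (0, (M.plane r).sign n.1.1.1)),
        ((((outHom r M).lin n.2).1.1 : M.planeSub r) : M)) : ext2 (M.plane r) × M) := by
  have h : (RObj r M).d 0 ((RObj r M).d 1 ((RObj r M).sign n)) =
      ((((0, 0), (0, (M.plane r).sign n.1.1.1)), M.d 0 (M.d 1 (M.sign n.2))) :
        ext2 (M.plane r) × M) := by
    rw [cone3_sign, cone3_d_one, cone3_d_zero, ext2_sign, ext2_d_one (flat_plane r M), map_neg,
      ext2_d_zero (flat_plane r M)]
    exact Prod.ext (neg_neg _) rfl
  rw [outHom_fst_fst, outHom_fst_fst, h, cone3_planeProj, ext2_planeProj]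
  exact Prod.ext (Prod.ext (Prod.ext (map_zero _) (map_zero _))
    (Prod.ext (map_zero _) (plane_planeProj_self _))) rfl

theorem outHom_RObj_fst_snd :
    ((((outHom r (RObj r M)).lin n).1.2 : (RObj r M).planeSub r) : ext2 (M.plane r) × M) =
      ((((0, 0), (0, -(M.plane r).sign n.1.1.2)),
        ((((outHom r M).lin n.2).1.2 : M.planeSub r) : M)) : ext2 (M.plane r) × M) := by
  rw [outHom_fst_snd, outHom_fst_snd, cone3_sign, cone3_d_zero, cone3_planeProj,
    ext2_sign, ext2_d_zero (flat_plane r M), map_neg, ext2_planeProj]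
  refine Prod.ext ((neg_neg _).trans (Prod.ext (Prod.ext (map_zero _) (map_zero _))
    (Prod.ext ?_ ?_))) rfl
  · exact plane_planeProj_ne (by omega) _
  · exact plane_planeProj_self _

theorem outHom_RObj_snd_fst :
    ((((outHom r (RObj r M)).lin n).2.1 : (RObj r M).planeSub r) : ext2 (M.plane r) × M) =
      ((((0, 0), (0, -(M.plane r).sign n.1.2.1)),
        ((((outHom r M).lin n.2).2.1 : M.planeSub r) : M)) : ext2 (M.plane r) × M) := by
  rw [outHom_snd_fst, outHom_snd_fst, cone3_sign, cone3_d_one, cone3_planeProj,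
    ext2_sign, ext2_d_one (flat_plane r M), map_neg, ext2_planeProj]
  refine Prod.ext (Prod.ext (Prod.ext ?_ ?_) (Prod.ext ?_ ?_)) rfl
  · exact neg_eq_zero.2 (map_zero _)
  · exact neg_eq_zero.2 (plane_planeProj_ne (by omega) _)
  · exact neg_eq_zero.2 (map_zero _)
  · refine congrArg Neg.neg ((plane_planeProj_self _).trans (neg_neg _))

theorem outHom_RObj_snd_snd :
    ((((outHom r (RObj r M)).lin n).2.2 : (RObj r M).planeSub r) : ext2 (M.plane r) × M) =
      (((((M.plane r).sign n.1.1.1, 0), (0, (M.plane r).sign n.1.2.2)),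
        ((((outHom r M).lin n.2).2.2 : M.planeSub r) : M)) : ext2 (M.plane r) × M) := by
  rw [outHom_snd_snd, outHom_snd_snd, cone3_sign, cone3_planeProj, ext2_sign, ext2_planeProj]
  exact Prod.ext (Prod.ext
    (Prod.ext (plane_planeProj_self _) (plane_planeProj_ne (by omega) _))
    (Prod.ext (plane_planeProj_ne (by omega) _) (plane_planeProj_self _))) rfl

/-- By the four coordinate formulas, the top coefficients of `out (u, m)` are those of `u` up to the
sign operator, which `RPlaneTop` undoes. Through this identity component `𝒰ᵣ(M)` is cancelled. -/
theorem oddMap_RPlaneTop_outHom :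
    oddMap (RPlaneTop r M) ((outHom r (RObj r M)).lin n) = n.1 := by
  rw [oddMap_apply, RPlaneTop_apply, RPlaneTop_apply, RPlaneTop_apply, RPlaneTop_apply,
    outHom_RObj_fst_fst, outHom_RObj_fst_snd, outHom_RObj_snd_fst, outHom_RObj_snd_snd]
  have e : ∀ y : M.plane r, -(M.plane r).sign (-(M.plane r).sign y) = y := fun y => by
    rw [map_neg, neg_neg, sign_sign]
  exact Prod.ext (Prod.ext (sign_sign _ _) (e _)) (Prod.ext (e _) (sign_sign _ _))

/-- `RPlaneSnd` sees only the `M`-components of the coordinates, and there `out` for `ℛᵣ(M)` is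
`out` for `M`. -/
theorem oddMap_RPlaneUnit_outHom :
    oddMap (RPlaneUnit r M ∘ₗ RPlaneSnd r M) ((outHom r (RObj r M)).lin n) =
      oddMap (RPlaneUnit r M) ((outHom r M).lin n.2) := by
  have e0 : RPlaneSnd r M ((outHom r (RObj r M)).lin n).1.1 = ((outHom r M).lin n.2).1.1 :=
    Subtype.ext (congrArg Prod.snd (outHom_RObj_fst_fst n))
  have e1 : RPlaneSnd r M ((outHom r (RObj r M)).lin n).1.2 = ((outHom r M).lin n.2).1.2 :=
    Subtype.ext (congrArg Prod.snd (outHom_RObj_fst_snd n))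
  have e2 : RPlaneSnd r M ((outHom r (RObj r M)).lin n).2.1 = ((outHom r M).lin n.2).2.1 :=
    Subtype.ext (congrArg Prod.snd (outHom_RObj_snd_fst n))
  have e3 : RPlaneSnd r M ((outHom r (RObj r M)).lin n).2.2 = ((outHom r M).lin n.2).2.2 :=
    Subtype.ext (congrArg Prod.snd (outHom_RObj_snd_snd n))
  exact oddMap_congr (congrArg (RPlaneUnit r M) e0) (congrArg (RPlaneUnit r M) e1)
    (congrArg (RPlaneUnit r M) e2) (congrArg (RPlaneUnit r M) e3)

end

/-- By naturality, `out` on the submodule `M` of `ℛᵣ(M)` is `out` of `M` followed by the inclusion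
of planes, and that inclusion is null-homotopic by `RPlaneUnit_d_two`. -/
theorem oddMap_RPlaneUnit_outHom_d_two (m : M) :
    (ext2 ((RObj r M).plane r)).d 2 (oddMap (RPlaneUnit r M) ((outHom r M).lin m)) +
      oddMap (RPlaneUnit r M) ((outHom r M).lin (M.d 2 m)) =
      (outHom r (RObj r M)).lin ((0, m) : ext2 (M.plane r) × M) := by
  have h : (outHom r (RObj r M)).lin ((0, m) : ext2 (M.plane r) × M) =
      (ext2Map (planeHom r (cone3Inr (inHom r M)))).lin ((outHom r M).lin m) :=
    outHom_naturality (cone3Inr (inHom r M)) m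
  rw [outHom_d, h, ext2Map_apply, oddMap_d_two]
  exact Prod.ext (Prod.ext (RPlaneUnit_d_two _) (RPlaneUnit_d_two _))
    (Prod.ext (RPlaneUnit_d_two _) (RPlaneUnit_d_two _))

/-- The component `∂₁∂₂ω ⊗ v ↦ v` on `ℛᵣ(M)_{i-j=r}`. -/
def RPlaneCoeff (w : (RObj r M).planeSub r) : M.plane r := (w : ext2 (M.plane r) × M).1.2.2

theorem RPlaneSnd_d_two (w : (RObj r M).plane r) :
    RPlaneSnd r M (((RObj r M).plane r).d 2 w) =
      (((w : (RObj r M).planeSub r) : ext2 (M.plane r) × M).1.1.1 + planeD01 r M (RPlaneCoeff w) +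
        (M.plane r).d 2 (RPlaneSnd r M w) : M.planeSub r) := by
  have h := coe_RPlane w
  have h1 := congrArg (fun y : ext2 (M.plane r) × M => y.1.1.2) h
  have h2 := congrArg (fun y : ext2 (M.plane r) × M => y.1.2.1) h
  refine Subtype.ext ?_
  rw [coe_RPlaneSnd, plane_d_two, cone3_d_two, inHom_apply, h1, h2]
  change _ + M.d 1 0 + M.d 0 0 + _ + _ = _ + M.d 0 (M.d 1 _) + M.d 2 _
  rw [map_zero, map_zero, add_zero, add_zero]
  rfl

/-- The component of the contraction formula for `ℛ'ᵣ ℛᵣ (M)` on `ℛᵣ(M)_{i-j=r}`. -/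
theorem RPlane_contraction (w : (RObj r M).plane r) :
    ((((RObj r M).plane r).d 2 (RPlaneUnit r M (RPlaneSnd r M w)) +
      RPlaneUnit r M (RPlaneSnd r M (((RObj r M).plane r).d 2 w)) : (RObj r M).planeSub r) :
        ext2 (M.plane r) × M) +
      ((((0, 0), (0, RPlaneCoeff w)), 0) : ext2 (M.plane r) × M) =
    ((w + RPlaneUnit r M (planeD01 r M (RPlaneCoeff w)) : (RObj r M).planeSub r) :
        ext2 (M.plane r) × M) := by
  have h := coe_RPlane w
  have e : ((((RObj r M).plane r).d 2 (RPlaneUnit r M (RPlaneSnd r M w)) :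
      (RObj r M).planeSub r) : ext2 (M.plane r) × M) =
      ((((-(M.plane r).d 2 (RPlaneSnd r M w), 0), (0, 0)),
        ((RPlaneSnd r M w : M.planeSub r) : M)) : ext2 (M.plane r) × M) := by
    rw [plane_d_two, cone3_d_two, coe_RPlaneUnit, ext2_d_two, inHom_apply]
    refine Prod.ext (Prod.ext (Prod.ext ?_ ?_) (Prod.ext ?_ ?_)) ?_ <;> simp
  rw [Submodule.coe_add, Submodule.coe_add, coe_RPlaneUnit, coe_RPlaneUnit, e, RPlaneSnd_d_two]
  refine Eq.trans ?_ (congrArg (· + _) h.symm)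
  refine Prod.ext (Prod.ext (Prod.ext ?_ ?_) (Prod.ext ?_ ?_)) ?_
  · change -(M.plane r).d 2 (RPlaneSnd r M w) + (_ + _ + (M.plane r).d 2 (RPlaneSnd r M w)) + 0 =
      _ + _
    abel
  · exact add_zero _
  · exact add_zero _
  · change (0 : M.plane r) + 0 + RPlaneCoeff w = RPlaneCoeff w + 0
    abel
  · change _ + (0 : M) + 0 = _ + (0 : M)
    rw [add_zero]
    rfl

section

variable (t : ext2 (M.plane r))

theorem outHom_RObj_signed_fst_fst :
    ((((outHom r (RObj r M)).lin
      ((oddMap (M.plane r).sign t, 0) : ext2 (M.plane r) × M)).1.1 : (RObj r M).planeSub r) :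
        ext2 (M.plane r) × M) = ((((0, 0), (0, t.1.1)), 0) : ext2 (M.plane r) × M) := by
  rw [outHom_RObj_fst_fst, oddMap_apply, sign_sign, map_zero]
  rfl

theorem outHom_RObj_signed_fst_snd :
    ((((outHom r (RObj r M)).lin
      ((oddMap (M.plane r).sign t, 0) : ext2 (M.plane r) × M)).1.2 : (RObj r M).planeSub r) :
        ext2 (M.plane r) × M) = ((((0, 0), (0, t.1.2)), 0) : ext2 (M.plane r) × M) := by
  rw [outHom_RObj_fst_snd, oddMap_apply, map_neg, neg_neg, sign_sign, map_zero]
  rfl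

theorem outHom_RObj_signed_snd_fst :
    ((((outHom r (RObj r M)).lin
      ((oddMap (M.plane r).sign t, 0) : ext2 (M.plane r) × M)).2.1 : (RObj r M).planeSub r) :
        ext2 (M.plane r) × M) = ((((0, 0), (0, t.2.1)), 0) : ext2 (M.plane r) × M) := by
  rw [outHom_RObj_snd_fst, oddMap_apply, map_neg, neg_neg, sign_sign, map_zero]
  rfl

theorem outHom_RObj_signed_snd_snd :
    ((((outHom r (RObj r M)).lin
      ((oddMap (M.plane r).sign t, 0) : ext2 (M.plane r) × M)).2.2 : (RObj r M).planeSub r) :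
        ext2 (M.plane r) × M) = ((((t.1.1, 0), (0, t.2.2)), 0) : ext2 (M.plane r) × M) := by
  rw [outHom_RObj_snd_snd, oddMap_apply, sign_sign, sign_sign, map_zero]
  rfl

theorem oddMap_outHom_signed {X : TriMod.{v} k} (h : M.plane r →ₗ[k] X) :
    oddMap h ((outHom r M).lin ((inHom r M).lin (oddMap (M.plane r).sign t))) =
      ((h (planeD01 r M t.1.1), h (planeD01 r M t.1.2)),
        (h (planeD01 r M t.2.1), h (t.1.1 + planeD01 r M t.2.2 : M.planeSub r))) := by
  rw [outHom_signed, oddMap_apply]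
  exact Prod.ext (Prod.ext rfl ((congrArg _ (map_neg _ _)).trans (neg_neg _)))
    (Prod.ext ((congrArg _ (map_neg _ _)).trans (neg_neg _)) rfl)

end

/-- Coefficient by coefficient this is `RPlane_contraction`. Only the coefficient of `∂₁∂₂ω` needs
more, because there `out ∘ in` also contains the shifted `ω`-coefficient. -/
theorem oddMap_RPlaneUnit_contraction (w : ext2 ((RObj r M).plane r)) :
    (ext2 ((RObj r M).plane r)).d 2 (oddMap (RPlaneUnit r M ∘ₗ RPlaneSnd r M) w) +
      oddMap (RPlaneUnit r M ∘ₗ RPlaneSnd r M) ((ext2 ((RObj r M).plane r)).d 2 w) +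
      (outHom r (RObj r M)).lin ((oddMap (RPlaneTop r M) w, 0) : ext2 (M.plane r) × M) =
    w + oddMap (RPlaneUnit r M)
      ((outHom r M).lin ((inHom r M).lin (oddMap (RPlaneTop r M) w))) := by
  have hf : oddMap (RPlaneTop r M) w = oddMap (M.plane r).sign
      ((RPlaneCoeff w.1.1, RPlaneCoeff w.1.2), (RPlaneCoeff w.2.1, RPlaneCoeff w.2.2)) := rfl
  rw [oddMap_d_two, hf, oddMap_outHom_signed]
  refine Prod.ext (Prod.ext (Subtype.ext ?_) (Subtype.ext ?_))
    (Prod.ext (Subtype.ext ?_) (Subtype.ext ?_))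
  · exact (congrArg (_ + ·) (outHom_RObj_signed_fst_fst _)).trans (RPlane_contraction w.1.1)
  · exact (congrArg (_ + ·) (outHom_RObj_signed_fst_snd _)).trans (RPlane_contraction w.1.2)
  · exact (congrArg (_ + ·) (outHom_RObj_signed_snd_fst _)).trans (RPlane_contraction w.2.1)
  · refine (congrArg (_ + ·) (outHom_RObj_signed_snd_snd _)).trans ?_
    -- The additional term `ω ⊗ RPlaneCoeff w.1.1` occurs on both sides: on the left from `out` of
    -- `ℛᵣ(M)`, on the right from `out ∘ in` of `M`.
    have e := congrArg (· + ((((RPlaneCoeff w.1.1, 0), (0, 0)), 0) : ext2 (M.plane r) × M))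
      (RPlane_contraction w.2.2)
    refine Eq.trans ?_ (e.trans ?_)
    · refine (congrArg (_ + ·) ?_).trans (add_assoc _ _ _).symm
      refine Prod.ext (Prod.ext (Prod.ext ?_ ?_) (Prod.ext ?_ ?_)) ?_ <;> simp
    · refine (add_assoc _ _ _).trans (congrArg (_ + ·) ?_)
      refine Prod.ext (Prod.ext (Prod.ext ?_ ?_) (Prod.ext ?_ ?_)) ?_
      · exact add_comm _ _
      all_goals exact add_zero _

variable (r M) in
/-- The morphism `ℛ'ᵣ ℛᵣ (M) ⟶ M`. -/
noncomputable def counitHom : cocone3 (outHom r (RObj r M)) ⟶ M :=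
  coconeCounit (oddMap_hasDeg RPlaneTop_hasDeg)
    (oddMap_anticomm (flat_plane _ _) (flat_plane _ _) RPlaneTop_d_two) oddMap_RPlaneTop_outHom

/-- The plane `r` of `ℛᵣ(M)` consists of the pair `ω ⊗ Mᵣ`, `Mᵣ`, contracted by `RPlaneUnit ∘
RPlaneSnd`, and of the top copy, which `RPlaneTop` matches with `𝒰ᵣ(M)`. -/
theorem isIso_counitHom : IsIso ((toStable k).map (counitHom r M)) := by
  have hV := flat_plane r M
  have hW := flat_plane r (RObj r M)
  refine isIso_coconeCounit _ _ _ (oddMap (RPlaneUnit r M) ∘ₗ (outHom r M).lin) ?_ ?_ ?_ ?_ ?_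
    (oddMap (RPlaneUnit r M ∘ₗ RPlaneSnd r M)) ?_ ?_ ?_ ?_ ?_
    (contr2 _) (contr2_hasDeg _) (adTrace_contr2 hV) (contr2 _) (contr2_hasDeg _)
    (adTrace_contr2 hW)
  · intro n x hx
    exact mem_gr_congr (oddMap_hasDeg RPlaneUnit_hasDeg _ _ (outHom_hasDeg n x hx)) (by abel)
  · intro m
    rw [LinearMap.comp_apply, LinearMap.comp_apply, outHom_d, oddMap_d_zero hV hW]
  · intro m
    rw [LinearMap.comp_apply, LinearMap.comp_apply, outHom_d, oddMap_d_one hV hW]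
  · exact oddMap_RPlaneUnit_outHom_d_two
  · intro m
    rw [LinearMap.comp_apply, oddMap_oddMap, RPlaneTop_unit, RPlaneTop_unit, RPlaneTop_unit,
      RPlaneTop_unit]
    rfl
  · exact oddMap_hasDeg fun n x hx => mem_gr_congr
      (RPlaneUnit_hasDeg _ _ (RPlaneSnd_hasDeg n x hx)) (by abel)
  · exact oddMap_d_zero hW hW _
  · exact oddMap_d_one hW hW _
  · exact oddMap_RPlaneUnit_outHom
  · exact oddMap_RPlaneUnit_contraction

end Counit

end TriMod

namespace TriMod

variable {k : Type u} [Field k]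

/-! ### The isomorphism `ℛᵣ ℛ'ᵣ ≅ Id` -/

section ConeCocone

variable {M E F : TriMod.{v} k} {o : M ⟶ E.shift ![-1, -1, 0]} {i : F ⟶ cocone3 o}
  {ε : E ⟶ M} {f : F →ₗ[k] E}

/-- The morphism `(a, m, z) ↦ m - ε (f a)` from the total complex `F ⟶ M ⊕ E ⟶ 0` to `M`. -/
def coneCounit (hf : HasDeg (-Pi.single 2 1) f)
    (hf0 : ∀ a, f (F.d 0 a) = -E.d 0 (f a)) (hf1 : ∀ a, f (F.d 1 a) = -E.d 1 (f a))
    (hf2 : ∀ a, ε.lin (E.d 2 (f a) + f (F.d 2 a)) = -(i.lin a : M × E).1) :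
    cone3 i ⟶ M where
  lin := LinearMap.fst k M E ∘ₗ LinearMap.snd k F (M × E) -
    ε.lin ∘ₗ f ∘ₗ LinearMap.fst k F (M × E)
  map_gr n x hx := Submodule.sub_mem _ ((cocone3_gr o n x.2).1 hx.2).1
    (mem_gr_congr (ε.map_gr _ _ (hf _ _ hx.1)) (by abel))
  map_d s x := by
    obtain ⟨a, m, z⟩ := x
    have e : ∀ y : F × (M × E), (cone3 i).d s (a, (m, z)) = y →
        y.2.1 - ε.lin (f y.1) = M.d s (m - ε.lin (f a)) →
        (LinearMap.fst k M E ∘ₗ LinearMap.snd k F (M × E) -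
          ε.lin ∘ₗ f ∘ₗ LinearMap.fst k F (M × E)) ((cone3 i).d s (a, (m, z))) =
          M.d s (m - ε.lin (f a)) := by
      rintro y hy h
      rw [hy]
      exact h
    fin_cases s
    · refine e _ (cone3_d_zero i _) ?_
      rw [cocone3_d_zero, map_neg, hf0, neg_neg, ε.map_d, map_sub]
      rfl
    · refine e _ (cone3_d_one i _) ?_
      rw [cocone3_d_one, map_neg, hf1, neg_neg, ε.map_d, map_sub]
      rfl
    · refine e _ (cone3_d_two i _) ?_
      have h := hf2 a
      rw [map_add, ε.map_d] at h
      rw [cocone3_d_two, map_neg, map_neg, sub_neg_eq_add]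
      have e1 : (i.lin a : M × E).1 = -(M.d 2 (ε.lin (f a)) + ε.lin (f (F.d 2 a))) := by
        rw [h, neg_neg]
      change (i.lin a : M × E).1 + M.d 2 m + ε.lin (f (F.d 2 a)) = M.d 2 (m - ε.lin (f a))
      rw [e1, map_sub]
      abel

theorem coneCounit_apply (hf : HasDeg (-Pi.single 2 1) f)
    (hf0 : ∀ a, f (F.d 0 a) = -E.d 0 (f a)) (hf1 : ∀ a, f (F.d 1 a) = -E.d 1 (f a))
    (hf2 : ∀ a, ε.lin (E.d 2 (f a) + f (F.d 2 a)) = -(i.lin a : M × E).1) (x : F × (M × E)) :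
    (coneCounit hf hf0 hf1 hf2).lin x = x.2.1 - ε.lin (f x.1) := rfl

/-- This is the dual elimination. Since `i ∘ j` is the inclusion of `E`, the summand `E` cancels
against `j(E)`, and `h` contracts the remainder of `F`. The section is `m ↦ (j (o m), m, 0)`; the
contraction `(a, m, z) ↦ (j z + h a, 0, 0)` has values in `F` only, so freeness of `F` suffices. -/
theorem isIso_coneCounit (hf : HasDeg (-Pi.single 2 1) f)
    (hf0 : ∀ a, f (F.d 0 a) = -E.d 0 (f a)) (hf1 : ∀ a, f (F.d 1 a) = -E.d 1 (f a))
    (hf2 : ∀ a, ε.lin (E.d 2 (f a) + f (F.d 2 a)) = -(i.lin a : M × E).1)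
    (j : E →ₗ[k] F) (hj : HasDeg (Pi.single 2 1 - Pi.single 0 1 - Pi.single 1 1) j)
    (hjd : ∀ s z, j (E.d s z) = -F.d s (j z)) (hij : ∀ z, (i.lin (j z) : M × E) = (0, z))
    (hfj : ∀ z, f (j z) = 0) (h : F →ₗ[k] F) (hh : HasDeg (-Pi.single 2 1) h)
    (hh0 : ∀ a, h (F.d 0 a) = -F.d 0 (h a)) (hh1 : ∀ a, h (F.d 1 a) = -F.d 1 (h a))
    (hih : ∀ a, (i.lin (h a) : M × E) = (ε.lin (f a), 0))
    (hh2 : ∀ a, -(F.d 2 (h a) + h (F.d 2 a)) + j (i.lin a : M × E).2 =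
      a + j (o.lin (ε.lin (f a))))
    (GF : F →ₗ[k] F) (hGF : HasDeg (-Pi.single 0 1 - Pi.single 1 1) GF)
    (hGF' : ∀ x, adTrace GF x = x) :
    IsIso ((toStable k).map (coneCounit hf hf0 hf1 hf2)) := by
  have hjo : ∀ s m, j (o.lin (M.d s m)) = -F.d s (j (o.lin m)) := fun s m => by
    rw [o.map_d, shift_U_d, hjd]
  let s : M ⟶ cone3 i :=
    { lin := (j ∘ₗ o.lin).prod (LinearMap.inl k M E)
      map_gr := fun n m hm => ⟨mem_gr_congr (hj _ _ (o.map_gr n m hm)) (by rw [U_shift_eq]; abel),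
        (cocone3_gr o n _).2 ⟨hm, Submodule.zero_mem _⟩⟩
      map_d := fun s m => by
        change ((j (o.lin (M.d s m)), (M.d s m, 0)) : F × (M × E)) =
          (cone3 i).d s ((j (o.lin m), (m, 0)) : F × (M × E))
        rw [hjo]
        fin_cases s
        · refine Eq.trans ?_ (cone3_d_zero i _).symm
          rw [cocone3_d_zero]
          refine Prod.ext rfl (Prod.ext rfl ?_)
          simp
        · refine Eq.trans ?_ (cone3_d_one i _).symm
          rw [cocone3_d_one]
          refine Prod.ext rfl (Prod.ext rfl ?_)
          simp
        · refine Eq.trans ?_ (cone3_d_two i _).symm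
          rw [cocone3_d_two, hij]
          refine Prod.ext rfl (Prod.ext ?_ ?_)
          · exact (zero_add _).symm
          · change (0 : E) = o.lin m + (-o.lin m - E.d 2 0)
            rw [map_zero, sub_zero]
            exact (add_neg_cancel (o.lin m : E)).symm }
  let H : cone3 i →ₗ[k] cone3 i := LinearMap.inl k F (M × E) ∘ₗ
    (j ∘ₗ LinearMap.snd k M E ∘ₗ LinearMap.snd k F (M × E) + h ∘ₗ LinearMap.fst k F (M × E))
  let G : cone3 i →ₗ[k] cone3 i := GF.prodMap (0 : (M × E) →ₗ[k] (M × E))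
  have hH : ∀ x : F × (M × E), H x = ((j x.2.2 + h x.1, 0) : F × (M × E)) := fun _ => rfl
  have hG : ∀ x : F × (M × E), G x = ((GF x.1, 0) : F × (M × E)) := fun _ => rfl
  refine isIso_of_retraction (s := s) ?_ (H := H) ⟨?_, ?_, ?_⟩ G ?_ ?_ ?_
  · refine TriMod.hom_ext fun m => ?_
    change m - ε.lin (f (j (o.lin m))) = m
    rw [hfj, map_zero, sub_zero]
  · intro n x hx
    obtain ⟨h1, h2⟩ := (cocone3_gr o n x.2).1 hx.2
    exact ⟨Submodule.add_mem _ (mem_gr_congr (hj _ _ h2) (by abel))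
      (mem_gr_congr (hh _ _ hx.1) (by abel)), Submodule.zero_mem _⟩
  · intro x
    rw [cone3_d_zero, hH, hH, cone3_d_zero, cocone3_d_zero, cocone3_d_zero]
    simp [hh0, hjd, add_comm]
    rfl
  · intro x
    rw [cone3_d_one, hH, hH, cone3_d_one, cocone3_d_one, cocone3_d_one]
    simp [hh1, hjd, add_comm]
    rfl
  · intro n x hx
    exact ⟨mem_gr_congr (hGF _ _ hx.1) (by abel), Submodule.zero_mem _⟩
  · intro x
    have e1 := hGF' (j x.2.2 + h x.1)
    have h0 : ⇑((cone3 i).d 0) = fun x : F × (M × E) =>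
        ((-F.d 0 x.1, (cocone3 o).d 0 x.2) : F × (M × E)) := funext fun x => by
      rw [cone3_d_zero]
    have h1 : ⇑((cone3 i).d 1) = fun x : F × (M × E) =>
        ((-F.d 1 x.1, (cocone3 o).d 1 x.2) : F × (M × E)) := funext fun x => by
      rw [cone3_d_one]
    rw [adTrace] at e1 ⊢
    rw [h0, h1, hH]
    simp only [hG]
    refine Prod.ext ?_ ?_
    · refine Eq.trans ?_ e1
      simp only [Prod.fst_add, Prod.fst_sub, map_neg, map_sub, neg_neg, neg_sub]
      abel
    · simp
  · intro x
    obtain ⟨a, m, z⟩ := x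
    rw [cone3_d_two, hH, hH, cone3_d_two, cocone3_d_two, cocone3_d_two]
    change ((a, (m, z)) : F × (M × E)) -
      ((j (o.lin (m - ε.lin (f a))), (m - ε.lin (f a), 0)) : F × (M × E)) = _
    have e1 := hh2 a
    have e2 : i.lin (j z + h a) = ((ε.lin (f a), z) : M × E) := by
      rw [map_add, hij, hih]
      exact Prod.ext (zero_add _) (add_zero _)
    refine Prod.ext ?_ ?_
    · have e4 := sub_eq_zero.2 e1
      have e3 : ∀ b : E, j (-(o.lin m : E) - b) = -j (o.lin m) - j b := fun b => by
        rw [map_sub, map_neg]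
      change a - j (o.lin (m - ε.lin (f a))) = -F.d 2 (j z + h a) +
        (j ((i.lin a : M × E).2 + (-(o.lin m : E) - E.d 2 z)) + h (-F.d 2 a))
      rw [← sub_eq_zero, ← neg_eq_zero, ← e4, map_add j, e3, hjd]
      simp only [map_add, map_sub, map_neg]
      abel
    · refine Eq.trans ?_ (congrArg (· + _) ((congrArg (· + _) e2).symm))
      refine Prod.ext ?_ ?_
      · change m - (m - ε.lin (f a)) = ε.lin (f a) + M.d 2 0 + 0
        rw [map_zero]
        abel
      · change z - 0 = z + (-(o.lin 0 : E) - E.d 2 0) + 0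
        rw [map_zero, map_zero]
        simp

end ConeCocone

theorem mem_planeSub_cocone3 {r : ℤ} {N E : TriMod.{v} k} {o : N ⟶ E.shift ![-1, -1, 0]}
    {x : N × E} :
    x ∈ (cocone3 o).planeSub r ↔ x.1 ∈ N.planeSub r ∧ x.2 ∈ E.planeSub r := by
  rw [← planeSub_shift r E ![-1, -1, 0] rfl]
  exact (congrArg (x ∈ ·) (planeSub_shift r (cone3 o) ![0, 0, 1] rfl)).to_iff.trans
    mem_planeSub_cone3

section ConeCounit

variable {r : ℤ} {M : TriMod.{v} k}

/-- The module `ℛ'ᵣ(M)`. -/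
@[reducible] noncomputable def RObj' (r : ℤ) (M : TriMod.{v} k) : TriMod.{v} k :=
  cocone3 (outHom r M)

/-- The component `(m, q) ↦ m` on `ℛ'ᵣ(M)_{i-j=r}`. -/
def RPlaneFst' (w : (RObj' r M).planeSub r) : M.plane r :=
  ⟨(w : M × ext2 (M.plane r)).1, (mem_planeSub_cocone3.1 w.2).1⟩

/-- The component `(m, ω ⊗ v + ∂₁∂₂ω ⊗ v') ↦ v` on `ℛ'ᵣ(M)_{i-j=r}`. -/
def RPlaneBot' (w : (RObj' r M).planeSub r) : M.plane r := (w : M × ext2 (M.plane r)).2.1.1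

/-- The component `(m, ω ⊗ v + ∂₁∂₂ω ⊗ v') ↦ v'` on `ℛ'ᵣ(M)_{i-j=r}`. -/
def RPlaneCoeff' (w : (RObj' r M).planeSub r) : M.plane r := (w : M × ext2 (M.plane r)).2.2.2

theorem coe_RPlane' (w : (RObj' r M).planeSub r) :
    (w : M × ext2 (M.plane r)) =
      (((RPlaneFst' w : M.planeSub r) : M), ((RPlaneBot' w, 0), (0, RPlaneCoeff' w))) := by
  have h := (mem_planeSub_ext2.1 (mem_planeSub_cocone3.1 w.2).2)
  exact Prod.ext rfl (Prod.ext (Prod.ext rfl (eq_zero_of_mem_planeSub_plane (by omega) h.1.2))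
    (Prod.ext (eq_zero_of_mem_planeSub_plane (by omega) h.2.1) rfl))

variable (r M) in
/-- The map `v ↦ (0, ω ⊗ v)` from `M_{i-j=r}` to `ℛ'ᵣ(M)_{i-j=r}`. -/
noncomputable def RPlaneUnit' : M.plane r →ₗ[k] (RObj' r M).plane r :=
  LinearMap.codRestrict ((RObj' r M).planeSub r)
    (LinearMap.inr k M (ext2 (M.plane r)) ∘ₗ
      LinearMap.inl k (M.plane r × M.plane r) (M.plane r × M.plane r) ∘ₗ
      LinearMap.inl k (M.plane r) (M.plane r)) fun _ =>
    mem_planeSub_cocone3.2 ⟨Submodule.zero_mem _,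
      mem_planeSub_ext2.2 ⟨⟨mem_planeSub_plane _, Submodule.zero_mem _⟩,
      ⟨Submodule.zero_mem _, Submodule.zero_mem _⟩⟩⟩

theorem coe_RPlaneUnit' (v : M.plane r) :
    ((RPlaneUnit' r M v : (RObj' r M).planeSub r) : M × ext2 (M.plane r)) =
      (0, ((v, 0), (0, 0))) := rfl

variable (r M) in
/-- The map `(m, ∂₁∂₂ω ⊗ v) ↦ ± v` from `ℛ'ᵣ(M)_{i-j=r}` to `M_{i-j=r}`. -/
noncomputable def RPlaneTop' : (RObj' r M).plane r →ₗ[k] M.plane r :=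
  (M.plane r).sign ∘ₗ LinearMap.snd k (M.plane r) (M.plane r) ∘ₗ
    LinearMap.snd k (M.plane r × M.plane r) (M.plane r × M.plane r) ∘ₗ
    LinearMap.snd k M (ext2 (M.plane r)) ∘ₗ ((RObj' r M).planeSub r).subtype

theorem RPlaneTop'_apply (w : (RObj' r M).planeSub r) :
    RPlaneTop' r M w = (M.plane r).sign (RPlaneCoeff' w) := rfl

variable (r M) in
/-- The inclusion of `M_{i-j=r}` in `ℛ'ᵣ(M)_{i-j=r}`. -/
noncomputable def RPlaneInl' : M.plane r →ₗ[k] (RObj' r M).plane r :=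
  LinearMap.codRestrict ((RObj' r M).planeSub r)
    (LinearMap.inl k M (ext2 (M.plane r)) ∘ₗ (M.planeSub r).subtype) fun m =>
    mem_planeSub_cocone3.2 ⟨m.2, Submodule.zero_mem _⟩

theorem coe_RPlaneInl' (m : M.planeSub r) :
    ((RPlaneInl' r M m : (RObj' r M).planeSub r) : M × ext2 (M.plane r)) = ((m : M), 0) := rfl

theorem RPlaneUnit'_hasDeg :
    HasDeg (Pi.single 2 1 - Pi.single 0 1 - Pi.single 1 1) (RPlaneUnit' r M) := fun n v hv =>
  (cocone3_gr (outHom r M) _ _).2 ⟨Submodule.zero_mem _,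
    ⟨⟨mem_gr_congr (M := M.plane r) hv (by abel), Submodule.zero_mem _⟩,
      ⟨Submodule.zero_mem _, Submodule.zero_mem _⟩⟩⟩

theorem RPlaneTop'_hasDeg : HasDeg (-Pi.single 2 1) (RPlaneTop' r M) := fun n w hw =>
  (M.plane r).scale_mem _
    (mem_gr_congr (M := M.plane r) ((cocone3_gr (outHom r M) _ _).1 hw).2.2.2 (by abel))

theorem RPlaneInl'_hasDeg : HasDeg 0 (RPlaneInl' r M) := fun n w hw =>
  (cocone3_gr (outHom r M) _ _).2 ⟨mem_gr_congr (M := M) hw (by abel), Submodule.zero_mem _⟩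

theorem RPlane'_d_two (w : (RObj' r M).plane r) :
    ((((RObj' r M).plane r).d 2 w : (RObj' r M).planeSub r) : M × ext2 (M.plane r)) =
      (M.d 2 (RPlaneFst' w : M.planeSub r), -(outHom r M).lin (RPlaneFst' w : M.planeSub r) -
        (((M.plane r).d 2 (RPlaneBot' w), 0), (0, (M.plane r).d 2 (RPlaneCoeff' w)))) := by
  rw [plane_d_two, coe_RPlane', cocone3_d_two, ext2_d_two]
  refine Prod.ext rfl (Prod.ext (Prod.ext rfl ?_) (Prod.ext ?_ rfl))
  · change _ - -(M.plane r).d 2 0 = _ - 0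
    rw [map_zero, neg_zero]
  · change _ - -(M.plane r).d 2 0 = _ - 0
    rw [map_zero, neg_zero]

theorem outHom_coe_snd_snd (m : M.planeSub r) :
    ((outHom r M).lin (m : M)).2.2 = (M.plane r).sign m := by
  refine Subtype.ext ?_
  rw [outHom_snd_snd, coe_plane_sign, planeProj_of_mem _ (sign_mem_planeSub _ _ m.2)]

theorem outHom_coe_sign (m : M.planeSub r) :
    (outHom r M).lin (((M.plane r).sign m : M.planeSub r) : M) =
      ((planeD01 r M m, 0), (0, m)) := by
  -- On `ω ⊗ m` the map `in` is just the inclusion of the plane, so the formula for `out ∘ in`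
  -- specialises to one for `out`.
  have h := outHom_signed (r := r) (M := M) ((m, 0), (0, 0))
  have e : (inHom r M).lin (oddMap (M.plane r).sign ((m, 0), (0, 0))) =
      (((M.plane r).sign m : M.planeSub r) : M) := by
    rw [oddMap_apply, inHom_apply]
    simp
  rw [e] at h
  refine h.trans ?_
  simp

/-- In `ℛ'ᵣ(M)` an element `m` of the plane is attached by `out` to `∂₁∂₂ω ⊗ m` up to sign. Reading
off the top coefficient is therefore a homotopy that kills the `M`-component. -/
theorem RPlaneTop'_d_two (w : (RObj' r M).plane r) :
    (M.plane r).d 2 (RPlaneTop' r M w) + RPlaneTop' r M (((RObj' r M).plane r).d 2 w) =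
      -RPlaneFst' w := by
  have h := congrArg (fun y : M × ext2 (M.plane r) => y.2.2.2) (RPlane'_d_two w)
  have e : RPlaneCoeff' (((RObj' r M).plane r).d 2 w) =
      -(M.plane r).sign (RPlaneFst' w) - (M.plane r).d 2 (RPlaneCoeff' w) := by
    refine h.trans ?_
    rw [← outHom_coe_snd_snd]
    rfl
  rw [RPlaneTop'_apply, RPlaneTop'_apply, e, map_sub, map_neg, sign_sign, sign_d_two]
  exact add_sub_cancel _ _

theorem RPlaneUnit'_d_two (v : M.plane r) :
    ((RObj' r M).plane r).d 2 (RPlaneUnit' r M v) + RPlaneUnit' r M ((M.plane r).d 2 v) = 0 := by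
  refine Subtype.ext ?_
  change (RObj' r M).d 2 ((0, ((v, 0), (0, 0))) : M × ext2 (M.plane r)) +
    ((0, (((M.plane r).d 2 v, 0), (0, 0))) : M × ext2 (M.plane r)) = 0
  rw [cocone3_d_two, ext2_d_two]
  refine Prod.ext ?_ (Prod.ext (Prod.ext ?_ ?_) (Prod.ext ?_ ?_)) <;> simp

theorem RPlaneTop'_unit (v : M.plane r) : RPlaneTop' r M (RPlaneUnit' r M v) = 0 :=
  map_zero (M.plane r).sign

theorem RPlaneInl'_d_two (m : M.planeSub r) :
    ((((RObj' r M).plane r).d 2 (RPlaneInl' r M m) : (RObj' r M).planeSub r) :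
      M × ext2 (M.plane r)) = (M.d 2 (m : M), -(outHom r M).lin (m : M)) := by
  rw [plane_d_two, coe_RPlaneInl', cocone3_d_two, map_zero]
  exact Prod.ext rfl (sub_zero (-(outHom r M).lin (m : M) : ext2 (M.plane r)))

/-- The component of the contraction formula for `ℛᵣ ℛ'ᵣ (M)` on `ℛ'ᵣ(M)_{i-j=r}`. -/
theorem RPlane'_contraction (w : (RObj' r M).planeSub r) :
    ((-(((RObj' r M).plane r).d 2 (RPlaneInl' r M (RPlaneTop' r M w)) +
      RPlaneInl' r M (RPlaneTop' r M (((RObj' r M).plane r).d 2 w))) +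
        RPlaneUnit' r M (RPlaneBot' w) : (RObj' r M).planeSub r) : M × ext2 (M.plane r)) =
      ((w + RPlaneUnit' r M (planeD01 r M (RPlaneCoeff' w)) : (RObj' r M).planeSub r) :
        M × ext2 (M.plane r)) := by
  have e1 : RPlaneTop' r M (((RObj' r M).plane r).d 2 w) =
      -RPlaneFst' w - (M.plane r).d 2 (RPlaneTop' r M w) :=
    eq_sub_of_add_eq' (RPlaneTop'_d_two w)
  have h := coe_RPlane' w
  rw [Submodule.coe_add, Submodule.coe_add, Submodule.coe_neg, Submodule.coe_add,
    RPlaneInl'_d_two, e1, coe_RPlaneUnit', coe_RPlaneUnit', coe_RPlaneInl', RPlaneTop'_apply,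
    outHom_coe_sign]
  refine Eq.trans ?_ (congrArg (· + _) h.symm)
  refine Prod.ext ?_ (Prod.ext (Prod.ext ?_ ?_) (Prod.ext ?_ ?_))
  · change -(M.d 2 (((M.plane r).sign (RPlaneCoeff' w) : M.planeSub r) : M) +
      (-((RPlaneFst' w : M.planeSub r) : M) -
        M.d 2 (((M.plane r).sign (RPlaneCoeff' w) : M.planeSub r) : M))) + 0 = _ + 0
    abel
  · change -(-planeD01 r M (RPlaneCoeff' w) + 0) + RPlaneBot' w = RPlaneBot' w + _
    rw [add_zero, neg_neg, add_comm]
  · change -(-(0 : M.plane r) + 0) + 0 = (0 : M.plane r) + 0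
    simp
  · change -(-(0 : M.plane r) + 0) + 0 = (0 : M.plane r) + 0
    simp
  · change -(-RPlaneCoeff' w + 0) + 0 = RPlaneCoeff' w + 0
    simp

/-- Both `∂₁` and `∂₂` kill the top element `∂₁∂₂ω`, so a top coefficient survives only under `q =
1`. The minus signs come from the negated action of `∂₁` and `∂₂` on the second summand of `ℛ'ᵣ(M)`.
-/
theorem inHom_RObj' (a : ext2 ((RObj' r M).plane r)) :
    ((inHom r (RObj' r M)).lin a : M × ext2 (M.plane r)) =
      ((inHom r M).lin ((RPlaneFst' a.1.1, RPlaneFst' a.1.2),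
        (RPlaneFst' a.2.1, RPlaneFst' a.2.2)),
        ((RPlaneBot' a.1.1, -RPlaneBot' a.1.2),
          (-RPlaneBot' a.2.1, RPlaneCoeff' a.1.1 + RPlaneBot' a.2.2))) := by
  have hV := flat_plane r M
  rw [inHom_apply, inHom_apply, cocone3_d_one, cocone3_d_one, cocone3_d_zero, cocone3_d_zero,
    coe_RPlane' a.1.1, coe_RPlane' a.1.2, coe_RPlane' a.2.1, coe_RPlane' a.2.2,
    ext2_d_one hV, ext2_d_one hV, ext2_d_zero hV, map_neg, ext2_d_zero hV, neg_neg]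
  refine Prod.ext rfl (Prod.ext (Prod.ext ?_ ?_) (Prod.ext ?_ ?_))
  · change RPlaneBot' a.1.1 + -0 + -0 + 0 = _
    simp
  · change 0 + -RPlaneBot' a.1.2 + -0 + 0 = _
    simp
  · change 0 + -0 + -RPlaneBot' a.2.1 + 0 = _
    simp
  · change RPlaneCoeff' a.1.1 + - -0 + -0 + RPlaneBot' a.2.2 = _
    simp

theorem oddMap_RPlaneTop'_d_two (a : ext2 ((RObj' r M).plane r)) :
    (inHom r M).lin ((ext2 (M.plane r)).d 2 (oddMap (RPlaneTop' r M) a) +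
      oddMap (RPlaneTop' r M) ((ext2 ((RObj' r M).plane r)).d 2 a)) =
      -((inHom r (RObj' r M)).lin a : M × ext2 (M.plane r)).1 := by
  rw [oddMap_d_two, RPlaneTop'_d_two, RPlaneTop'_d_two, RPlaneTop'_d_two, RPlaneTop'_d_two,
    inHom_RObj']
  exact map_neg (inHom r M).lin ((RPlaneFst' a.1.1, RPlaneFst' a.1.2),
        (RPlaneFst' a.2.1, RPlaneFst' a.2.2))

/-- Applying `q` to `ω ⊗ v` inside `ℛ'ᵣ(M)` gives `q ⊗ v` up to `(-1)^|q|`, the sign contained in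
`oddMap`. Thus `in` splits off a whole copy of `𝒰ᵣ(M)`. -/
theorem inHom_oddMap_RPlaneUnit' (z : ext2 (M.plane r)) :
    ((inHom r (RObj' r M)).lin (oddMap (RPlaneUnit' r M) z) : M × ext2 (M.plane r)) = (0, z) := by
  have e0 : ∀ y, RPlaneFst' (RPlaneUnit' r M y) = 0 := fun y => rfl
  have e1 : ∀ y, RPlaneFst' (-RPlaneUnit' r M y : (RObj' r M).planeSub r) = 0 := fun y =>
    Subtype.ext neg_zero
  rw [oddMap_apply, inHom_RObj', e0, e0, e1, e1]
  exact Prod.ext (map_zero (inHom r M).lin)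
    (Prod.ext (Prod.ext rfl (neg_neg _)) (Prod.ext (neg_neg _) (zero_add _)))

theorem inHom_oddMap_RPlaneInl' (a : ext2 ((RObj' r M).plane r)) :
    ((inHom r (RObj' r M)).lin (oddMap (RPlaneInl' r M ∘ₗ RPlaneTop' r M) a) :
      M × ext2 (M.plane r)) = ((inHom r M).lin (oddMap (RPlaneTop' r M) a), 0) := by
  rw [oddMap_apply (RPlaneInl' r M ∘ₗ RPlaneTop' r M), inHom_RObj', oddMap_apply]
  refine Prod.ext rfl (Prod.ext (Prod.ext rfl ?_) (Prod.ext ?_ ?_))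
  · exact (neg_neg _).trans rfl
  · exact (neg_neg _).trans rfl
  · exact (add_zero _).trans rfl

/-- Again this is `RPlane'_contraction` in each coefficient. In the last one, the top coefficient of
`a.1.1` contributes one further term, the same on both sides. -/
theorem oddMap_RPlaneInl'_contraction (a : ext2 ((RObj' r M).plane r)) :
    -((ext2 ((RObj' r M).plane r)).d 2 (oddMap (RPlaneInl' r M ∘ₗ RPlaneTop' r M) a) +
      oddMap (RPlaneInl' r M ∘ₗ RPlaneTop' r M) ((ext2 ((RObj' r M).plane r)).d 2 a)) +
      oddMap (RPlaneUnit' r M) ((inHom r (RObj' r M)).lin a : M × ext2 (M.plane r)).2 =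
    a + oddMap (RPlaneUnit' r M)
      ((outHom r M).lin ((inHom r M).lin (oddMap (RPlaneTop' r M) a))) := by
  have hf : oddMap (RPlaneTop' r M) a = oddMap (M.plane r).sign
      ((RPlaneCoeff' a.1.1, RPlaneCoeff' a.1.2), (RPlaneCoeff' a.2.1, RPlaneCoeff' a.2.2)) := rfl
  have e : oddMap (RPlaneUnit' r M) ((inHom r (RObj' r M)).lin a : M × ext2 (M.plane r)).2 =
      ((RPlaneUnit' r M (RPlaneBot' a.1.1), RPlaneUnit' r M (RPlaneBot' a.1.2)),
        (RPlaneUnit' r M (RPlaneBot' a.2.1),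
          RPlaneUnit' r M (RPlaneCoeff' a.1.1) + RPlaneUnit' r M (RPlaneBot' a.2.2))) := by
    rw [inHom_RObj', oddMap_apply]
    have e' : ∀ y, -RPlaneUnit' r M (-y) = RPlaneUnit' r M y := fun y => by rw [map_neg, neg_neg]
    exact Prod.ext (Prod.ext rfl (e' _)) (Prod.ext (e' _) (map_add _ _ _))
  rw [oddMap_d_two, hf, oddMap_outHom_signed, e]
  refine Prod.ext (Prod.ext (Subtype.ext ?_) (Subtype.ext ?_))
    (Prod.ext (Subtype.ext ?_) ?_)
  · exact RPlane'_contraction a.1.1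
  · exact RPlane'_contraction a.1.2
  · exact RPlane'_contraction a.2.1
  · have h : _ = _ := Subtype.ext (RPlane'_contraction a.2.2)
    refine (add_left_comm _ _ _).trans ((congrArg (_ + ·) h).trans ?_)
    refine (add_left_comm _ _ _).trans (congrArg (_ + ·) ?_)
    exact (map_add (RPlaneUnit' r M) _ _).symm

variable (r M) in
/-- The morphism `ℛᵣ ℛ'ᵣ (M) ⟶ M`. -/
noncomputable def counitHom' : cone3 (inHom r (RObj' r M)) ⟶ M :=
  coneCounit (i := inHom r (RObj' r M)) (ε := inHom r M)
    (oddMap_hasDeg RPlaneTop'_hasDeg) (oddMap_d_zero (flat_plane _ _) (flat_plane _ _) _)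
    (oddMap_d_one (flat_plane _ _) (flat_plane _ _) _) oddMap_RPlaneTop'_d_two

/-- Here the plane `r` of `ℛ'ᵣ(M)` consists of `Mᵣ` and `∂₁∂₂ω ⊗ Mᵣ`, which `out` cancels, and of `ω
⊗ Mᵣ`, which is matched with `𝒰ᵣ(M)` by `in`. -/
theorem isIso_counitHom' : IsIso ((toStable k).map (counitHom' r M)) := by
  have hV := flat_plane r M
  have hW := flat_plane r (RObj' r M)
  refine isIso_coneCounit _ _ _ _ (oddMap (RPlaneUnit' r M)) (oddMap_hasDeg RPlaneUnit'_hasDeg)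
    (oddMap_anticomm hV hW RPlaneUnit'_d_two) inHom_oddMap_RPlaneUnit' ?_
    (oddMap (RPlaneInl' r M ∘ₗ RPlaneTop' r M)) ?_ (oddMap_d_zero hW hW _) (oddMap_d_one hW hW _)
    inHom_oddMap_RPlaneInl' oddMap_RPlaneInl'_contraction
    (contr2 _) (contr2_hasDeg _) (adTrace_contr2 hW)
  · intro z
    rw [oddMap_oddMap, RPlaneTop'_unit, RPlaneTop'_unit, RPlaneTop'_unit, RPlaneTop'_unit]
    rfl
  · exact oddMap_hasDeg fun n x hx => mem_gr_congr
      (RPlaneInl'_hasDeg _ _ (RPlaneTop'_hasDeg n x hx)) (by abel)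

end ConeCounit

end TriMod

namespace TriMod

variable {k : Type u} [Field k]

/-! ### The isomorphism `ℛᵣ ℛₛ ≅ ℛₛ ℛᵣ` for `|r - s| > 1` -/

section Swap

variable {M A B A' B' : TriMod.{v} k} {a : A ⟶ M} {b : B ⟶ M} {a' : A' ⟶ cone3 b}
  {b' : B' ⟶ cone3 a}

/-- The morphism `(x, y, m) ↦ (y, x, m)` between iterated `∂₃`-cones. -/
def cone3Swap (p : A' ⟶ A) (j : B ⟶ B') (hp : ∀ x, (a'.lin x : B × M) = (0, a.lin (p.lin x)))
    (hj : ∀ y, (b'.lin (j.lin y) : A × M) = (0, b.lin y)) : cone3 a' ⟶ cone3 b' where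
  lin := (j.lin ∘ₗ LinearMap.fst k B M ∘ₗ LinearMap.snd k A' (B × M)).prod
    ((p.lin ∘ₗ LinearMap.fst k A' (B × M)).prod (LinearMap.snd k B M ∘ₗ LinearMap.snd k A' (B × M)))
  map_gr n x hx := ⟨j.map_gr _ _ hx.2.1, p.map_gr _ _ hx.1, hx.2.2⟩
  map_d s x := by
    obtain ⟨x, y, m⟩ := x
    change ((j.lin ((cone3 a').d s ((x, (y, m)) : A' × (B × M)) : A' × (B × M)).2.1,
      (p.lin ((cone3 a').d s ((x, (y, m)) : A' × (B × M)) : A' × (B × M)).1,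
        ((cone3 a').d s ((x, (y, m)) : A' × (B × M)) : A' × (B × M)).2.2)) : B' × (A × M)) =
      (cone3 b').d s ((j.lin y, (p.lin x, m)) : B' × (A × M))
    by_cases hs : s = 2
    · subst hs
      rw [cone3_d_two, cone3_d_two, cone3_d_two, cone3_d_two, hp, hj]
      refine Prod.ext ?_ (Prod.ext ?_ ?_)
      · change j.lin (0 + -B.d 2 y) = -B'.d 2 (j.lin y)
        rw [zero_add, map_neg, j.map_d]
      · change p.lin (-A'.d 2 x) = 0 + -A.d 2 (p.lin x)
        rw [zero_add, map_neg, p.map_d]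
      · exact add_left_comm _ _ _
    · rw [cone3_d_of_ne _ hs, cone3_d_of_ne _ hs, cone3_d_of_ne _ hs, cone3_d_of_ne _ hs]
      refine Prod.ext ?_ (Prod.ext ?_ rfl)
      · change j.lin (-B.d s y) = -B'.d s (j.lin y)
        rw [map_neg, j.map_d]
      · change p.lin (-A'.d s x) = -A.d s (p.lin x)
        rw [map_neg, p.map_d]

end Swap

theorem isIso_of_lin_bijective {M N : TriMod.{v} k} (f : M ⟶ N)
    (hf : Function.Bijective f.lin) : IsIso f := by
  let e := LinearEquiv.ofBijective f.lin hf
  have he : ∀ y, f.lin (e.symm y) = y := e.apply_symm_apply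
  refine ⟨⟨e.symm.toLinearMap, fun n y hy => ?_, fun s y => ?_⟩, ?_, ?_⟩
  -- The inverse is graded because `f` commutes with the projections onto homogeneous pieces: the
  -- preimage and its degree `n` part have the same image.
  · have h : e.symm y = M.proj n (e.symm y) := by
      refine hf.1 (((he y).trans ?_).trans (hom_scale f _ _).symm)
      rw [he]
      exact (N.proj_of_mem hy).symm
    change e.symm y ∈ M.gr n
    rw [h]
    exact M.proj_mem n _
  · refine hf.1 ?_
    change f.lin (e.symm _) = f.lin (M.d s (e.symm y))
    rw [he, f.map_d, he]
  · exact TriMod.hom_ext fun x => e.symm_apply_apply x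
  · exact TriMod.hom_ext fun x => e.apply_symm_apply x

/-- The morphism `ℛᵣ(M) ⟶ ℛᵣ(N)` induced by a morphism `M ⟶ N`. -/
def RMap (r : ℤ) {M N : TriMod.{v} k} (f : M ⟶ N) : RObj r M ⟶ RObj r N := (R k r).map f

theorem RMap_apply (r : ℤ) {M N : TriMod.{v} k} (f : M ⟶ N) (x : ext2 (M.plane r) × M) :
    (RMap r f).lin x =
      (((ext2Map (planeHom r f)).lin x.1, f.lin x.2) : ext2 (N.plane r) × N) := rfl

/-- The morphism `ℛ'ᵣ(M) ⟶ ℛ'ᵣ(N)` induced by a morphism `M ⟶ N`. -/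
noncomputable def RMap' (r : ℤ) {M N : TriMod.{v} k} (f : M ⟶ N) : RObj' r M ⟶ RObj' r N :=
  (shiftFunctor k ![0, 0, 1]).map
    (show cone3 (outHom r M) ⟶ cone3 (outHom r N) from (cone3Functor (outTrans k r)).map f)

theorem RMap'_apply (r : ℤ) {M N : TriMod.{v} k} (f : M ⟶ N) (x : M × ext2 (M.plane r)) :
    (RMap' r f).lin x =
      ((f.lin x.1, (ext2Map (planeHom r f)).lin x.2) : N × ext2 (N.plane r)) := rfl

/-- The module `ℛᵣ(M)`, as an opaque object. -/
def RMod (r : ℤ) (M : TriMod.{v} k) : TriMod.{v} k := RObj r M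

/-- The module `ℛ'ᵣ(M)`, as an opaque object. -/
noncomputable def RMod' (r : ℤ) (M : TriMod.{v} k) : TriMod.{v} k := RObj' r M

/-- The morphism `ℛᵣ(M) ⟶ ℛᵣ(N)` induced by a morphism `M ⟶ N`. -/
def RModMap (r : ℤ) {M N : TriMod.{v} k} (f : M ⟶ N) : RMod r M ⟶ RMod r N := RMap r f

/-- The morphism `ℛ'ᵣ(M) ⟶ ℛ'ᵣ(N)` induced by a morphism `M ⟶ N`. -/
noncomputable def RModMap' (r : ℤ) {M N : TriMod.{v} k} (f : M ⟶ N) : RMod' r M ⟶ RMod' r N :=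
  RMap' r f

/-- The functor `ℛᵣ`, in terms of `RMod`. -/
def RFunctor (k : Type u) [Field k] (r : ℤ) : TriMod.{v} k ⥤ TriMod.{v} k where
  obj M := RMod r M
  map f := RModMap r f
  map_id M := (R k r).map_id M
  map_comp f g := (R k r).map_comp f g

theorem R_eq_RFunctor (r : ℤ) : R.{v} k r = RFunctor k r := rfl

/-- The functor `ℛ'ᵣ`, in terms of `RMod'`. -/
noncomputable def RFunctor' (k : Type u) [Field k] (r : ℤ) : TriMod.{v} k ⥤ TriMod.{v} k where
  obj M := RMod' r M
  map f := RModMap' r f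
  map_id _ := TriMod.hom_ext fun _ => rfl
  map_comp _ _ := TriMod.hom_ext fun _ => rfl

theorem R'_eq_RFunctor' (r : ℤ) : R'.{v} k r = RFunctor' k r := rfl

section Commute

variable {r s : ℤ} {M : TriMod.{v} k}

/-- The module `Q ⊗ Mₛ` is supported in the planes `s - 1`, `s` and `s + 1`, none of which is the
plane `r`. -/
theorem RPlane_fst_eq_zero (hrs : 1 < |r - s|) (w : (RObj s M).planeSub r) :
    (w : ext2 (M.plane s) × M).1 = 0 := by
  have h := mem_planeSub_ext2.1 (mem_planeSub_cone3.1 w.2).1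
  have h1 : s ≠ r ∧ s ≠ r + 1 ∧ s ≠ r - 1 := by
    rcases lt_abs.1 hrs with h | h <;> omega
  exact Prod.ext (Prod.ext (eq_zero_of_mem_planeSub_plane h1.1 h.1.1)
    (eq_zero_of_mem_planeSub_plane h1.2.1 h.1.2))
    (Prod.ext (eq_zero_of_mem_planeSub_plane h1.2.2 h.2.1)
      (eq_zero_of_mem_planeSub_plane h1.1 h.2.2))

variable (M) in
/-- The projection `ℛₛ(M)_{i-j=r} ⟶ M_{i-j=r}`, for `|r - s| > 1`. -/
def RPlaneProj (hrs : 1 < |r - s|) : (RObj s M).plane r ⟶ M.plane r where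
  lin := (LinearMap.snd k (ext2 (M.plane s)) M).restrict fun _ hx => (mem_planeSub_cone3.1 hx).2
  map_gr _ _ hx := hx.2
  map_d q w := by
    by_cases hq : q = 2
    · subst hq
      refine Subtype.ext ?_
      have h := RPlane_fst_eq_zero hrs w
      change (((RObj s M).d 2 ((w : (RObj s M).planeSub r) : ext2 (M.plane s) × M)) :
        ext2 (M.plane s) × M).2 = M.d 2 ((w : (RObj s M).planeSub r) : ext2 (M.plane s) × M).2
      rw [cone3_d_two, h]
      exact (congrArg (· + _) (map_zero (inHom s M).lin)).trans (zero_add _)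
    · rw [plane_d_of_ne hq, plane_d_of_ne hq, map_zero]

theorem planeHom_RPlaneProj (hrs : 1 < |r - s|) (w : (RObj s M).plane r) :
    (planeHom r (cone3Inr (inHom s M))).lin ((RPlaneProj M hrs).lin w) = w :=
  Subtype.ext (Prod.ext (RPlane_fst_eq_zero hrs w).symm rfl)

theorem ext2Map_RPlaneProj (hrs : 1 < |r - s|) (x : ext2 ((RObj s M).plane r)) :
    (ext2Map (planeHom r (cone3Inr (inHom s M)))).lin ((ext2Map (RPlaneProj M hrs)).lin x) = x := by
  rw [ext2Map_apply, ext2Map_apply]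
  exact Prod.ext (Prod.ext (planeHom_RPlaneProj hrs _) (planeHom_RPlaneProj hrs _))
    (Prod.ext (planeHom_RPlaneProj hrs _) (planeHom_RPlaneProj hrs _))

/-- The plane `r` of `ℛₛ(M)` comes entirely from `M`, so `in` has no component in `𝒰ₛ(M)`. Without
that component the two attaching maps are independent, and their order is immaterial. -/
theorem inHom_RPlaneProj (hrs : 1 < |r - s|) (x : ext2 ((RObj s M).plane r)) :
    ((inHom r (RObj s M)).lin x : ext2 (M.plane s) × M) =
      (0, (inHom r M).lin ((ext2Map (RPlaneProj M hrs)).lin x)) := by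
  have e := (ext2Map_RPlaneProj hrs x).symm
  nth_rw 1 [e]
  exact inHom_naturality (cone3Inr (inHom s M)) _

variable (M) in
/-- The morphism `ℛᵣ ℛₛ (M) ⟶ ℛₛ ℛᵣ (M)`, for `|r - s| > 1`. -/
def commHom (hrs : 1 < |r - s|) : RObj r (RObj s M) ⟶ RObj s (RObj r M) :=
  cone3Swap (ext2Map (RPlaneProj M hrs)) (ext2Map (planeHom s (cone3Inr (inHom r M))))
    (inHom_RPlaneProj hrs) fun _ => inHom_naturality (cone3Inr (inHom r M)) _

theorem commHom_apply (hrs : 1 < |r - s|)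
    (x : ext2 ((RObj s M).plane r) × (ext2 (M.plane s) × M)) :
    (commHom M hrs).lin x = (((ext2Map (planeHom s (cone3Inr (inHom r M)))).lin x.2.1,
      ((ext2Map (RPlaneProj M hrs)).lin x.1, x.2.2)) :
        ext2 ((RObj r M).plane s) × (ext2 (M.plane r) × M)) := rfl

theorem commHom_naturality (hrs : 1 < |r - s|) {N : TriMod.{v} k} (f : M ⟶ N) :
    RMap r (RMap s f) ≫ commHom N hrs = commHom M hrs ≫ RMap s (RMap r f) := by
  have e : ∀ y : M.plane s,
      (planeHom s (cone3Inr (inHom r N))).lin ((planeHom s f).lin y) =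
        (planeHom s (RMap r f)).lin ((planeHom s (cone3Inr (inHom r M))).lin y) := fun y =>
    Subtype.ext (Prod.ext (map_zero (ext2Map (planeHom r f)).lin).symm rfl)
  refine TriMod.hom_ext fun x => ?_
  rw [comp_lin, comp_lin, LinearMap.comp_apply, LinearMap.comp_apply, RMap_apply, RMap_apply,
    commHom_apply, commHom_apply, RMap_apply, RMap_apply, ext2Map_apply, ext2Map_apply,
    ext2Map_apply (planeHom s (cone3Inr (inHom r M))), ext2Map_apply (planeHom s (RMap r f))]
  refine Prod.ext (Prod.ext (Prod.ext (e _) (e _)) (Prod.ext (e _) (e _))) rfl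

/-- The same construction with `r` and `s` exchanged is inverse to it, so no passage to the stable
category is needed here. -/
theorem isIso_commHom (hrs : 1 < |r - s|) : IsIso (commHom M hrs) := by
  have hsr : 1 < |s - r| := by rwa [abs_sub_comm]
  refine isIso_of_lin_bijective _ (Function.bijective_iff_has_inverse.2
    ⟨(commHom M hsr).lin, fun x => ?_, fun x => ?_⟩)
  · rw [commHom_apply, commHom_apply]
    exact Prod.ext (ext2Map_RPlaneProj hrs x.1) rfl
  · rw [commHom_apply, commHom_apply]
    exact Prod.ext (ext2Map_RPlaneProj hsr x.1) rfl

end Commute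

/-! ### Naturality of the two counits. -/

section CounitNaturality

variable {r : ℤ} {M N : TriMod.{v} k} (f : M ⟶ N)

theorem oddMap_ext2Map {V W V' W' : TriMod.{v} k} {h : V →ₗ[k] W} {h' : V' →ₗ[k] W'} {g : V ⟶ V'}
    {g' : W ⟶ W'} (e : ∀ y, h' (g.lin y) = g'.lin (h y)) (x : ext2 V) :
    oddMap h' ((ext2Map g).lin x) = (ext2Map g').lin (oddMap h x) := by
  rw [oddMap_apply, oddMap_apply, ext2Map_apply, ext2Map_apply, e, e, e, e, map_neg, map_neg]

theorem counitHom_naturality : RMap' r (RMap r f) ≫ counitHom r N = counitHom r M ≫ f := by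
  refine TriMod.hom_ext fun x => ?_
  rw [comp_lin, comp_lin, LinearMap.comp_apply, LinearMap.comp_apply, RMap'_apply, counitHom,
    counitHom, coconeCounit_apply, coconeCounit_apply, map_add, ← inHom_naturality,
    ← oddMap_ext2Map fun y => ?_]
  · rfl
  · exact (hom_sign (planeHom r f) _).symm

theorem counitHom'_naturality : RMap r (RMap' r f) ≫ counitHom' r N = counitHom' r M ≫ f := by
  refine TriMod.hom_ext fun x => ?_
  rw [comp_lin, comp_lin, LinearMap.comp_apply, LinearMap.comp_apply, RMap_apply, counitHom',
    counitHom', coneCounit_apply, coneCounit_apply, map_sub, ← inHom_naturality,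
    ← oddMap_ext2Map fun y => ?_]
  · rfl
  · exact (hom_sign (planeHom r f) _).symm

end CounitNaturality

/-! ### The resulting transformations of functors, stably invertible at every object. -/

section Transformations

/-- The morphism `ℛ'ᵣ ℛᵣ (M) ⟶ M`. -/
noncomputable def counitMod (r : ℤ) (M : TriMod.{v} k) : RMod' r (RMod r M) ⟶ M := by
  delta RMod' RMod
  exact counitHom r M

/-- The morphism `ℛᵣ ℛ'ᵣ (M) ⟶ M`. -/
noncomputable def counitMod' (r : ℤ) (M : TriMod.{v} k) : RMod r (RMod' r M) ⟶ M := by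
  delta RMod RMod'
  exact counitHom' r M

/-- The morphism `ℛᵣ ℛₛ (M) ⟶ ℛₛ ℛᵣ (M)`, for `|r - s| > 1`. -/
def commMod {r s : ℤ} (hrs : 1 < |r - s|) (M : TriMod.{v} k) :
    RMod r (RMod s M) ⟶ RMod s (RMod r M) := by
  delta RMod
  exact commHom M hrs

theorem counitMod_naturality (r : ℤ) {M N : TriMod.{v} k} (f : M ⟶ N) :
    RModMap' r (RModMap r f) ≫ counitMod r N = counitMod r M ≫ f := by
  delta counitMod RModMap' RModMap RMod' RMod
  exact counitHom_naturality f

theorem counitMod'_naturality (r : ℤ) {M N : TriMod.{v} k} (f : M ⟶ N) :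
    RModMap r (RModMap' r f) ≫ counitMod' r N = counitMod' r M ≫ f := by
  delta counitMod' RModMap' RModMap RMod' RMod
  exact counitHom'_naturality f

theorem commMod_naturality {r s : ℤ} (hrs : 1 < |r - s|) {M N : TriMod.{v} k} (f : M ⟶ N) :
    RModMap r (RModMap s f) ≫ commMod hrs N = commMod hrs M ≫ RModMap s (RModMap r f) := by
  delta commMod RModMap RMod
  exact commHom_naturality hrs f

theorem isIso_counitMod (r : ℤ) (M : TriMod.{v} k) :
    IsIso ((toStable k).map (counitMod r M)) := by
  delta counitMod RMod' RMod
  exact isIso_counitHom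

theorem isIso_counitMod' (r : ℤ) (M : TriMod.{v} k) :
    IsIso ((toStable k).map (counitMod' r M)) := by
  delta counitMod' RMod RMod'
  exact isIso_counitHom'

theorem isIso_commMod {r s : ℤ} (hrs : 1 < |r - s|) (M : TriMod.{v} k) :
    IsIso ((toStable k).map (commMod hrs M)) := by
  have h : IsIso (commMod hrs M) := by
    delta commMod RMod
    exact isIso_commHom hrs
  infer_instance

attribute [local irreducible] RMod RMod'

/-- The transformation `ℛ'ᵣ ℛᵣ ⟶ Id`. -/
noncomputable def counitTrans (k : Type u) [Field k] (r : ℤ) :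
    RFunctor.{v} k r ⋙ RFunctor' k r ⟶ 𝟭 (TriMod.{v} k) where
  app M := counitMod r M
  naturality _ _ f := counitMod_naturality r f

/-- The transformation `ℛᵣ ℛ'ᵣ ⟶ Id`. -/
noncomputable def counitTrans' (k : Type u) [Field k] (r : ℤ) :
    RFunctor'.{v} k r ⋙ RFunctor k r ⟶ 𝟭 (TriMod.{v} k) where
  app M := counitMod' r M
  naturality _ _ f := counitMod'_naturality r f

/-- The transformation `ℛᵣ ℛₛ ⟶ ℛₛ ℛᵣ`, for `|r - s| > 1`. -/
def commTrans (k : Type u) [Field k] {r s : ℤ} (hrs : 1 < |r - s|) :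
    RFunctor.{v} k s ⋙ RFunctor k r ⟶ RFunctor k r ⋙ RFunctor k s where
  app M := commMod hrs M
  naturality _ _ f := commMod_naturality hrs f

theorem isIso_counitTrans (r : ℤ) (M : TriMod.{v} k) :
    IsIso ((toStable k).map ((counitTrans k r).app M)) := isIso_counitMod r M

theorem isIso_counitTrans' (r : ℤ) (M : TriMod.{v} k) :
    IsIso ((toStable k).map ((counitTrans' k r).app M)) := isIso_counitMod' r M

theorem isIso_commTrans {r s : ℤ} (hrs : 1 < |r - s|) (M : TriMod.{v} k) :
    IsIso ((toStable k).map ((commTrans k hrs).app M)) := isIso_commMod hrs M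

end Transformations

end TriMod

namespace TriMod

variable {k : Type u} [Field k]

/-! ### Deformation retractions of the source of a `∂₃`-cone -/

section ConeRetract

variable {E E' N : TriMod.{v} k} {f : E ⟶ N} {J : E' ⟶ E} {G : E ⟶ E'} {H : E →ₗ[k] E}

/-- The morphism `(e, n) ↦ (G e, n + f (H e))` between `∂₃`-cones induced by a homotopy `H` from
`J ∘ G` to the identity. -/
def coneRetract (hH : IsHomotopy H)
    (hJG : ∀ e, e - J.lin (G.lin e) = E.d 2 (H e) + H (E.d 2 e)) : cone3 f ⟶ cone3 (J ≫ f) where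
  lin := (G.lin ∘ₗ LinearMap.fst k E N).prod
    (LinearMap.snd k E N + f.lin ∘ₗ H ∘ₗ LinearMap.fst k E N)
  map_gr n x hx := ⟨G.map_gr _ _ hx.1, Submodule.add_mem _ hx.2
    (mem_gr_congr (f.map_gr _ _ (hH.deg _ _ hx.1)) (by abel))⟩
  map_d s x := by
    obtain ⟨e, n⟩ := x
    change ((G.lin ((cone3 f).d s ((e, n) : E × N) : E × N).1,
      ((cone3 f).d s ((e, n) : E × N) : E × N).2 +
        f.lin (H ((cone3 f).d s ((e, n) : E × N) : E × N).1)) : E' × N) =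
      (cone3 (J ≫ f)).d s ((G.lin e, n + f.lin (H e)) : E' × N)
    have h2 : ∀ e, H (E.d 2 e) = e - J.lin (G.lin e) - E.d 2 (H e) := fun e =>
      eq_sub_of_add_eq' (hJG e).symm
    fin_cases s
    · refine Eq.trans ?_ (cone3_d_zero (J ≫ f) _).symm
      refine (congrArg (fun y : E × N => ((G.lin y.1, y.2 + f.lin (H y.1)) : E' × N))
        (cone3_d_zero f (e, n))).trans ?_
      simp [hH.d_zero, G.map_d, f.map_d]
    · refine Eq.trans ?_ (cone3_d_one (J ≫ f) _).symm
      refine (congrArg (fun y : E × N => ((G.lin y.1, y.2 + f.lin (H y.1)) : E' × N))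
        (cone3_d_one f (e, n))).trans ?_
      simp [hH.d_one, G.map_d, f.map_d]
    · refine Eq.trans ?_ (cone3_d_two (J ≫ f) _).symm
      refine (congrArg (fun y : E × N => ((G.lin y.1, y.2 + f.lin (H y.1)) : E' × N))
        (cone3_d_two f (e, n))).trans ?_
      simp [h2, G.map_d, f.map_d]
      abel

/-- The section is `J` on the source and the identity on `N`. The homotopy on the cone is `-H`,
since the source carries `-∂₃`; its values stay in `E`, so `K` is needed only there. -/
theorem isIso_coneRetract (hH : IsHomotopy H)
    (hJG : ∀ e, e - J.lin (G.lin e) = E.d 2 (H e) + H (E.d 2 e))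
    (hGJ : ∀ y, G.lin (J.lin y) = y) (hHJ : ∀ y, H (J.lin y) = 0)
    (K : E →ₗ[k] E) (hK : HasDeg (-Pi.single 0 1 - Pi.single 1 1) K)
    (hK' : ∀ x, adTrace K x = x) :
    IsIso ((toStable k).map (coneRetract (f := f) hH hJG)) := by
  let s : cone3 (J ≫ f) ⟶ cone3 f :=
    { lin := J.lin.prodMap LinearMap.id
      map_gr := fun n x hx => ⟨J.map_gr _ _ hx.1, hx.2⟩
      map_d := fun s x => by
        obtain ⟨y, n⟩ := x
        by_cases hs : s = 2
        · subst hs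
          refine (congrArg (fun y : E' × N => ((J.lin y.1, y.2) : E × N))
            (cone3_d_two (J ≫ f) (y, n))).trans (Eq.trans ?_ (cone3_d_two f _).symm)
          simp [J.map_d]
        · refine (congrArg (fun y : E' × N => ((J.lin y.1, y.2) : E × N))
            (cone3_d_of_ne (J ≫ f) hs (y, n))).trans (Eq.trans ?_ (cone3_d_of_ne f hs _).symm)
          simp [J.map_d] }
  let H' : cone3 f →ₗ[k] cone3 f := (-H).prodMap (0 : N →ₗ[k] N)
  let K2 : cone3 f →ₗ[k] cone3 f := K.prodMap (0 : N →ₗ[k] N)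
  have hH' : ∀ x : E × N, H' x = ((-H x.1, 0) : E × N) := fun _ => rfl
  have hK2 : ∀ x : E × N, K2 x = ((K x.1, 0) : E × N) := fun _ => rfl
  refine isIso_of_retraction (s := s) ?_ (H := H') ⟨?_, ?_, ?_⟩ K2 ?_ ?_ ?_
  · refine TriMod.hom_ext fun x => ?_
    change ((G.lin (J.lin x.1), x.2 + f.lin (H (J.lin x.1))) : E' × N) = x
    rw [hGJ, hHJ, map_zero, add_zero]
  · intro n x hx
    exact ⟨Submodule.neg_mem _ (mem_gr_congr (hH.deg _ _ hx.1) (by abel)), Submodule.zero_mem _⟩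
  · intro x
    rw [cone3_d_zero, hH', hH', cone3_d_zero]
    simp [hH.d_zero]
  · intro x
    rw [cone3_d_one, hH', hH', cone3_d_one]
    simp [hH.d_one]
  · intro n x hx
    exact ⟨mem_gr_congr (hK _ _ hx.1) (by abel), Submodule.zero_mem _⟩
  · intro x
    have e1 := hK' (-H x.1)
    have h0 : ⇑((cone3 f).d 0) = fun x : E × N => ((-E.d 0 x.1, N.d 0 x.2) : E × N) :=
      funext fun x => by rw [cone3_d_zero]
    have h1 : ⇑((cone3 f).d 1) = fun x : E × N => ((-E.d 1 x.1, N.d 1 x.2) : E × N) :=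
      funext fun x => by rw [cone3_d_one]
    rw [adTrace] at e1 ⊢
    rw [h0, h1, hH']
    simp only [hK2]
    refine Prod.ext ?_ ?_
    · refine Eq.trans ?_ e1
      simp only [Prod.fst_add, Prod.fst_sub, map_neg, map_sub, neg_neg, neg_sub]
      abel
    · simp
  · intro x
    obtain ⟨e, n⟩ := x
    rw [cone3_d_two, hH', hH', cone3_d_two]
    change ((e, n) : E × N) - ((J.lin (G.lin e), n + f.lin (H e)) : E × N) = _
    refine Prod.ext ?_ ?_
    · refine (hJG e).trans ?_
      simp
    · simp

end ConeRetract

/-! ### Generators of `Q ⊗ V` -/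

section Gen

variable {V W : TriMod.{v} k}

variable (V) in
/-- The map `v ↦ ω ⊗ v`. -/
def omega : V →ₗ[k] ext2 V := LinearMap.inl k (V × V) (V × V) ∘ₗ LinearMap.inl k V V

theorem omega_apply (x : V) : omega V x = ((x, 0), (0, 0)) := rfl

theorem omega_hasDeg (V : TriMod.{v} k) : HasDeg 0 (omega V) := fun n x hx =>
  ⟨⟨mem_gr_congr hx (by abel), Submodule.zero_mem _⟩,
    ⟨Submodule.zero_mem _, Submodule.zero_mem _⟩⟩

theorem omega_d_two (x : V) : (ext2 V).d 2 (omega V x) = omega V (V.d 2 x) := by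
  rw [ext2_d_two, omega_apply, omega_apply]
  simp

/-- A linear map out of `Q ⊗ V` that commutes with `∂₁` and `∂₂` is determined by its values on
`ω ⊗ V`. -/
theorem ext2_lin_ext (hV : Flat V) {X : TriMod.{v} k} {φ ψ : ext2 V →ₗ[k] X}
    (hφ0 : ∀ x, φ ((ext2 V).d 0 x) = X.d 0 (φ x)) (hφ1 : ∀ x, φ ((ext2 V).d 1 x) = X.d 1 (φ x))
    (hψ0 : ∀ x, ψ ((ext2 V).d 0 x) = X.d 0 (ψ x)) (hψ1 : ∀ x, ψ ((ext2 V).d 1 x) = X.d 1 (ψ x))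
    (h : ∀ y, φ (omega V y) = ψ (omega V y)) (x : ext2 V) : φ x = ψ x := by
  have e : x = omega V x.1.1 + (ext2 V).d 1 (omega V x.1.2) + (ext2 V).d 0 (omega V x.2.1) +
      (ext2 V).d 0 ((ext2 V).d 1 (omega V x.2.2)) := by
    rw [ext2_d_one hV, ext2_d_one hV, ext2_d_zero hV, ext2_d_zero hV]
    refine Prod.ext (Prod.ext ?_ ?_) (Prod.ext ?_ ?_) <;> simp [omega]
  rw [e]
  rw [map_add, map_add, map_add, map_add, map_add, map_add, hφ0, hφ0, hφ1, hφ1, hψ0, hψ0, hψ1,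
    hψ1, h, h, h, h]

/-- The map `q ⊗ v ↦ q ⊗ h(v)` from `Q ⊗ V` to `Q ⊗ W`. -/
def evenMap (h : V →ₗ[k] W) : ext2 V →ₗ[k] ext2 W := (h.prodMap h).prodMap (h.prodMap h)

theorem evenMap_apply (h : V →ₗ[k] W) (x : ext2 V) :
    evenMap h x = ((h x.1.1, h x.1.2), (h x.2.1, h x.2.2)) := rfl

theorem evenMap_hasDeg {h : V →ₗ[k] W} {a : Fin 3 → ℤ} (hh : HasDeg a h) :
    HasDeg (M := ext2 V) (N := ext2 W) a (evenMap h) := fun _ _ hx =>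
  ⟨⟨hh _ _ hx.1.1, mem_gr_congr (hh _ _ hx.1.2) (by abel)⟩,
    ⟨mem_gr_congr (hh _ _ hx.2.1) (by abel), mem_gr_congr (hh _ _ hx.2.2) (by abel)⟩⟩

theorem evenMap_d_zero (hV : Flat V) (hW : Flat W) (h : V →ₗ[k] W) (x : ext2 V) :
    evenMap h ((ext2 V).d 0 x) = (ext2 W).d 0 (evenMap h x) := by
  rw [ext2_d_zero hV, ext2_d_zero hW, evenMap_apply, evenMap_apply]
  simp

theorem evenMap_d_one (hV : Flat V) (hW : Flat W) (h : V →ₗ[k] W) (x : ext2 V) :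
    evenMap h ((ext2 V).d 1 x) = (ext2 W).d 1 (evenMap h x) := by
  rw [ext2_d_one hV, ext2_d_one hW, evenMap_apply, evenMap_apply]
  simp

theorem evenMap_d_of_ne (hV : Flat V) (hW : Flat W) (h : V →ₗ[k] W) {s : Fin 3} (hs : s ≠ 2)
    (x : ext2 V) : evenMap h ((ext2 V).d s x) = (ext2 W).d s (evenMap h x) := by
  fin_cases s
  · exact evenMap_d_zero hV hW h x
  · exact evenMap_d_one hV hW h x
  · exact absurd rfl hs

/-- The supercommutator of `∂₃` with an even map. -/
theorem evenMap_d_two {h : V →ₗ[k] W} {c : V →ₗ[k] W}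
    (hh : ∀ x, h (V.d 2 x) = W.d 2 (h x) + c x) (x : ext2 V) :
    evenMap h ((ext2 V).d 2 x) = (ext2 W).d 2 (evenMap h x) + oddMap c x := by
  rw [ext2_d_two, ext2_d_two, evenMap_apply, evenMap_apply, oddMap_apply]
  simp only [map_neg, hh]
  refine Prod.ext (Prod.ext rfl ?_) (Prod.ext ?_ rfl)
  · exact neg_add _ _
  · exact neg_add _ _

end Gen

/-! ### The planes `i - j = r` and `i - j = r ± 1` -/

/-- The operator `∂ₐ` maps the plane `i - j = r` to the plane `i - j = t`, and `∂_b` maps it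
back. -/
structure Dir (a b : Fin 3) (r t : ℤ) : Prop where
  cases : (a = 0 ∧ b = 1 ∧ t = r + 1) ∨ (a = 1 ∧ b = 0 ∧ t = r - 1)

section Dir

variable {a b : Fin 3} {r t : ℤ} {M : TriMod.{v} k}

/-- The constructions for `(a, b, r, t)` apply equally to `(b, a, t, r)`; this is how both sides of
the braid relation are treated at once. -/
theorem Dir.symm (hd : Dir a b r t) : Dir b a t r := by
  rcases hd.cases with ⟨rfl, rfl, rfl⟩ | ⟨rfl, rfl, rfl⟩
  · exact ⟨Or.inr ⟨rfl, rfl, by omega⟩⟩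
  · exact ⟨Or.inl ⟨rfl, rfl, by omega⟩⟩

theorem Dir.ne_two (hd : Dir a b r t) : a ≠ 2 := by
  rcases hd.cases with ⟨rfl, rfl, rfl⟩ | ⟨rfl, rfl, rfl⟩ <;> decide

theorem Dir.d_mem_planeSub (hd : Dir a b r t) {x : M} (hx : x ∈ M.planeSub r) :
    M.d a x ∈ M.planeSub t := by
  rcases hd.cases with ⟨rfl, rfl, rfl⟩ | ⟨rfl, rfl, rfl⟩
  · exact d_zero_mem_planeSub hx
  · exact d_one_mem_planeSub hx

variable (M) in
/-- The operator `∂ₐ` from `M_{i-j=r}` to `M_{i-j=t}`. -/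
def planeD (hd : Dir a b r t) : M.plane r →ₗ[k] M.plane t :=
  (M.d a).restrict fun _ hx => hd.d_mem_planeSub hx

theorem planeD_hasDeg (hd : Dir a b r t) : HasDeg (Pi.single a 1) (planeD M hd) :=
  fun n _ hx => M.d_mem a n _ hx

theorem planeD_d_two (hd : Dir a b r t) (x : M.plane r) :
    planeD M hd ((M.plane r).d 2 x) = -(M.plane t).d 2 (planeD M hd x) :=
  Subtype.ext (M.d_anticomm a 2 _ hd.ne_two)

variable (a) in
/-- The map `v ↦ ∂ₐω ⊗ v`. -/
def gen (V : TriMod.{v} k) : V →ₗ[k] ext2 V := (ext2 V).d a ∘ₗ omega V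

theorem gen_apply {V : TriMod.{v} k} (x : V) : gen a V x = (ext2 V).d a (omega V x) := rfl

theorem gen_hasDeg (V : TriMod.{v} k) : HasDeg (Pi.single a 1) (gen a V) := fun n x hx =>
  (ext2 V).d_mem a n _ (mem_gr_congr (omega_hasDeg V n x hx) (add_zero n))

theorem gen_d_two (ha : a ≠ 2) {V : TriMod.{v} k} (x : V) :
    (ext2 V).d 2 (gen a V x) = -gen a V (V.d 2 x) := by
  rw [gen_apply, (ext2 V).d_anticomm 2 a _ ha.symm, omega_d_two]
  rfl

variable (a) in
/-- The coefficient of `∂ₐω`. -/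
def coeffGen (V : TriMod.{v} k) : ext2 V →ₗ[k] V :=
  if a = 0 then LinearMap.fst k V V ∘ₗ LinearMap.snd k (V × V) (V × V)
  else LinearMap.snd k V V ∘ₗ LinearMap.fst k (V × V) (V × V)

variable (a) in
/-- The coefficient of `∂_b∂ₐω`, for `{a, b} = {1, 2}`. -/
def coeffTop (V : TriMod.{v} k) : ext2 V →ₗ[k] V :=
  if a = 0 then -(LinearMap.snd k V V ∘ₗ LinearMap.snd k (V × V) (V × V))
  else LinearMap.snd k V V ∘ₗ LinearMap.snd k (V × V) (V × V)

variable {V : TriMod.{v} k}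

theorem coeffGen_hasDeg (hd : Dir a b r t) : HasDeg (-Pi.single a 1) (coeffGen a V) := by
  rcases hd.cases with ⟨rfl, rfl, rfl⟩ | ⟨rfl, rfl, rfl⟩
  · exact fun n x hx => mem_gr_congr hx.2.1 (by abel)
  · exact fun n x hx => mem_gr_congr hx.1.2 (by abel)

theorem coeffTop_hasDeg (hd : Dir a b r t) :
    HasDeg (-Pi.single a 1 - Pi.single b 1) (coeffTop a V) := by
  rcases hd.cases with ⟨rfl, rfl, rfl⟩ | ⟨rfl, rfl, rfl⟩
  · exact fun n x hx => Submodule.neg_mem _ (mem_gr_congr hx.2.2 (by abel))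
  · exact fun n x hx => mem_gr_congr hx.2.2 (by abel)

theorem coeffGen_gen (hd : Dir a b r t) (hV : Flat V) (v : V) :
    coeffGen a V (gen a V v) = v := by
  rcases hd.cases with ⟨rfl, rfl, rfl⟩ | ⟨rfl, rfl, rfl⟩
  · rw [gen_apply, ext2_d_zero hV]; rfl
  · rw [gen_apply, ext2_d_one hV]; rfl

theorem coeffTop_omega (hd : Dir a b r t) (v : V) : coeffTop a V (omega V v) = 0 := by
  rcases hd.cases with ⟨rfl, rfl, rfl⟩ | ⟨rfl, rfl, rfl⟩
  · exact neg_zero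
  · rfl

theorem coeffTop_d_gen (hd : Dir a b r t) (hV : Flat V) (v : V) :
    coeffTop a V ((ext2 V).d b (gen a V v)) = v := by
  rcases hd.cases with ⟨rfl, rfl, rfl⟩ | ⟨rfl, rfl, rfl⟩
  · rw [gen_apply, ext2_d_zero hV, ext2_d_one hV]; exact neg_neg v
  · rw [gen_apply, ext2_d_one hV, ext2_d_zero hV]; rfl

theorem coeffGen_d_two (hd : Dir a b r t) (x : ext2 V) :
    coeffGen a V ((ext2 V).d 2 x) = -V.d 2 (coeffGen a V x) := by
  rw [ext2_d_two]
  rcases hd.cases with ⟨rfl, rfl, rfl⟩ | ⟨rfl, rfl, rfl⟩ <;> rfl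

theorem coeffTop_d_two (hd : Dir a b r t) (x : ext2 V) :
    coeffTop a V ((ext2 V).d 2 x) = V.d 2 (coeffTop a V x) := by
  rw [ext2_d_two]
  rcases hd.cases with ⟨rfl, rfl, rfl⟩ | ⟨rfl, rfl, rfl⟩
  · exact (map_neg (V.d 2) _).symm
  · rfl

/-- Of the four generators of `Q` only `∂ₐω` carries the plane `r` to the plane `t`. -/
theorem eq_gen_of_mem_planeSub (hd : Dir a b r t) {x : ext2 (M.plane r)}
    (hx : x ∈ (ext2 (M.plane r)).planeSub t) : x = gen a _ (coeffGen a _ x) := by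
  have h := mem_planeSub_ext2.1 hx
  have hV := flat_plane r M
  rcases hd.cases with ⟨rfl, rfl, rfl⟩ | ⟨rfl, rfl, rfl⟩
  · rw [gen_apply, ext2_d_zero hV]
    exact Prod.ext (Prod.ext (eq_zero_of_mem_planeSub_plane (by omega) h.1.1)
      (eq_zero_of_mem_planeSub_plane (by omega) h.1.2))
      (Prod.ext rfl (eq_zero_of_mem_planeSub_plane (by omega) h.2.2))
  · rw [gen_apply, ext2_d_one hV]
    exact Prod.ext (Prod.ext (eq_zero_of_mem_planeSub_plane (by omega) h.1.1) rfl)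
      (Prod.ext ((eq_zero_of_mem_planeSub_plane (by omega) h.2.1).trans rfl)
        ((eq_zero_of_mem_planeSub_plane (by omega) h.2.2).trans neg_zero.symm))

/-- Only `ω` and `∂_b∂ₐω` keep the plane `r` fixed. Writing the second through `∂ₐω` treats both
orientations uniformly. -/
theorem eq_omega_add_of_mem_planeSub (hd : Dir a b r t) {x : ext2 (M.plane r)}
    (hx : x ∈ (ext2 (M.plane r)).planeSub r) :
    x = omega _ x.1.1 + (ext2 (M.plane r)).d b (gen a _ (coeffTop a _ x)) := by
  have h := mem_planeSub_ext2.1 hx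
  have hV := flat_plane r M
  have h1 := eq_zero_of_mem_planeSub_plane (by omega) h.1.2
  have h2 := eq_zero_of_mem_planeSub_plane (by omega) h.2.1
  rcases hd.cases with ⟨rfl, rfl, rfl⟩ | ⟨rfl, rfl, rfl⟩
  · rw [gen_apply, ext2_d_zero hV, ext2_d_one hV]
    exact Prod.ext (Prod.ext (add_zero _).symm (h1.trans (add_zero _).symm))
      (Prod.ext (h2.trans (add_zero _).symm) (((zero_add _).trans (neg_neg _)).symm))
  · rw [gen_apply, ext2_d_one hV, ext2_d_zero hV]
    exact Prod.ext (Prod.ext (add_zero _).symm (h1.trans (add_zero _).symm))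
      (Prod.ext (h2.trans (add_zero _).symm) (zero_add _).symm)

theorem gen_mem_planeSub (hd : Dir a b r t) (v : M.plane r) :
    gen a (M.plane r) v ∈ (ext2 (M.plane r)).planeSub t := by
  refine (gen_hasDeg (a := a) (M.plane r)).mem_planeSub ?_ v (mem_planeSub_plane v)
  rcases hd.cases with ⟨rfl, rfl, rfl⟩ | ⟨rfl, rfl, rfl⟩
  · simp
  · simp; rfl

theorem inHom_omega (v : M.plane r) : (inHom r M).lin (omega _ v) = ((v : M.planeSub r) : M) := by
  refine (inHom_apply _).trans ?_
  change (v : M.planeSub r).1 + M.d 1 0 + M.d 0 0 + M.d 0 (M.d 1 0) = _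
  simp only [map_zero, add_zero]

theorem inHom_gen (v : M.plane r) :
    (inHom r M).lin (gen a _ v) = M.d a ((v : M.planeSub r) : M) := by
  rw [gen_apply, (inHom r M).map_d, inHom_omega]

/-! ### The plane `i - j = t` of `ℛᵣ(M)` -/

variable (M) in
/-- The map `v ↦ (∂ₐω ⊗ v, 0)` from `M_{i-j=r}` to `ℛᵣ(M)_{i-j=t}`. -/
def planeGen (hd : Dir a b r t) : M.plane r →ₗ[k] (RObj r M).plane t :=
  (LinearMap.inl k (ext2 (M.plane r)) M ∘ₗ gen a (M.plane r)).codRestrict _ fun v =>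
    mem_planeSub_cone3.2 ⟨gen_mem_planeSub hd v, Submodule.zero_mem _⟩

variable (M) in
/-- The inclusion of `M_{i-j=s}` in `ℛᵣ(M)_{i-j=s}`. -/
def planeInr (r s : ℤ) : M.plane s ⟶ (RObj r M).plane s := planeHom s (cone3Inr (inHom r M))

/-- The map `(∂ₐω ⊗ v, n) ↦ v` from `ℛᵣ(M)_{i-j=t}` to `M_{i-j=r}`. -/
def planeCoeff (M : TriMod.{v} k) (r : ℤ) (a : Fin 3) (t : ℤ) :
    (RObj r M).plane t →ₗ[k] M.plane r :=
  coeffGen a _ ∘ₗ LinearMap.fst k (ext2 (M.plane r)) M ∘ₗ ((RObj r M).planeSub t).subtype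

variable (M) in
/-- The projection of `ℛᵣ(M)_{i-j=s}` to `M_{i-j=s}`. -/
def planeSnd (r s : ℤ) : (RObj r M).plane s →ₗ[k] M.plane s :=
  (LinearMap.snd k (ext2 (M.plane r)) M).restrict fun _ hx => (mem_planeSub_cone3.1 hx).2

theorem planeGen_hasDeg (hd : Dir a b r t) :
    HasDeg (Pi.single a 1 - Pi.single 2 1) (planeGen M hd) := fun n v hv =>
  ⟨mem_gr_congr (gen_hasDeg (a := a) (M.plane r) n v hv) (by abel), Submodule.zero_mem _⟩

theorem planeCoeff_hasDeg (hd : Dir a b r t) :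
    HasDeg (Pi.single 2 1 - Pi.single a 1) (planeCoeff M r a t) := fun n w hw =>
  mem_gr_congr (coeffGen_hasDeg hd (n + Pi.single 2 1) _ hw.1) (by abel)

theorem planeSnd_hasDeg {s : ℤ} : HasDeg 0 (planeSnd M r s) := fun n _ hw =>
  mem_gr_congr (M := M) hw.2 (add_zero n).symm

theorem planeCoeff_gen (hd : Dir a b r t) (v : M.plane r) :
    planeCoeff M r a t (planeGen M hd v) = v := coeffGen_gen hd (flat_plane r M) v

theorem planeCoeff_inr (v : M.plane t) :
    planeCoeff M r a t ((planeInr M r t).lin v) = 0 := map_zero (coeffGen a _)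

theorem planeSnd_gen (hd : Dir a b r t) (v : M.plane r) :
    planeSnd M r t (planeGen M hd v) = 0 := rfl

theorem planeSnd_inr {s : ℤ} (v : M.plane s) :
    planeSnd M r s ((planeInr M r s).lin v) = v := rfl

theorem planeGen_add_inr (hd : Dir a b r t) (w : (RObj r M).plane t) :
    planeGen M hd (planeCoeff M r a t w) + (planeInr M r t).lin (planeSnd M r t w) = w := by
  refine Subtype.ext (Prod.ext ?_ ?_)
  · refine (add_zero _).trans ?_
    exact (eq_gen_of_mem_planeSub hd (mem_planeSub_cone3.1 w.2).1).symm
  · exact zero_add _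

/-- Since `in` sends `∂ₐω ⊗ v` to `∂ₐv`, the plane `t` of `ℛᵣ(M)` is, up to sign conventions, the
`∂₃`-cone of `∂ₐ` from `Mᵣ` to `Mₜ`. -/
theorem planeGen_d_two (hd : Dir a b r t) (v : M.plane r) :
    ((RObj r M).plane t).d 2 (planeGen M hd v) =
      planeGen M hd ((M.plane r).d 2 v) + (planeInr M r t).lin (planeD M hd v) := by
  refine Subtype.ext ?_
  refine (cone3_d_two (inHom r M) (gen a _ v, 0)).trans (Prod.ext ?_ ?_)
  · change -(ext2 (M.plane r)).d 2 (gen a _ v) = gen a _ ((M.plane r).d 2 v) + 0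
    rw [gen_d_two hd.ne_two, neg_neg, add_zero]
  · change (inHom r M).lin (gen a _ v) + M.d 2 0 = 0 + M.d a ((v : M.planeSub r) : M)
    rw [inHom_gen, map_zero, add_zero, zero_add]

theorem planeCoeff_d_two (hd : Dir a b r t) (w : (RObj r M).plane t) :
    planeCoeff M r a t (((RObj r M).plane t).d 2 w) = (M.plane r).d 2 (planeCoeff M r a t w) := by
  change coeffGen a _ (-(ext2 (M.plane r)).d 2
    ((w : (RObj r M).planeSub t) : ext2 (M.plane r) × M).1) = _
  rw [map_neg, coeffGen_d_two hd, neg_neg]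
  rfl

theorem planeSnd_d_two (hd : Dir a b r t) (w : (RObj r M).plane t) :
    planeSnd M r t (((RObj r M).plane t).d 2 w) =
      planeD M hd (planeCoeff M r a t w) + (M.plane t).d 2 (planeSnd M r t w) := by
  refine Subtype.ext ?_
  change (inHom r M).lin ((w : (RObj r M).planeSub t) : ext2 (M.plane r) × M).1 + _ = _
  rw [eq_gen_of_mem_planeSub hd (mem_planeSub_cone3.1 w.2).1, inHom_gen]
  rfl

end Dir

end TriMod

namespace TriMod

variable {k : Type u} [Field k]

/-! ### The plane `i - j = r` of `ℛₜ ℛᵣ(M)` for `t = r ± 1` -/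

section Plane

variable {a b : Fin 3} {r t : ℤ} {M : TriMod.{v} k}

/-- The coefficient of `∂_b∂ₐω` in `ℛᵣ(M)_{i-j=r}`. -/
def planeTop (M : TriMod.{v} k) (r : ℤ) (a : Fin 3) : (RObj r M).plane r →ₗ[k] M.plane r :=
  coeffTop a _ ∘ₗ LinearMap.fst k (ext2 (M.plane r)) M ∘ₗ ((RObj r M).planeSub r).subtype

/-- The coefficient of `ω` in `ℛᵣ(M)_{i-j=r}`. -/
def planeBot (M : TriMod.{v} k) (r : ℤ) (w : (RObj r M).planeSub r) : M.plane r :=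
  (w : ext2 (M.plane r) × M).1.1.1

theorem planeTop_hasDeg (hd : Dir a b r t) :
    HasDeg (Pi.single 2 1 - Pi.single a 1 - Pi.single b 1) (planeTop M r a) := fun n _ hw =>
  mem_gr_congr (coeffTop_hasDeg hd (n + Pi.single 2 1) _ hw.1) (by abel)

theorem planeTop_unit (hd : Dir a b r t) (v : M.plane r) :
    planeTop M r a (RPlaneUnit r M v) = 0 := coeffTop_omega hd v

theorem planeTop_d_two (hd : Dir a b r t) (w : (RObj r M).plane r) :
    planeTop M r a (((RObj r M).plane r).d 2 w) = -(M.plane r).d 2 (planeTop M r a w) := by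
  change coeffTop a _ (-(ext2 (M.plane r)).d 2
    ((w : (RObj r M).planeSub r) : ext2 (M.plane r) × M).1) = _
  rw [map_neg, coeffTop_d_two hd]
  rfl

theorem planeSnd_unit (v : M.plane r) : planeSnd M r r (RPlaneUnit r M v) = 0 := rfl

theorem coe_planeD_RObj (hd : Dir a b r t) {s : ℤ} (w : (RObj s M).planeSub r) :
    ((planeD (RObj s M) hd w : (RObj s M).planeSub t) : ext2 (M.plane s) × M) =
      (-(ext2 (M.plane s)).d a (w : ext2 (M.plane s) × M).1,
        M.d a (w : ext2 (M.plane s) × M).2) :=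
  cone3_d_of_ne (inHom s M) hd.ne_two _

theorem planeD_inr (hd : Dir a b r t) {s : ℤ} (v : M.plane r) :
    planeD (RObj s M) hd ((planeInr M s r).lin v) = (planeInr M s t).lin (planeD M hd v) := by
  refine Subtype.ext ((coe_planeD_RObj hd _).trans (Prod.ext ?_ rfl))
  change -(ext2 (M.plane s)).d a 0 = 0
  rw [map_zero, neg_zero]

theorem planeSnd_planeD (hd : Dir a b r t) {s : ℤ} (w : (RObj s M).plane r) :
    planeSnd M s t (planeD (RObj s M) hd w) = planeD M hd (planeSnd M s r w) :=
  Subtype.ext (congrArg Prod.snd (coe_planeD_RObj hd w))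

theorem planeTop_planeD (hd : Dir a b r t) (w : (RObj r M).plane t) :
    planeTop M r a (planeD (RObj r M) hd.symm w) = -planeCoeff M r a t w := by
  refine (congrArg (fun x : ext2 (M.plane r) × M => coeffTop a _ x.1)
    (coe_planeD_RObj hd.symm w)).trans ?_
  change coeffTop a _ (-(ext2 (M.plane r)).d b
    ((w : (RObj r M).planeSub t) : ext2 (M.plane r) × M).1) = _
  rw [map_neg, eq_gen_of_mem_planeSub hd (mem_planeSub_cone3.1 w.2).1,
    coeffTop_d_gen hd (flat_plane r M)]
  rfl

/-- The plane `r` of `ℛᵣ(M)` is the sum of `ω ⊗ Mᵣ`, `∂_b∂ₐω ⊗ Mᵣ` and `Mᵣ`. The middle term is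
subtracted because `∂_b` acts by `-∂_b` on the first summand of a `∂₃`-cone. -/
theorem planeUnit_add_top_add_inr (hd : Dir a b r t) (w : (RObj r M).plane r) :
    RPlaneUnit r M (planeBot M r w) -
      planeD (RObj r M) hd.symm (planeGen M hd (planeTop M r a w)) +
        (planeInr M r r).lin (planeSnd M r r w) = w := by
  refine Subtype.ext (Prod.ext ?_ ?_)
  · have e := eq_omega_add_of_mem_planeSub hd (mem_planeSub_cone3.1 w.2).1
    refine Eq.trans ?_ e.symm
    have e' := congrArg Prod.fst
      (coe_planeD_RObj hd.symm (planeGen M hd (planeTop M r a w)))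
    refine (add_zero _).trans ?_
    refine (sub_eq_add_neg _ _).trans ?_
    refine congrArg (fun y => omega (M.plane r) (planeBot M r w) + y) ?_
    exact (congrArg Neg.neg e').trans (neg_neg _)
  · have e' := congrArg Prod.snd
      (coe_planeD_RObj hd.symm (planeGen M hd (planeTop M r a w)))
    have e2 : M.d b (0 : M) = 0 := map_zero _
    change (0 : M) - _ + _ = _
    rw [e']
    change (0 : M) - M.d b 0 + _ = _
    rw [e2, sub_zero, zero_add]
    rfl

theorem planeSnd_d_two_self (hd : Dir a b r t) (w : (RObj r M).plane r) :
    planeSnd M r r (((RObj r M).plane r).d 2 w) =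
      planeBot M r w + planeD M hd.symm (planeD M hd (planeTop M r a w)) +
        (M.plane r).d 2 (planeSnd M r r w) := by
  refine Subtype.ext ?_
  change (inHom r M).lin ((w : (RObj r M).planeSub r) : ext2 (M.plane r) × M).1 + _ = _
  rw [eq_omega_add_of_mem_planeSub hd (mem_planeSub_cone3.1 w.2).1, map_add, (inHom r M).map_d,
    inHom_omega, inHom_gen]
  rfl

end Plane

/-! ### A retract of the plane `i - j = r` of `ℛₜ ℛᵣ(M)` -/

section Retract

variable {a b : Fin 3} {r t : ℤ} (M : TriMod.{v} k) (hd : Dir a b r t)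

/-- The module `M_{i-j=t}`, shifted by the degree of `∂_b` minus that of `∂₃`. -/
@[reducible] def shiftPlane (b : Fin 3) (t : ℤ) (M : TriMod.{v} k) : TriMod.{v} k :=
  (M.plane t).shift (Pi.single b 1 - Pi.single 2 1)

theorem shiftPlane_d (b : Fin 3) (t : ℤ) (M : TriMod.{v} k) (s : Fin 3) (x : M.plane t) :
    (shiftPlane b t M).d s x = (M.plane t).d s x := by
  change ((∑ i, (Pi.single b 1 - Pi.single 2 1 : Fin 3 → ℤ) i).negOnePow • (M.plane t).d s) x = _
  have : (∑ i, (Pi.single b 1 - Pi.single 2 1 : Fin 3 → ℤ) i) = 0 := by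
    simp
  rw [this, Int.negOnePow_zero, one_smul]

theorem flat_shiftPlane (b : Fin 3) (t : ℤ) (M : TriMod.{v} k) : Flat (shiftPlane b t M) :=
  ⟨fun x => (shiftPlane_d b t M 0 x).trans ((flat_plane t M).d_zero x),
    fun x => (shiftPlane_d b t M 1 x).trans ((flat_plane t M).d_one x)⟩

/-- The null-homotopy of the complement of the retract. -/
def retractHomotopy :
    (RObj t (RObj r M)).plane r →ₗ[k] (RObj t (RObj r M)).plane r :=
  (planeInr (RObj r M) t r).lin ∘ₗ RPlaneUnit r M ∘ₗ planeSnd M r r ∘ₗ planeSnd (RObj r M) t r -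
    planeGen (RObj r M) hd.symm ∘ₗ planeGen M hd ∘ₗ planeTop M r a ∘ₗ planeSnd (RObj r M) t r

/-- The projection onto the retract. -/
def retractProj : (RObj t (RObj r M)).plane r →ₗ[k] M.plane t :=
  planeSnd M r t ∘ₗ planeCoeff (RObj r M) t b r +
    planeD M hd ∘ₗ planeTop M r a ∘ₗ planeSnd (RObj r M) t r

/-- The inclusion of the retract. -/
def retractIncl : M.plane t →ₗ[k] (RObj t (RObj r M)).plane r :=
  planeGen (RObj r M) hd.symm ∘ₗ (planeInr M r t).lin -
    (planeInr (RObj r M) t r).lin ∘ₗ RPlaneUnit r M ∘ₗ planeD M hd.symm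

theorem retractHomotopy_apply (p : (RObj t (RObj r M)).plane r) :
    retractHomotopy M hd p =
      (planeInr (RObj r M) t r).lin
        (RPlaneUnit r M (planeSnd M r r (planeSnd (RObj r M) t r p))) -
      planeGen (RObj r M) hd.symm (planeGen M hd (planeTop M r a (planeSnd (RObj r M) t r p))) :=
  rfl

theorem retractProj_apply (p : (RObj t (RObj r M)).plane r) :
    retractProj M hd p = planeSnd M r t (planeCoeff (RObj r M) t b r p) +
      planeD M hd (planeTop M r a (planeSnd (RObj r M) t r p)) := rfl

theorem retractIncl_apply (n : M.plane t) :
    retractIncl M hd n = planeGen (RObj r M) hd.symm ((planeInr M r t).lin n) -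
      (planeInr (RObj r M) t r).lin (RPlaneUnit r M (planeD M hd.symm n)) := rfl

theorem retractProj_incl (n : M.plane t) : retractProj M hd (retractIncl M hd n) = n := by
  rw [retractProj_apply, retractIncl_apply, map_sub (planeCoeff (RObj r M) t b r), planeCoeff_gen,
    planeCoeff_inr, sub_zero, planeSnd_inr, map_sub (planeSnd (RObj r M) t r), planeSnd_gen,
    planeSnd_inr, zero_sub, map_neg, planeTop_unit hd, neg_zero, map_zero, add_zero]

theorem retractHomotopy_incl (n : M.plane t) :
    retractHomotopy M hd (retractIncl M hd n) = 0 := by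
  rw [retractHomotopy_apply, retractIncl_apply, map_sub, planeSnd_gen, planeSnd_inr, zero_sub,
    map_neg (planeSnd M r r), map_neg (planeTop M r a), planeTop_unit hd, planeSnd_unit, neg_zero]
  simp only [map_zero, sub_zero]

theorem retractProj_d_two (p : (RObj t (RObj r M)).plane r) :
    retractProj M hd (((RObj t (RObj r M)).plane r).d 2 p) =
      (M.plane t).d 2 (retractProj M hd p) := by
  rw [retractProj_apply, retractProj_apply, planeCoeff_d_two hd.symm, planeSnd_d_two hd,
    planeSnd_d_two hd.symm, map_add (planeTop M r a), planeTop_planeD hd, planeTop_d_two hd,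
    map_add (planeD M hd), map_neg, map_neg, planeD_d_two, map_add ((M.plane t).d 2)]
  abel

theorem RPlaneUnit_d_two' (v : M.plane r) :
    ((RObj r M).plane r).d 2 (RPlaneUnit r M v) =
      (planeInr M r r).lin v - RPlaneUnit r M ((M.plane r).d 2 v) :=
  eq_sub_of_add_eq (RPlaneUnit_d_two v)

theorem retractIncl_d_two (n : M.plane t) :
    retractIncl M hd ((M.plane t).d 2 n) =
      ((RObj t (RObj r M)).plane r).d 2 (retractIncl M hd n) := by
  rw [retractIncl_apply, retractIncl_apply, map_sub, planeGen_d_two hd.symm,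
    ← (planeInr (RObj r M) t r).map_d, RPlaneUnit_d_two', planeD_inr, planeD_d_two,
    map_sub (planeInr (RObj r M) t r).lin, ← (planeInr M r t).map_d, map_neg, map_neg]
  abel

/-- The plane `r` of `ℛₜ ℛᵣ(M)` has five summands: `∂_bω ⊗ ∂ₐω ⊗ Mᵣ`, `∂_bω ⊗ Mₜ`, `ω ⊗ Mᵣ`, `∂_b∂ₐω
⊗ Mᵣ` and `Mᵣ`. Under `∂₃` the third cancels against the fifth and the first against the fourth, so
only the copy of `Mₜ` remains. The second terms of `retractProj` and `retractIncl` are the usual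
corrections of Gaussian elimination. -/
theorem retract_contraction (p : (RObj t (RObj r M)).plane r) :
    p - retractIncl M hd (retractProj M hd p) =
      ((RObj t (RObj r M)).plane r).d 2 (retractHomotopy M hd p) +
        retractHomotopy M hd (((RObj t (RObj r M)).plane r).d 2 p) := by
  have e1 := planeGen_add_inr hd.symm p
  have e2 := planeUnit_add_top_add_inr hd (planeSnd (RObj r M) t r p)
  have e3 := planeGen_add_inr hd (planeCoeff (RObj r M) t b r p)
  rw [retractHomotopy_apply, retractHomotopy_apply, planeSnd_d_two hd.symm,
    map_add (planeSnd M r r), map_add (planeTop M r a), planeSnd_planeD, planeTop_planeD hd,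
    planeTop_d_two hd, planeSnd_d_two_self hd, map_sub (((RObj t (RObj r M)).plane r).d 2),
    planeGen_d_two hd.symm, ← (planeInr (RObj r M) t r).map_d, RPlaneUnit_d_two',
    planeGen_d_two hd, retractIncl_apply, retractProj_apply]
  -- The element `p` is decomposed completely into its five components; after that all terms cancel
  -- formally.
  nth_rw 1 [← e1]
  nth_rw 1 [← e2]
  nth_rw 1 [← e3]
  simp only [map_add, map_sub, map_neg]
  abel

theorem retractHomotopy_hasDeg : HasDeg (-Pi.single 2 1) (retractHomotopy M hd) :=
  fun n p hp => by
    rw [retractHomotopy_apply]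
    refine Submodule.sub_mem _ ((planeInr (RObj r M) t r).map_gr _ _ ?_) ?_
    · refine mem_gr_congr (RPlaneUnit_hasDeg _ _
        (planeSnd_hasDeg _ _ (planeSnd_hasDeg _ _ hp))) (by abel)
    · exact mem_gr_congr (planeGen_hasDeg hd.symm _ _ (planeGen_hasDeg hd _ _
        (planeTop_hasDeg hd _ _ (planeSnd_hasDeg _ _ hp)))) (by abel)

/-- The projection onto the retract, as a morphism. -/
def retractProjHom : (RObj t (RObj r M)).plane r ⟶ shiftPlane b t M where
  lin := retractProj M hd
  map_gr n p hp := by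
    change retractProj M hd p ∈ (M.plane t).gr (n - (Pi.single b 1 - Pi.single 2 1))
    rw [retractProj_apply]
    exact Submodule.add_mem _ (mem_gr_congr (planeSnd_hasDeg _ _
      (planeCoeff_hasDeg hd.symm _ _ hp)) (by abel)) (mem_gr_congr (planeD_hasDeg hd _ _
        (planeTop_hasDeg hd _ _ (planeSnd_hasDeg _ _ hp))) (by abel))
  map_d s p := by
    refine Eq.trans ?_ (shiftPlane_d b t M s _).symm
    by_cases hs : s = 2
    · subst hs
      exact retractProj_d_two M hd p
    · rw [plane_d_of_ne hs, plane_d_of_ne hs, map_zero]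

/-- The inclusion of the retract, as a morphism. -/
def retractInclHom : shiftPlane b t M ⟶ (RObj t (RObj r M)).plane r where
  lin := retractIncl M hd
  map_gr n x hx := by
    change retractIncl M hd x ∈ _
    rw [retractIncl_apply]
    exact Submodule.sub_mem _ (mem_gr_congr (planeGen_hasDeg hd.symm _ _
      ((planeInr M r t).map_gr _ _ hx)) (by abel))
      (mem_gr_congr ((planeInr (RObj r M) t r).map_gr _ _
        (RPlaneUnit_hasDeg _ _ (planeD_hasDeg hd.symm _ _ hx))) (by abel))
  map_d s x := by
    refine (congrArg (retractIncl M hd) (shiftPlane_d b t M s x)).trans ?_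
    by_cases hs : s = 2
    · subst hs
      exact retractIncl_d_two M hd x
    · rw [plane_d_of_ne hs, plane_d_of_ne hs, map_zero]

/-- A model of `ℛᵣ ℛₜ ℛᵣ(M)` in the stable category. -/
@[reducible] def BObj : TriMod.{v} k :=
  cone3 (ext2Map (retractInclHom M hd) ≫ inHom r (RObj t (RObj r M)))

theorem ext2_retract_contraction (x : ext2 ((RObj t (RObj r M)).plane r)) :
    x - (ext2Map (retractInclHom M hd)).lin ((ext2Map (retractProjHom M hd)).lin x) =
      (ext2 ((RObj t (RObj r M)).plane r)).d 2 (oddMap (retractHomotopy M hd) x) +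
        oddMap (retractHomotopy M hd) ((ext2 ((RObj t (RObj r M)).plane r)).d 2 x) := by
  have h := retract_contraction M hd
  rw [oddMap_d_two, ext2Map_apply, ext2Map_apply]
  exact Prod.ext (Prod.ext (h _) (h _)) (Prod.ext (h _) (h _))

/-- The morphism from `ℛᵣ ℛₜ ℛᵣ(M)` to its model. -/
def braidRetract : RObj r (RObj t (RObj r M)) ⟶ BObj M hd :=
  coneRetract (isHomotopy_oddMap (flat_plane _ _) (flat_plane _ _) (retractHomotopy_hasDeg M hd))
    (ext2_retract_contraction M hd)

theorem braidRetract_apply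
    (x : ext2 ((RObj t (RObj r M)).plane r) × RObj t (RObj r M)) :
    (braidRetract M hd).lin x = (((ext2Map (retractProjHom M hd)).lin x.1,
      x.2 + (inHom r (RObj t (RObj r M))).lin (oddMap (retractHomotopy M hd) x.1)) :
        ext2 (shiftPlane b t M) × RObj t (RObj r M)) := rfl

/-- The retraction takes place inside the source `Q ⊗ V` of the outermost cone, with `V` flat. The
freeness required for a stable isomorphism is thus automatic. -/
theorem isIso_braidRetract : IsIso ((toStable k).map (braidRetract M hd)) := by
  have h1 := retractProj_incl M hd
  have h2 := retractHomotopy_incl M hd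
  refine isIso_coneRetract _ _ (fun y => ?_) (fun y => ?_) (contr2 _) (contr2_hasDeg _)
    (adTrace_contr2 (flat_plane _ _))
  · rw [ext2Map_apply, ext2Map_apply]
    exact Prod.ext (Prod.ext (h1 _) (h1 _)) (Prod.ext (h1 _) (h1 _))
  · rw [oddMap_apply, ext2Map_apply]
    exact Prod.ext (Prod.ext (h2 _) ((congrArg Neg.neg (h2 _)).trans neg_zero))
      (Prod.ext ((congrArg Neg.neg (h2 _)).trans neg_zero) (h2 _))

end Retract

end TriMod

namespace TriMod

variable {k : Type u} [Field k]

/-! ### The models of `ℛᵣ ℛₜ ℛᵣ(M)` and `ℛₜ ℛᵣ ℛₜ(M)` are isomorphic -/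

section Model

variable {a b : Fin 3} {r t : ℤ} (M : TriMod.{v} k) (hd : Dir a b r t)

theorem evenMap_omega {V W : TriMod.{v} k} (h : V →ₗ[k] W) (x : V) :
    evenMap h (omega V x) = omega W (h x) := by
  rw [evenMap_apply, omega_apply, omega_apply, map_zero]

theorem oddMap_omega {V W : TriMod.{v} k} (h : V →ₗ[k] W) (x : V) :
    oddMap h (omega V x) = omega W (h x) := by
  rw [oddMap_apply, omega_apply, omega_apply, map_zero, neg_zero]

theorem evenMap_d_two_of_comm {V W : TriMod.{v} k} {h : V →ₗ[k] W}
    (hh : ∀ x, h (V.d 2 x) = W.d 2 (h x)) (x : ext2 V) :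
    evenMap h ((ext2 V).d 2 x) = (ext2 W).d 2 (evenMap h x) := by
  rw [evenMap_d_two (c := 0) fun x => (hh x).trans (add_zero _).symm, oddMap_apply]
  refine add_eq_left.2 ?_
  exact Prod.ext (Prod.ext rfl neg_zero) (Prod.ext neg_zero rfl)

/-- The transformation `inₜ` on `ℛᵣ(M)`, in coordinates. -/
theorem inHom_RObj_eq (hd : Dir a b r t) (u : ext2 ((RObj r M).plane t)) :
    ((inHom t (RObj r M)).lin u : ext2 (M.plane r) × M) =
      ((ext2 (M.plane r)).d a (evenMap (planeCoeff M r a t) u),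
        (inHom t M).lin (evenMap (planeSnd M r t) u)) := by
  have hV := flat_plane t (RObj r M)
  have hW := flat_plane r M
  have hW' := flat_plane t M
  let ψ : ext2 ((RObj r M).plane t) →ₗ[k] RObj r M :=
    ((ext2 (M.plane r)).d a ∘ₗ evenMap (planeCoeff M r a t)).prod
      ((inHom t M).lin ∘ₗ evenMap (planeSnd M r t))
  have hψ : ∀ s : Fin 3, s ≠ 2 → ∀ x, ψ ((ext2 ((RObj r M).plane t)).d s x) =
      (RObj r M).d s (ψ x) := by
    intro s hs x
    refine Eq.trans ?_ (cone3_d_of_ne _ hs _).symm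
    refine Prod.ext ?_ ?_
    · change (ext2 (M.plane r)).d a (evenMap _ _) = -(ext2 (M.plane r)).d s
        ((ext2 (M.plane r)).d a (evenMap _ _))
      rw [evenMap_d_of_ne hV hW _ hs]
      -- The sign of `∂ₛ` on the first summand of the cone is accounted for by anticommutation with
      -- `∂ₐ`; for `s = a` both sides vanish.
      by_cases h : s = a
      · subst h
        rw [(ext2 (M.plane r)).d_sq, neg_zero]
      · rw [(ext2 (M.plane r)).d_anticomm s a _ h, neg_neg]
    · change (inHom t M).lin (evenMap _ _) = M.d s ((inHom t M).lin (evenMap _ _))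
      rw [evenMap_d_of_ne hV hW' _ hs, (inHom t M).map_d]
  -- Both sides commute with `∂₁` and `∂₂`, and `ω ⊗ V` generates `Q ⊗ V` under these, so a
  -- comparison on `ω ⊗ w` is enough.
  refine ext2_lin_ext hV (φ := (inHom t (RObj r M)).lin) (ψ := ψ)
    ((inHom t (RObj r M)).map_d 0) ((inHom t (RObj r M)).map_d 1)
    (hψ 0 (by decide)) (hψ 1 (by decide)) (fun w => ?_) u
  refine (inHom_omega w).trans (Prod.ext ?_ ?_)
  · refine (eq_gen_of_mem_planeSub hd (mem_planeSub_cone3.1 w.2).1).trans ?_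
    change _ = (ext2 (M.plane r)).d a (evenMap _ (omega _ w))
    rw [evenMap_omega]
    rfl
  · change _ = (inHom t M).lin (evenMap _ (omega _ w))
    rw [evenMap_omega, inHom_omega]
    rfl

/-- The inclusion of `M_{i-j=t}` in `ℛᵣ(M)_{i-j=t}`, on the shifted module. -/
def shiftInr : shiftPlane b t M →ₗ[k] (RObj r M).plane t := (planeInr M r t).lin

/-- The operator `∂_b`, on the shifted module. -/
def shiftD : shiftPlane b t M →ₗ[k] M.plane r := planeD M hd.symm

/-- The attaching map of the model, in coordinates. -/
theorem inHom_retractIncl_eq (y : ext2 (shiftPlane b t M)) :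
    ((inHom r (RObj t (RObj r M))).lin ((ext2Map (retractInclHom M hd)).lin y) :
      ext2 ((RObj r M).plane t) × (ext2 (M.plane r) × M)) =
      ((ext2 ((RObj r M).plane t)).d b (evenMap (shiftInr M) y),
        (-oddMap (shiftD M hd) y, 0)) := by
  have hV := flat_shiftPlane b t M
  have hW := flat_plane t (RObj r M)
  have hW' := flat_plane r M
  let ψ : ext2 (shiftPlane b t M) →ₗ[k] RObj t (RObj r M) :=
    ((ext2 ((RObj r M).plane t)).d b ∘ₗ evenMap (shiftInr M)).prod
      ((-oddMap (shiftD M hd)).prod (0 : ext2 (shiftPlane b t M) →ₗ[k] M))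
  have hψ : ∀ s : Fin 3, s ≠ 2 → (∀ x, oddMap (shiftD M hd) ((ext2 (shiftPlane b t M)).d s x) =
      -(ext2 (M.plane r)).d s (oddMap (shiftD M hd) x)) →
      ∀ x, ψ ((ext2 (shiftPlane b t M)).d s x) = (RObj t (RObj r M)).d s (ψ x) := by
    intro s hs ho x
    refine Eq.trans ?_ (cone3_d_of_ne _ hs _).symm
    refine Prod.ext ?_ (Eq.trans (Prod.ext ?_ ?_) (cone3_d_of_ne _ hs _).symm)
    · change (ext2 ((RObj r M).plane t)).d b (evenMap _ _) = -(ext2 ((RObj r M).plane t)).d s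
        ((ext2 ((RObj r M).plane t)).d b (evenMap _ _))
      rw [evenMap_d_of_ne hV hW _ hs]
      by_cases h : s = b
      · subst h
        rw [(ext2 ((RObj r M).plane t)).d_sq, neg_zero]
      · rw [(ext2 ((RObj r M).plane t)).d_anticomm s b _ h, neg_neg]
    · change -oddMap _ _ = -(ext2 (M.plane r)).d s (-oddMap _ _)
      rw [ho, map_neg]
    · exact (map_zero (M.d s)).symm
  refine ext2_lin_ext hV
    (φ := (inHom r (RObj t (RObj r M))).lin ∘ₗ (ext2Map (retractInclHom M hd)).lin) (ψ := ψ)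
    ((ext2Map (retractInclHom M hd) ≫ inHom r (RObj t (RObj r M))).map_d 0)
    ((ext2Map (retractInclHom M hd) ≫ inHom r (RObj t (RObj r M))).map_d 1)
    (hψ 0 (by decide) (oddMap_d_zero hV hW' _)) (hψ 1 (by decide) (oddMap_d_one hV hW' _))
    (fun w => ?_) y
  have e : (ext2Map (retractInclHom M hd)).lin (omega _ w) = omega _ (retractIncl M hd w) :=
    evenMap_omega (retractIncl M hd) w
  have e1 : evenMap (shiftInr M) (omega (shiftPlane b t M) w) =
      omega ((RObj r M).plane t) ((planeInr M r t).lin w) := evenMap_omega _ _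
  have e2 : oddMap (shiftD M hd) (omega (shiftPlane b t M) w) =
      omega (M.plane r) (planeD M hd.symm w) := oddMap_omega _ _
  refine (congrArg (inHom r (RObj t (RObj r M))).lin e).trans ?_
  refine (inHom_omega _).trans (Prod.ext ?_ (Prod.ext ?_ ?_))
  · refine Eq.trans ?_ (congrArg ((ext2 ((RObj r M).plane t)).d b) e1).symm
    exact sub_zero _
  · refine Eq.trans ?_ (congrArg Neg.neg e2).symm
    exact zero_sub _
  · exact sub_zero (0 : M)

/-- The map `v ↦ (∂_bω ⊗ v, 0)`, on the shifted module. -/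
def shiftGen : shiftPlane b t M →ₗ[k] (RObj t M).plane r := planeGen M hd.symm

/-- The map `planeCoeff`, to the shifted module. -/
def shiftCoeff : (RObj r M).plane t →ₗ[k] shiftPlane a r M := planeCoeff M r a t

/-- The isomorphism between the models of `ℛᵣ ℛₜ ℛᵣ(M)` and `ℛₜ ℛᵣ ℛₜ(M)`, as a linear map. -/
def modelLin : ext2 (shiftPlane b t M) × (ext2 ((RObj r M).plane t) × (ext2 (M.plane r) × M)) →ₗ[k]
    ext2 (shiftPlane a r M) × (ext2 ((RObj t M).plane r) × (ext2 (M.plane t) × M)) where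
  toFun x := (evenMap (shiftCoeff M) x.2.1, (evenMap (shiftGen M hd) x.1 +
    evenMap (planeInr M t r).lin x.2.2.1, (evenMap (planeSnd M r t) x.2.1, x.2.2.2)))
  map_add' x y := by
    refine Prod.ext (map_add _ _ _) (Prod.ext ?_ (Prod.ext (map_add _ _ _) rfl))
    refine (congrArg₂ (· + ·) (map_add (evenMap (shiftGen M hd)) _ _)
      (map_add (evenMap (planeInr M t r).lin) _ _)).trans ?_
    exact add_add_add_comm _ _ _ _
  map_smul' c x := by
    refine Prod.ext (map_smul _ _ _) (Prod.ext ?_ (Prod.ext (map_smul _ _ _) rfl))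
    refine (congrArg₂ (· + ·) (map_smul (evenMap (shiftGen M hd)) _ _)
      (map_smul (evenMap (planeInr M t r).lin) _ _)).trans ?_
    exact (smul_add _ _ _).symm

theorem modelLin_apply
    (x : ext2 (shiftPlane b t M) × (ext2 ((RObj r M).plane t) × (ext2 (M.plane r) × M))) :
    modelLin M hd x = (evenMap (shiftCoeff M) x.2.1, (evenMap (shiftGen M hd) x.1 +
      evenMap (planeInr M t r).lin x.2.2.1, (evenMap (planeSnd M r t) x.2.1, x.2.2.2))) := rfl

theorem modelLin_gr (n : Fin 3 → ℤ) (x : BObj M hd) (hx : x ∈ (BObj M hd).gr n) :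
    modelLin M hd x ∈ (BObj M hd.symm).gr n := by
  obtain ⟨h1, h2, h3, h4⟩ := hx
  refine ⟨?_, Submodule.add_mem _ ?_ ?_, ?_, h4⟩
  · have h : HasDeg 0 (shiftCoeff (a := a) (r := r) (t := t) M) := fun n w hw =>
      mem_gr_congr (M := M.plane r) (planeCoeff_hasDeg hd n w hw) (by abel)
    exact mem_gr_congr (evenMap_hasDeg h _ _ h2) (add_zero _)
  · have h : HasDeg 0 (shiftGen M hd) := fun n w hw =>
      mem_gr_congr (planeGen_hasDeg hd.symm _ w hw) (by abel)
    exact mem_gr_congr (evenMap_hasDeg h _ _ h1) (add_zero _)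
  · have h : HasDeg 0 (planeInr M t r).lin := fun n w hw =>
      mem_gr_congr ((planeInr M t r).map_gr _ w hw) (add_zero n).symm
    exact mem_gr_congr (evenMap_hasDeg h _ _ h3) (add_zero _)
  · exact mem_gr_congr (evenMap_hasDeg planeSnd_hasDeg _ _ h2) (add_zero _)

theorem BObj_d_of_ne {s : Fin 3} (hs : s ≠ 2)
    (x : ext2 (shiftPlane b t M) × (ext2 ((RObj r M).plane t) × (ext2 (M.plane r) × M))) :
    ((BObj M hd).d s x :
      ext2 (shiftPlane b t M) × (ext2 ((RObj r M).plane t) × (ext2 (M.plane r) × M))) =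
      (-(ext2 (shiftPlane b t M)).d s x.1, (-(ext2 ((RObj r M).plane t)).d s x.2.1,
        (-(ext2 (M.plane r)).d s x.2.2.1, M.d s x.2.2.2))) := by
  refine (cone3_d_of_ne _ hs _).trans (Prod.ext rfl ?_)
  exact (cone3_d_of_ne _ hs _).trans (Prod.ext rfl (cone3_d_of_ne _ hs _))

/-- All arrows of the model appear here. Further arrows are hidden in `∂₃` of the plane `t` of
`ℛᵣ(M)`, which is itself a cone; the isomorphism of models exchanges hidden and visible arrows. -/
theorem BObj_d_two
    (x : ext2 (shiftPlane b t M) × (ext2 ((RObj r M).plane t) × (ext2 (M.plane r) × M))) :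
    ((BObj M hd).d 2 x :
      ext2 (shiftPlane b t M) × (ext2 ((RObj r M).plane t) × (ext2 (M.plane r) × M))) =
      (-(ext2 (shiftPlane b t M)).d 2 x.1,
        ((ext2 ((RObj r M).plane t)).d b (evenMap (shiftInr M) x.1) +
            -(ext2 ((RObj r M).plane t)).d 2 x.2.1,
          (-oddMap (shiftD M hd) x.1 +
            ((ext2 (M.plane r)).d a (evenMap (planeCoeff M r a t) x.2.1) +
              -(ext2 (M.plane r)).d 2 x.2.2.1),
            0 + ((inHom t M).lin (evenMap (planeSnd M r t) x.2.1) +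
              ((inHom r M).lin x.2.2.1 + M.d 2 x.2.2.2))))) := by
  refine (cone3_d_two _ _).trans (Prod.ext rfl ?_)
  have e1 := inHom_RObj_eq M hd x.2.1
  have e2 := cone3_d_two (inHom r M) x.2.2
  have e3 : ((RObj t (RObj r M)).d 2 x.2 : ext2 ((RObj r M).plane t) × (ext2 (M.plane r) × M)) =
      (-(ext2 ((RObj r M).plane t)).d 2 x.2.1,
        ((ext2 (M.plane r)).d a (evenMap (planeCoeff M r a t) x.2.1) +
            -(ext2 (M.plane r)).d 2 x.2.2.1,
          (inHom t M).lin (evenMap (planeSnd M r t) x.2.1) +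
            ((inHom r M).lin x.2.2.1 + M.d 2 x.2.2.2))) := by
    refine (cone3_d_two (inHom t (RObj r M)) x.2).trans (Prod.ext rfl ?_)
    exact (congrArg₂ (fun p q : ext2 (M.plane r) × M => p + q) e1 e2).trans rfl
  exact (congrArg₂ (fun p q : ext2 ((RObj r M).plane t) × (ext2 (M.plane r) × M) => p + q)
    (inHom_retractIncl_eq M hd x.1) e3).trans rfl

theorem evenMap_eq_self {V W : TriMod.{v} k} {g : W →ₗ[k] V} {h : V →ₗ[k] W}
    (e : ∀ x, g (h x) = x) (x : ext2 V) : evenMap g (evenMap h x) = x :=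
  Prod.ext (Prod.ext (e _) (e _)) (Prod.ext (e _) (e _))

theorem evenMap_eq_zero {V W X : TriMod.{v} k} {g : W →ₗ[k] X} {h : V →ₗ[k] W}
    (e : ∀ x, g (h x) = 0) (x : ext2 V) : evenMap g (evenMap h x) = 0 :=
  Prod.ext (Prod.ext (e _) (e _)) (Prod.ext (e _) (e _))

theorem modelLin_d_of_ne {s : Fin 3} (hs : s ≠ 2)
    (x : ext2 (shiftPlane b t M) × (ext2 ((RObj r M).plane t) × (ext2 (M.plane r) × M))) :
    modelLin M hd ((BObj M hd).d s x) = (BObj M hd.symm).d s (modelLin M hd x) := by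
  refine Eq.trans ?_ (BObj_d_of_ne M hd.symm hs _).symm
  refine (congrArg (modelLin M hd) (BObj_d_of_ne M hd hs x)).trans ?_
  rw [modelLin_apply, modelLin_apply]
  refine Prod.ext ?_ (Prod.ext ?_ (Prod.ext ?_ rfl))
  · change evenMap (shiftCoeff M) (-(ext2 ((RObj r M).plane t)).d s x.2.1) =
      -(ext2 (shiftPlane a r M)).d s (evenMap (shiftCoeff M) x.2.1)
    rw [map_neg, evenMap_d_of_ne (flat_plane _ _) (flat_shiftPlane _ _ _) _ hs]
  · change evenMap (shiftGen M hd) (-(ext2 (shiftPlane b t M)).d s x.1) +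
      evenMap (planeInr M t r).lin (-(ext2 (M.plane r)).d s x.2.2.1) =
      -(ext2 ((RObj t M).plane r)).d s (evenMap (shiftGen M hd) x.1 +
        evenMap (planeInr M t r).lin x.2.2.1)
    rw [map_neg, map_neg, evenMap_d_of_ne (flat_shiftPlane _ _ _) (flat_plane _ _) _ hs,
      evenMap_d_of_ne (flat_plane _ _) (flat_plane _ _) _ hs, map_add, neg_add]
  · change evenMap (planeSnd M r t) (-(ext2 ((RObj r M).plane t)).d s x.2.1) =
      -(ext2 (M.plane t)).d s (evenMap (planeSnd M r t) x.2.1)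
    rw [map_neg, evenMap_d_of_ne (flat_plane _ _) (flat_plane _ _) _ hs]

end Model

end TriMod

namespace TriMod

variable {k : Type u} [Field k]

/-! ### Compatibility of the model isomorphism with `∂₃`, and its inverse. -/

section Model

variable {a b : Fin 3} {r t : ℤ} (M : TriMod.{v} k) (hd : Dir a b r t)

/-- The coefficient of `∂ₐω` vanishes on the included copy of `Mₜ`, so the arrow out of the first
summand is not seen. This agrees with the absence of arrows into the first summand of the other
model. -/
theorem modelLin_d_two_fst (hd : Dir a b r t) (y : ext2 (shiftPlane b t M))
    (u : ext2 ((RObj r M).plane t)) :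
    evenMap (shiftCoeff M) ((ext2 ((RObj r M).plane t)).d b (evenMap (shiftInr M) y) +
      -(ext2 ((RObj r M).plane t)).d 2 u) =
      -(ext2 (shiftPlane a r M)).d 2 (evenMap (shiftCoeff M) u) := by
  rw [map_add, evenMap_d_of_ne (flat_plane _ _) (flat_shiftPlane _ _ _) _ hd.symm.ne_two,
    evenMap_eq_zero (g := shiftCoeff (a := a) M) (h := shiftInr M) (fun x => planeCoeff_inr x), map_zero,
    zero_add,
    map_neg]
  refine congrArg Neg.neg (evenMap_d_two_of_comm (fun w => ?_) u)
  exact (planeCoeff_d_two hd w).trans (shiftPlane_d _ _ _ _ _).symm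

/-- The visible arrow given by `∂_b` on `Mₜ` becomes the hidden one: `v ↦ ∂_bω ⊗ v` fails to commute
with `∂₃` exactly by the included `∂_b v`. -/
theorem modelLin_d_two_snd (y : ext2 (shiftPlane b t M)) (u : ext2 ((RObj r M).plane t))
    (x : ext2 (M.plane r)) :
    evenMap (shiftGen M hd) (-(ext2 (shiftPlane b t M)).d 2 y) +
      evenMap (planeInr M t r).lin (-oddMap (shiftD M hd) y +
        ((ext2 (M.plane r)).d a (evenMap (planeCoeff M r a t) u) + -(ext2 (M.plane r)).d 2 x)) =
      (ext2 ((RObj t M).plane r)).d a (evenMap (shiftInr M) (evenMap (shiftCoeff (a := a) M) u)) +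
        -(ext2 ((RObj t M).plane r)).d 2 (evenMap (shiftGen M hd) y +
          evenMap (planeInr M t r).lin x) := by
  have h1 : evenMap (shiftGen M hd) ((ext2 (shiftPlane b t M)).d 2 y) =
      (ext2 ((RObj t M).plane r)).d 2 (evenMap (shiftGen M hd) y) +
        oddMap (-((planeInr M t r).lin ∘ₗ shiftD M hd)) y := by
    refine evenMap_d_two (fun n => ?_) y
    refine (congrArg (planeGen M hd.symm) (shiftPlane_d b t M 2 n)).trans ?_
    exact eq_add_neg_of_add_eq (planeGen_d_two hd.symm n).symm
  have h2 : oddMap (-((planeInr M t r).lin ∘ₗ shiftD M hd)) y =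
      -evenMap (planeInr M t r).lin (oddMap (shiftD M hd) y) := by
    rw [oddMap_apply, oddMap_apply, evenMap_apply]
    simp
  have h3 : evenMap (planeInr M t r).lin
      ((ext2 (M.plane r)).d a (evenMap (planeCoeff M r a t) u)) =
      (ext2 ((RObj t M).plane r)).d a
        (evenMap (planeInr M t r).lin (evenMap (planeCoeff M r a t) u)) :=
    evenMap_d_of_ne (flat_plane _ _) (flat_plane _ _) _ hd.ne_two _
  have h3' : evenMap (shiftInr M) (evenMap (shiftCoeff (a := a) M) u) =
      evenMap (planeInr M t r).lin (evenMap (planeCoeff M r a t) u) := rfl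
  have h4 : evenMap (planeInr M t r).lin ((ext2 (M.plane r)).d 2 x) =
      (ext2 ((RObj t M).plane r)).d 2 (evenMap (planeInr M t r).lin x) :=
    evenMap_d_two_of_comm ((planeInr M t r).map_d 2) x
  rw [map_neg, h1, h2, map_add (evenMap (planeInr M t r).lin),
    map_add (evenMap (planeInr M t r).lin), map_neg (evenMap (planeInr M t r).lin),
    map_neg (evenMap (planeInr M t r).lin), h3, h3', h4,
    map_add ((ext2 ((RObj t M).plane r)).d 2)]
  abel

theorem evenMap_planeCoeff_snd (y : ext2 (shiftPlane b t M)) (x : ext2 (M.plane r)) :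
    evenMap (planeCoeff M t b r) (evenMap (shiftGen M hd) y + evenMap (planeInr M t r).lin x) =
      y := by
  rw [map_add, evenMap_eq_zero (fun x => planeCoeff_inr x), add_zero]
  exact evenMap_eq_self (fun x => planeCoeff_gen hd.symm x) y

theorem evenMap_planeSnd_snd (y : ext2 (shiftPlane b t M)) (x : ext2 (M.plane r)) :
    evenMap (planeSnd M t r) (evenMap (shiftGen M hd) y + evenMap (planeInr M t r).lin x) =
      x := by
  rw [map_add, evenMap_eq_zero (h := shiftGen M hd) (fun x => planeSnd_gen hd.symm x), zero_add]
  exact evenMap_eq_self (fun x => planeSnd_inr x) x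

/-- Conversely, the hidden arrow `∂ₐ` in the plane `t` of `ℛᵣ(M)` becomes visible in the other
model, and the arrow `∂_b` on `Q` keeps its place between the two copies of `Q ⊗ Mₜ`. -/
theorem modelLin_d_two_trd (y : ext2 (shiftPlane b t M)) (u : ext2 ((RObj r M).plane t))
    (x : ext2 (M.plane r)) :
    evenMap (planeSnd M r t) ((ext2 ((RObj r M).plane t)).d b (evenMap (shiftInr M) y) +
      -(ext2 ((RObj r M).plane t)).d 2 u) =
      -oddMap (shiftD M hd.symm) (evenMap (shiftCoeff M) u) +
        ((ext2 (M.plane t)).d b (evenMap (planeCoeff M t b r)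
          (evenMap (shiftGen M hd) y + evenMap (planeInr M t r).lin x)) +
            -(ext2 (M.plane t)).d 2 (evenMap (planeSnd M r t) u)) := by
  have h1 : evenMap (planeSnd M r t) (evenMap (shiftInr M) y) = y :=
    evenMap_eq_self (fun x => planeSnd_inr x) y
  have h2 : evenMap (planeSnd M r t) ((ext2 ((RObj r M).plane t)).d 2 u) =
      (ext2 (M.plane t)).d 2 (evenMap (planeSnd M r t) u) +
        oddMap (planeD M hd ∘ₗ planeCoeff M r a t) u :=
    evenMap_d_two (fun w => (planeSnd_d_two hd w).trans (add_comm _ _)) u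
  have h3 : oddMap (shiftD M hd.symm) (evenMap (shiftCoeff M) u) =
      oddMap (planeD M hd ∘ₗ planeCoeff M r a t) u := rfl
  rw [evenMap_planeCoeff_snd, map_add, map_neg,
    evenMap_d_of_ne (flat_plane _ _) (flat_plane _ _) _ hd.symm.ne_two, h1, h2, h3]
  abel

theorem modelLin_d_two
    (x : ext2 (shiftPlane b t M) × (ext2 ((RObj r M).plane t) × (ext2 (M.plane r) × M))) :
    modelLin M hd ((BObj M hd).d 2 x) = (BObj M hd.symm).d 2 (modelLin M hd x) := by
  refine Eq.trans ?_ (BObj_d_two M hd.symm _).symm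
  refine (congrArg (modelLin M hd) (BObj_d_two M hd x)).trans ?_
  refine Prod.ext (modelLin_d_two_fst M hd x.1 x.2.1) (Prod.ext
    (modelLin_d_two_snd M hd x.1 x.2.1 x.2.2.1) (Prod.ext
      (modelLin_d_two_trd M hd x.1 x.2.1 x.2.2.1) ?_))
  have e : (inHom r M).lin (evenMap (planeSnd M t r) (modelLin M hd x).2.1) =
      (inHom r M).lin x.2.2.1 := congrArg _ (evenMap_planeSnd_snd M hd x.1 x.2.2.1)
  refine congrArg (fun z => 0 + z) ?_
  refine Eq.trans ?_ (congrArg (fun z => z + ((inHom t M).lin (evenMap (planeSnd M r t) x.2.1) +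
    M.d 2 x.2.2.2)) e).symm
  exact add_left_comm _ _ _

/-- The isomorphism between the models of `ℛᵣ ℛₜ ℛᵣ(M)` and `ℛₜ ℛᵣ ℛₜ(M)`. -/
def modelHom : BObj M hd ⟶ BObj M hd.symm where
  lin := modelLin M hd
  map_gr := modelLin_gr M hd
  map_d s x := by
    by_cases hs : s = 2
    · subst hs
      exact modelLin_d_two M hd x
    · exact modelLin_d_of_ne M hd hs x

/-- The map only regroups summands. One model keeps the unshifted `Mₜ` together with `∂ₐω ⊗ Mᵣ` and
the shifted `Mₜ` apart; the other does the same with the two planes exchanged. Regrouping twice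
gives the identity. -/
theorem modelLin_modelLin
    (x : ext2 (shiftPlane b t M) × (ext2 ((RObj r M).plane t) × (ext2 (M.plane r) × M))) :
    modelLin M hd.symm (modelLin M hd x) = x := by
  refine Prod.ext (evenMap_planeCoeff_snd M hd x.1 x.2.2.1) (Prod.ext ?_ (Prod.ext
    (evenMap_planeSnd_snd M hd x.1 x.2.2.1) rfl))
  have h := planeGen_add_inr (M := M) hd
  exact Prod.ext (Prod.ext (h _) (h _)) (Prod.ext (h _) (h _))

theorem isIso_modelHom : IsIso (modelHom M hd) :=
  isIso_of_lin_bijective _ (Function.bijective_iff_has_inverse.2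
    ⟨modelLin M hd.symm, modelLin_modelLin M hd, modelLin_modelLin M hd.symm⟩)

end Model

end TriMod

namespace TriMod

variable {k : Type u} [Field k]

/-! ### Naturality of the comparison with the model -/

section Naturality

variable {a b : Fin 3} {r t : ℤ} {M N : TriMod.{v} k} (f : M ⟶ N)

/-- The morphism of `∂₃`-cones induced by a commutative square. -/
def cone3Map {A B A' B' : TriMod.{v} k} {g : A ⟶ B} {g' : A' ⟶ B'} (α : A ⟶ A') (β : B ⟶ B')
    (h : ∀ x, g'.lin (α.lin x) = β.lin (g.lin x)) : cone3 g ⟶ cone3 g' where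
  lin := α.lin.prodMap β.lin
  map_gr n x hx := ⟨α.map_gr _ _ hx.1, β.map_gr _ _ hx.2⟩
  map_d s x := by
    obtain ⟨y, n⟩ := x
    by_cases hs : s = 2
    · subst hs
      refine (congrArg (fun y : A × B => ((α.lin y.1, β.lin y.2) : A' × B'))
        (cone3_d_two g (y, n))).trans (Eq.trans ?_ (cone3_d_two g' _).symm)
      refine Prod.ext ?_ ?_
      · exact (map_neg α.lin _).trans (congrArg Neg.neg (α.map_d 2 y))
      · exact (map_add β.lin _ _).trans (congrArg₂ (· + ·) (h y).symm (β.map_d 2 n))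
    · refine (congrArg (fun y : A × B => ((α.lin y.1, β.lin y.2) : A' × B'))
        (cone3_d_of_ne g hs (y, n))).trans (Eq.trans ?_ (cone3_d_of_ne g' hs _).symm)
      refine Prod.ext ?_ (β.map_d s n)
      exact (map_neg α.lin _).trans (congrArg Neg.neg (α.map_d s y))

theorem gen_naturality (v : M.plane r) :
    gen a _ ((planeHom r f).lin v) = (ext2Map (planeHom r f)).lin (gen a _ v) := by
  rw [gen_apply, gen_apply, (ext2Map (planeHom r f)).map_d]
  refine congrArg _ ?_
  rw [ext2Map_apply, omega_apply, omega_apply, map_zero]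

theorem coeffGen_naturality {V W : TriMod.{v} k} (g : V ⟶ W) (x : ext2 V) :
    coeffGen a W ((ext2Map g).lin x) = g.lin (coeffGen a V x) := by
  unfold coeffGen
  split_ifs <;> rfl

theorem coeffTop_naturality {V W : TriMod.{v} k} (g : V ⟶ W) (x : ext2 V) :
    coeffTop a W ((ext2Map g).lin x) = g.lin (coeffTop a V x) := by
  unfold coeffTop
  split_ifs
  · exact (map_neg g.lin _).symm
  · rfl

theorem planeGen_naturality (hd : Dir a b r t) (v : M.plane r) :
    planeGen N hd ((planeHom r f).lin v) = (planeHom t (RMap r f)).lin (planeGen M hd v) :=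
  Subtype.ext (Prod.ext (gen_naturality f v) (map_zero f.lin).symm)

theorem planeInr_naturality (s : ℤ) (v : M.plane s) :
    (planeInr N r s).lin ((planeHom s f).lin v) =
      (planeHom s (RMap r f)).lin ((planeInr M r s).lin v) :=
  Subtype.ext (Prod.ext (map_zero (ext2Map (planeHom r f)).lin).symm rfl)

theorem planeCoeff_naturality (w : (RObj r M).plane t) :
    planeCoeff N r a t ((planeHom t (RMap r f)).lin w) =
      (planeHom r f).lin (planeCoeff M r a t w) :=
  coeffGen_naturality (planeHom r f) ((w : (RObj r M).planeSub t) : ext2 (M.plane r) × M).1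

theorem planeTop_naturality (w : (RObj r M).plane r) :
    planeTop N r a ((planeHom r (RMap r f)).lin w) =
      (planeHom r f).lin (planeTop M r a w) :=
  coeffTop_naturality (planeHom r f) ((w : (RObj r M).planeSub r) : ext2 (M.plane r) × M).1

theorem planeSnd_naturality (s : ℤ) (w : (RObj r M).plane s) :
    planeSnd N r s ((planeHom s (RMap r f)).lin w) = (planeHom s f).lin (planeSnd M r s w) := rfl

theorem planeD_naturality (hd : Dir a b r t) (v : M.plane r) :
    planeD N hd ((planeHom r f).lin v) = (planeHom t f).lin (planeD M hd v) :=
  Subtype.ext (f.map_d a _).symm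

theorem RPlaneUnit_naturality (v : M.plane r) :
    RPlaneUnit r N ((planeHom r f).lin v) = (planeHom r (RMap r f)).lin (RPlaneUnit r M v) := by
  have h := map_zero (planeHom r f).lin
  exact Subtype.ext (Prod.ext (Prod.ext (Prod.ext rfl h.symm) (Prod.ext h.symm h.symm))
    (map_zero f.lin).symm)

variable (hd : Dir a b r t)

theorem retractIncl_naturality (n : M.plane t) :
    retractIncl N hd ((planeHom t f).lin n) =
      (planeHom r (RMap t (RMap r f))).lin (retractIncl M hd n) := by
  rw [retractIncl_apply, retractIncl_apply, map_sub, planeInr_naturality, planeGen_naturality,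
    planeD_naturality, RPlaneUnit_naturality, planeInr_naturality]

theorem retractProj_naturality (p : (RObj t (RObj r M)).plane r) :
    retractProj N hd ((planeHom r (RMap t (RMap r f))).lin p) =
      (planeHom t f).lin (retractProj M hd p) := by
  rw [retractProj_apply, retractProj_apply, map_add, planeCoeff_naturality, planeSnd_naturality,
    planeSnd_naturality, planeTop_naturality, planeD_naturality]

theorem retractHomotopy_naturality (p : (RObj t (RObj r M)).plane r) :
    retractHomotopy N hd ((planeHom r (RMap t (RMap r f))).lin p) =
      (planeHom r (RMap t (RMap r f))).lin (retractHomotopy M hd p) := by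
  rw [retractHomotopy_apply, retractHomotopy_apply, map_sub, planeSnd_naturality,
    planeSnd_naturality, RPlaneUnit_naturality, planeInr_naturality, planeTop_naturality,
    planeGen_naturality, planeGen_naturality]

/-- The morphism of shifted modules induced by a morphism `M ⟶ N`. -/
def shiftPlaneHom (b : Fin 3) (t : ℤ) : shiftPlane b t M ⟶ shiftPlane b t N :=
  (TriMod.shiftFunctor k (Pi.single b 1 - Pi.single 2 1)).map (planeHom t f)

/-- The morphism of models induced by a morphism `M ⟶ N`. -/
def BMap : BObj M hd ⟶ BObj N hd :=
  cone3Map (ext2Map (shiftPlaneHom f b t)) (RMap t (RMap r f)) fun y => by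
    have h := retractIncl_naturality f hd
    refine Eq.trans ?_ (inHom_naturality (RMap t (RMap r f))
      ((ext2Map (retractInclHom M hd)).lin y))
    refine congrArg (inHom r (RObj t (RObj r N))).lin ?_
    exact Prod.ext (Prod.ext (h _) (h _)) (Prod.ext (h _) (h _))

theorem BMap_apply (x : ext2 (shiftPlane b t M) × RObj t (RObj r M)) :
    (BMap f hd).lin x = (((ext2Map (shiftPlaneHom f b t)).lin x.1,
      (RMap t (RMap r f)).lin x.2) : ext2 (shiftPlane b t N) × RObj t (RObj r N)) := rfl

theorem braidRetract_naturality :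
    RMap r (RMap t (RMap r f)) ≫ braidRetract N hd = braidRetract M hd ≫ BMap f hd := by
  have h1 := retractProj_naturality f hd
  have h2 := retractHomotopy_naturality f hd
  refine TriMod.hom_ext fun x => ?_
  rw [comp_lin, comp_lin, LinearMap.comp_apply, LinearMap.comp_apply, RMap_apply,
    braidRetract_apply, braidRetract_apply, BMap_apply]
  refine Prod.ext (Prod.ext (Prod.ext (h1 _) (h1 _)) (Prod.ext (h1 _) (h1 _))) ?_
  refine Eq.trans ?_ (map_add (RMap t (RMap r f)).lin _ _).symm
  refine congrArg (fun z => (RMap t (RMap r f)).lin x.2 + z) ?_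
  refine Eq.trans ?_ (inHom_naturality (RMap t (RMap r f)) _)
  exact congrArg _ (oddMap_ext2Map h2 _)

theorem evenMap_ext2Map {V W V' W' : TriMod.{v} k} {h : V →ₗ[k] W} {h' : V' →ₗ[k] W'} {g : V ⟶ V'}
    {g' : W ⟶ W'} (e : ∀ y, h' (g.lin y) = g'.lin (h y)) (x : ext2 V) :
    evenMap h' ((ext2Map g).lin x) = (ext2Map g').lin (evenMap h x) :=
  Prod.ext (Prod.ext (e _) (e _)) (Prod.ext (e _) (e _))

theorem modelHom_naturality :
    BMap f hd ≫ modelHom N hd = modelHom M hd ≫ BMap f hd.symm := by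
  refine TriMod.hom_ext fun x => ?_
  refine Prod.ext ?_ (Prod.ext ?_ (Prod.ext ?_ rfl))
  · exact evenMap_ext2Map (g := planeHom t (RMap r f)) (g' := shiftPlaneHom f a r)
      (planeCoeff_naturality f) x.2.1
  · refine Eq.trans ?_ (map_add (ext2Map (planeHom r (RMap t f))).lin _ _).symm
    exact congrArg₂ (· + ·)
      (evenMap_ext2Map (g := shiftPlaneHom f b t) (g' := planeHom r (RMap t f))
        (planeGen_naturality f hd.symm) x.1)
      (evenMap_ext2Map (g := planeHom r f) (g' := planeHom r (RMap t f))
        (planeInr_naturality f r) x.2.2.1)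
  · exact evenMap_ext2Map (g := planeHom t (RMap r f)) (g' := planeHom t f)
      (planeSnd_naturality f t) x.2.1

/-- The model of `ℛᵣ ℛₜ ℛᵣ(M)`, as an opaque object. -/
def BMod (M : TriMod.{v} k) : TriMod.{v} k := BObj M hd

/-- The morphism of models induced by a morphism `M ⟶ N`. -/
def BModMap : BMod hd M ⟶ BMod hd N := BMap f hd

/-- The morphism from `ℛᵣ ℛₜ ℛᵣ(M)` to its model. -/
def braidRetractMod (M : TriMod.{v} k) : RMod r (RMod t (RMod r M)) ⟶ BMod hd M := by
  delta RMod BMod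
  exact braidRetract M hd

/-- The isomorphism between the models of `ℛᵣ ℛₜ ℛᵣ(M)` and `ℛₜ ℛᵣ ℛₜ(M)`. -/
def modelMod (M : TriMod.{v} k) : BMod hd M ⟶ BMod hd.symm M := modelHom M hd

theorem BModMap_id (M : TriMod.{v} k) : BModMap (𝟙 M) hd = 𝟙 _ := TriMod.hom_ext fun _ => rfl

theorem BModMap_comp {M N P : TriMod.{v} k} (f : M ⟶ N) (g : N ⟶ P) :
    BModMap (f ≫ g) hd = BModMap f hd ≫ BModMap g hd := TriMod.hom_ext fun _ => rfl

theorem braidRetractMod_naturality :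
    RModMap r (RModMap t (RModMap r f)) ≫ braidRetractMod hd N =
      braidRetractMod hd M ≫ BModMap f hd := by
  delta braidRetractMod BModMap RModMap RMod BMod
  exact braidRetract_naturality f hd

theorem modelMod_naturality :
    BModMap f hd ≫ modelMod hd N = modelMod hd M ≫ BModMap f hd.symm := modelHom_naturality f hd

theorem isIso_braidRetractMod (M : TriMod.{v} k) :
    IsIso ((toStable k).map (braidRetractMod hd M)) := by
  delta braidRetractMod RMod BMod
  exact isIso_braidRetract M hd

theorem isIso_modelMod (M : TriMod.{v} k) : IsIso ((toStable k).map (modelMod hd M)) := by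
  have h : IsIso (modelMod hd M) := isIso_modelHom M hd
  infer_instance

attribute [local irreducible] RMod BMod

/-- The model of `ℛᵣ ℛₜ ℛᵣ`. -/
def BFunctor : TriMod.{v} k ⥤ TriMod.{v} k where
  obj M := BMod hd M
  map f := BModMap f hd
  map_id M := BModMap_id hd M
  map_comp f g := BModMap_comp hd f g

/-- The transformation from `ℛᵣ ℛₜ ℛᵣ` to its model. -/
def braidRetractTrans :
    RFunctor.{v} k r ⋙ RFunctor k t ⋙ RFunctor k r ⟶ BFunctor hd where
  app M := braidRetractMod hd M
  naturality _ _ f := braidRetractMod_naturality f hd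

/-- The transformation between the models of `ℛᵣ ℛₜ ℛᵣ` and `ℛₜ ℛᵣ ℛₜ`. -/
def modelTrans : BFunctor.{v} (k := k) hd ⟶ BFunctor hd.symm where
  app M := modelMod hd M
  naturality _ _ f := modelMod_naturality f hd

theorem isIso_braidRetractTrans (M : TriMod.{v} k) :
    IsIso ((toStable k).map ((braidRetractTrans hd).app M)) := isIso_braidRetractMod hd M

theorem isIso_modelTrans (M : TriMod.{v} k) :
    IsIso ((toStable k).map ((modelTrans hd).app M)) := isIso_modelMod hd M

end Naturality

end TriMod

namespace TriMod

variable {k : Type u} [Field k]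

/-! ### Isomorphisms between functors on the stable category -/

section Lifting

variable {A B C : TriMod.{v} k ⥤ TriMod.{v} k} {F G H : StableCat.{v} k ⥤ StableCat.{v} k}

theorem nonempty_iso_of_trans (α : A ⟶ B) (h : ∀ M, IsIso ((toStable k).map (α.app M))) :
    Nonempty (A ⋙ toStable k ≅ B ⋙ toStable k) :=
  ⟨NatIso.ofComponents (fun M => @asIso _ _ _ _ ((toStable k).map (α.app M)) (h M)) fun f => by
    refine ((toStable k).map_comp _ _).symm.trans (Eq.trans ?_ ((toStable k).map_comp _ _))
    exact congrArg (toStable k).map (α.naturality f)⟩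

/-- The quotient functor is the identity on objects and full, so an isomorphism between restrictions
to `ℳ₃` is already natural on the stable category. -/
theorem nonempty_iso_of_lifts (hF : toStable k ⋙ F = A ⋙ toStable k)
    (hG : toStable k ⋙ G = B ⋙ toStable k)
    (h : Nonempty (A ⋙ toStable k ≅ B ⋙ toStable k)) : Nonempty (F ≅ G) :=
  h.map fun e => CategoryTheory.Quotient.natIsoLift _ (eqToIso hF ≪≫ e ≪≫ (eqToIso hG).symm)

theorem lifts_comp (hF : toStable k ⋙ F = A ⋙ toStable k) (hG : toStable k ⋙ G = B ⋙ toStable k) :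
    toStable k ⋙ F ⋙ G = (A ⋙ B) ⋙ toStable k := by
  rw [← Functor.assoc, hF, Functor.assoc, hG, ← Functor.assoc]

theorem lifts_id : toStable.{v} k ⋙ 𝟭 (StableCat.{v} k) = 𝟭 (TriMod.{v} k) ⋙ toStable k := rfl

/-- The braid relation between the functors `ℛᵣ` and `ℛₜ`, `t = r + 1`. -/
theorem nonempty_braid_iso {a b : Fin 3} {r t : ℤ} (hd : Dir a b r t) :
    Nonempty ((RFunctor.{v} k r ⋙ RFunctor k t ⋙ RFunctor k r) ⋙ toStable k ≅
      (RFunctor.{v} k t ⋙ RFunctor k r ⋙ RFunctor k t) ⋙ toStable k) := by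
  obtain ⟨e1⟩ := nonempty_iso_of_trans (braidRetractTrans.{v} (k := k) hd)
    (isIso_braidRetractTrans hd)
  obtain ⟨e2⟩ := nonempty_iso_of_trans (modelTrans.{v} (k := k) hd) (isIso_modelTrans hd)
  -- The other triple product is reduced by the same retraction, with the two directions exchanged;
  -- its model is the target of `modelTrans`.
  obtain ⟨e3⟩ := nonempty_iso_of_trans (braidRetractTrans.{v} (k := k) hd.symm)
    (isIso_braidRetractTrans hd.symm)
  exact ⟨e1 ≪≫ e2 ≪≫ e3.symm⟩

end Lifting

/-! ### The monoid of exact endofunctors -/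

theorem isExact_id : IsExact (𝟭 (StableCat.{v} k)) := by
  refine ⟨(stableSusp k).rightUnitor ≪≫ (stableSusp k).leftUnitor.symm, fun X Y Z f g h H => ?_⟩
  have e : (𝟭 (StableCat.{v} k)).map h ≫
      ((stableSusp k).rightUnitor ≪≫ (stableSusp k).leftUnitor.symm).hom.app X = h := by
    simp
  rw [e]
  exact H

theorem IsExact.comp {F G : StableCat.{v} k ⥤ StableCat.{v} k} (hF : IsExact F)
    (hG : IsExact G) : IsExact (F ⋙ G) := by
  obtain ⟨ξ, hξ⟩ := hF
  obtain ⟨ζ, hζ⟩ := hG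
  refine ⟨NatIso.ofComponents (fun X => G.mapIso (ξ.app X) ≪≫ ζ.app (F.obj X))
    fun {X Y} f => ?_, fun X Y Z f g h H => ?_⟩
  · have e1 := congrArg G.map (ξ.hom.naturality f)
    have e2 := ζ.hom.naturality (F.map f)
    rw [G.map_comp, G.map_comp] at e1
    change G.map ((stableSusp k ⋙ F).map f) ≫ G.map (ξ.hom.app Y) ≫ ζ.hom.app (F.obj Y) =
      (G.map (ξ.hom.app X) ≫ ζ.hom.app (F.obj X)) ≫ (G ⋙ stableSusp k).map (F.map f)
    rw [← Category.assoc, e1, Category.assoc, Category.assoc]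
    exact congrArg (G.map (ξ.hom.app X) ≫ ·) e2
  · have e := hζ _ _ _ (hξ f g h H)
    rw [G.map_comp, Category.assoc] at e
    exact e

/-- The exact endofunctors of the stable category up to isomorphism. -/
def exactSetoid (k : Type u) [Field k] :
    Setoid {F : StableCat.{v} k ⥤ StableCat.{v} k // IsExact F} where
  r F G := Nonempty (F.1 ≅ G.1)
  iseqv := ⟨fun _ => ⟨Iso.refl _⟩, fun ⟨e⟩ => ⟨e.symm⟩, fun ⟨e⟩ ⟨e'⟩ => ⟨e ≪≫ e'⟩⟩

/-- The isomorphism classes of exact endofunctors of the stable category. -/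
def ExactEnd (k : Type u) [Field k] := _root_.Quotient (exactSetoid.{v} k)

/-- The class of an exact endofunctor. -/
def ExactEnd.mk (F : StableCat.{v} k ⥤ StableCat.{v} k) (hF : IsExact F) : ExactEnd.{v} k :=
  _root_.Quotient.mk (exactSetoid k) ⟨F, hF⟩

theorem ExactEnd.mk_eq_iff {F G : StableCat.{v} k ⥤ StableCat.{v} k} {hF : IsExact F}
    {hG : IsExact G} : ExactEnd.mk F hF = ExactEnd.mk G hG ↔ Nonempty (F ≅ G) :=
  _root_.Quotient.eq (r := exactSetoid k)

/-- The product is composition in the order of the theorem, the left factor being applied last. The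
action asked for carries no coherence conditions, so isomorphism classes retain all that is needed.
-/
instance : Monoid (ExactEnd.{v} k) where
  mul := _root_.Quotient.map₂ (sa := exactSetoid k) (sb := exactSetoid k) (sc := exactSetoid k)
    (fun F G => ⟨G.1 ⋙ F.1, G.2.comp F.2⟩)
    fun _ _ ⟨e⟩ _ _ ⟨e'⟩ => ⟨NatIso.hcomp e' e⟩
  one := ExactEnd.mk (𝟭 _) isExact_id
  mul_assoc := by
    rintro ⟨F⟩ ⟨G⟩ ⟨H⟩
    exact ExactEnd.mk_eq_iff.2 ⟨(Functor.associator _ _ _).symm⟩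
  one_mul := by
    rintro ⟨F⟩
    exact ExactEnd.mk_eq_iff.2 ⟨F.1.rightUnitor⟩
  mul_one := by
    rintro ⟨F⟩
    exact ExactEnd.mk_eq_iff.2 ⟨F.1.leftUnitor⟩

theorem ExactEnd.mk_mul_mk {F G : StableCat.{v} k ⥤ StableCat.{v} k} (hF : IsExact F)
    (hG : IsExact G) : ExactEnd.mk F hF * ExactEnd.mk G hG = ExactEnd.mk (G ⋙ F) (hG.comp hF) :=
  rfl

theorem ExactEnd.one_eq : (1 : ExactEnd.{v} k) = ExactEnd.mk (𝟭 _) isExact_id := rfl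

theorem ExactEnd.exists_rep (x : ExactEnd.{v} k) :
    ∃ (F : StableCat.{v} k ⥤ StableCat.{v} k) (hF : IsExact F), x = ExactEnd.mk F hF := by
  obtain ⟨F⟩ := x
  exact ⟨F.1, F.2, rfl⟩

/-- Exact functors that satisfy the braid relations up to isomorphism define an action of the
braid group. -/
theorem exists_braid_action (F F' : ℤ → (StableCat.{v} k ⥤ StableCat.{v} k))
    (h1 : ∀ r, Nonempty (F r ⋙ F' r ≅ 𝟭 (StableCat.{v} k)))
    (h2 : ∀ r, Nonempty (F' r ⋙ F r ≅ 𝟭 (StableCat.{v} k)))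
    (h3 : ∀ r, Nonempty (F r ⋙ F (r + 1) ⋙ F r ≅ F (r + 1) ⋙ F r ⋙ F (r + 1)))
    (h4 : ∀ r s : ℤ, 1 < |r - s| → Nonempty (F s ⋙ F r ≅ F r ⋙ F s))
    (hF : ∀ r, IsExact (F r)) (hF' : ∀ r, IsExact (F' r)) :
    ∃ Φ : BraidInf → (StableCat.{v} k ⥤ StableCat.{v} k),
      (∀ g, IsExact (Φ g)) ∧ Nonempty (Φ 1 ≅ 𝟭 (StableCat.{v} k)) ∧
      (∀ g h, Nonempty (Φ (g * h) ≅ Φ h ⋙ Φ g)) ∧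
      ∀ r : ℤ, Nonempty (Φ (PresentedGroup.of r) ≅ F r) := by
  -- The class of `F' r` is the inverse, so the values lie in a group and the universal property of
  -- the presentation applies.
  let σ : ℤ → (ExactEnd.{v} k)ˣ := fun r =>
    ⟨ExactEnd.mk (F r) (hF r), ExactEnd.mk (F' r) (hF' r), ExactEnd.mk_eq_iff.2 (h2 r),
      ExactEnd.mk_eq_iff.2 (h1 r)⟩
  have hσ : ∀ w ∈ braidRels, FreeGroup.lift σ w = 1 := by
    rintro w (⟨r, rfl⟩ | ⟨r, s, hrs, rfl⟩)
    · simp only [map_mul, map_inv, FreeGroup.lift_apply_of]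
      refine mul_inv_eq_one.2 (Units.ext ?_)
      exact ExactEnd.mk_eq_iff.2 (h3 r)
    · simp only [map_mul, map_inv, FreeGroup.lift_apply_of]
      refine mul_inv_eq_one.2 (Units.ext ?_)
      exact ExactEnd.mk_eq_iff.2 (h4 r s hrs)
  let ρ : BraidInf →* (ExactEnd.{v} k)ˣ := PresentedGroup.toGroup hσ
  -- A representative is chosen separately for every group element; equalities of classes then turn
  -- into isomorphisms of functors.
  choose Φ hΦ e using fun g => ExactEnd.exists_rep ((ρ g : (ExactEnd.{v} k)ˣ) : ExactEnd.{v} k)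
  refine ⟨Φ, hΦ, ?_, fun g h => ?_, fun r => ?_⟩
  · refine (ExactEnd.mk_eq_iff (hG := isExact_id)).1 ((e 1).symm.trans ?_)
    rw [map_one, Units.val_one, ExactEnd.one_eq]
  · refine (ExactEnd.mk_eq_iff (hG := (hΦ h).comp (hΦ g))).1 ((e (g * h)).symm.trans ?_)
    rw [map_mul, Units.val_mul, e g, e h, ExactEnd.mk_mul_mk]
  · refine (ExactEnd.mk_eq_iff (hG := hF r)).1 ((e _).symm.trans ?_)
    exact congrArg Units.val (PresentedGroup.toGroup.of hσ)

end TriMod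

/-! ### The main theorem. -/

theorem mainTheorem2 (k : Type u) [Field k] :
    ∃ F F' : ℤ → (TriMod.StableCat.{v} k ⥤ TriMod.StableCat.{v} k),
      (∀ r, TriMod.toStable k ⋙ F r = TriMod.R k r ⋙ TriMod.toStable k) ∧
      (∀ r, TriMod.toStable k ⋙ F' r = TriMod.R' k r ⋙ TriMod.toStable k) ∧
      (∀ r, Nonempty (F r ⋙ F' r ≅ 𝟭 (TriMod.StableCat.{v} k))) ∧
      (∀ r, Nonempty (F' r ⋙ F r ≅ 𝟭 (TriMod.StableCat.{v} k))) ∧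
      (∀ r, Nonempty (F r ⋙ F (r + 1) ⋙ F r ≅ F (r + 1) ⋙ F r ⋙ F (r + 1))) ∧
      (∀ r s : ℤ, 1 < |r - s| → Nonempty (F s ⋙ F r ≅ F r ⋙ F s)) ∧
      (∀ r, TriMod.IsExact (F r)) ∧
      (∀ r, TriMod.IsExact (F' r)) ∧
      ∃ Φ : BraidInf → (TriMod.StableCat.{v} k ⥤ TriMod.StableCat.{v} k),
        (∀ g, TriMod.IsExact (Φ g)) ∧
        Nonempty (Φ 1 ≅ 𝟭 (TriMod.StableCat.{v} k)) ∧
        (∀ g h, Nonempty (Φ (g * h) ≅ Φ h ⋙ Φ g)) ∧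
        ∀ r : ℤ, Nonempty (Φ (PresentedGroup.of r) ≅ F r) := by
  let F : ℤ → (TriMod.StableCat.{v} k ⥤ TriMod.StableCat.{v} k) := fun r =>
    TriMod.descend (TriMod.R k r) (TriMod.preservesExact_R r) (TriMod.preservesProjective_R r)
  let F' : ℤ → (TriMod.StableCat.{v} k ⥤ TriMod.StableCat.{v} k) := fun r =>
    TriMod.descend (TriMod.R' k r) (TriMod.preservesExact_R' r) (TriMod.preservesProjective_R' r)
  have eF : ∀ r, TriMod.IsExact (F r) := fun r => TriMod.isExact_descend _ _
  have eF' : ∀ r, TriMod.IsExact (F' r) := fun r => TriMod.isExact_descend _ _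
  have hF : ∀ r, TriMod.toStable k ⋙ F r = TriMod.R k r ⋙ TriMod.toStable k := fun _ => rfl
  have hF' : ∀ r, TriMod.toStable k ⋙ F' r = TriMod.R' k r ⋙ TriMod.toStable k := fun _ => rfl
  clear_value F F'
  have gF : ∀ r, TriMod.toStable k ⋙ F r = TriMod.RFunctor k r ⋙ TriMod.toStable k := fun r =>
    (hF r).trans (congrArg (· ⋙ TriMod.toStable k) (TriMod.R_eq_RFunctor r))
  have gF' : ∀ r, TriMod.toStable k ⋙ F' r = TriMod.RFunctor' k r ⋙ TriMod.toStable k := fun r =>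
    (hF' r).trans (congrArg (· ⋙ TriMod.toStable k) (TriMod.R'_eq_RFunctor' r))
  have h1 : ∀ r, Nonempty (F r ⋙ F' r ≅ 𝟭 (TriMod.StableCat.{v} k)) := fun r =>
    TriMod.nonempty_iso_of_lifts (TriMod.lifts_comp (gF r) (gF' r)) TriMod.lifts_id
      (TriMod.nonempty_iso_of_trans (TriMod.counitTrans k r) (TriMod.isIso_counitTrans r))
  have h2 : ∀ r, Nonempty (F' r ⋙ F r ≅ 𝟭 (TriMod.StableCat.{v} k)) := fun r =>
    TriMod.nonempty_iso_of_lifts (TriMod.lifts_comp (gF' r) (gF r)) TriMod.lifts_id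
      (TriMod.nonempty_iso_of_trans (TriMod.counitTrans' k r) (TriMod.isIso_counitTrans' r))
  have h3 : ∀ r, Nonempty (F r ⋙ F (r + 1) ⋙ F r ≅ F (r + 1) ⋙ F r ⋙ F (r + 1)) := fun r =>
    TriMod.nonempty_iso_of_lifts
      (TriMod.lifts_comp (gF r) (TriMod.lifts_comp (gF (r + 1)) (gF r)))
      (TriMod.lifts_comp (gF (r + 1)) (TriMod.lifts_comp (gF r) (gF (r + 1))))
      -- The operator `∂₁` raises `i - j` by one and `∂₂` lowers it by one, which is the orientation
      -- for `t = r + 1`.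
      (TriMod.nonempty_braid_iso (a := 0) (b := 1) ⟨Or.inl ⟨rfl, rfl, rfl⟩⟩)
  have h4 : ∀ r s : ℤ, 1 < |r - s| → Nonempty (F s ⋙ F r ≅ F r ⋙ F s) := fun r s hrs =>
    TriMod.nonempty_iso_of_lifts (TriMod.lifts_comp (gF s) (gF r))
      (TriMod.lifts_comp (gF r) (gF s))
      (TriMod.nonempty_iso_of_trans (TriMod.commTrans k hrs) (TriMod.isIso_commTrans hrs))
  exact ⟨F, F', hF, hF', h1, h2, h3, h4, eF, eF',
    TriMod.exists_braid_action F F' h1 h2 h3 h4 eF eF'⟩
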